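/- **Conventions.** For a partition $\lambda$ of $n$ let $\chi^\lambda$ be the character of the irreducible representation of $S_n$ over $\mathbb{C}$ given by $\lambda$ (the left ideal of $\mathbb{C}S_n$ generated by a Young symmetrizer of shape $\lambda$), $\dim\lambda$ its dimension, and $\chi^\lambda_\mu$ its value on permutations of cycle type $\mu$. Let $C_\mu\subset S_{|\mu|}$ be the conjugacy class of cycle type $\mu$, also regarded as the class sum in the class algebra $Z\mathbb{C}S_{|\mu|}$. For partitions $\mu,\lambda$ and $k\ge 1$ put $$f_\mu(\lambda)=\binom{|\lambda|}{|\mu|}\,|C_\mu|\,\frac{\chi^\lambda_{\mu\cup 1^{|\lambda|-|\mu|}}}{\dim\lambda}\quad(=0\text{ if }|\lambda|<|\mu|),\qquad \mathbf p_k(\lambda)=\sum_{i\ge1}\Big(\big(\lambda_i-i+\tfrac12\big)^k-\big(-i+\tfrac12\big)^k\Big),$$ and let $\phi$ be the linear map from $\bigoplus_{d\ge0}Z\mathbb{C}S_d$ to functions on partitions with $\phi(C_\mu)=f_\mu$. The completed $k$-cycle is $\overline{(k)}=\phi^{-1}(\mathbf p_k)/k!$. An element $\sum_\mu c_\mu C_\mu$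 of $\bigoplus_d Z\mathbb{C}S_d$ acts on $\mathbb{C}S_n$ by multiplication with $\sum_\mu c_\mu C_\mu^{(n)}$, where $C_\mu^{(n)}\in Z\mathbb{C}S_n$ is the sum, over all $|\mu|$-element subsets $S\subset\{1,\dots,n\}$ and all permutations of $S$ of cycle type $\mu$, of that permutation extended by the identity. Let $p_1,p_2,\dots$ be formal variables, $p_k$ of weight $k$. Let $p:\mathbb{C}S_n\to\mathbb{C}[p_1,p_2,\dots]$ be the linear map sending a permutation with cycle lengths $k_1,\dots,k_s$ to $p_{k_1}\cdots p_{k_s}$. Let $a_{-k}$ be multiplication by $p_k$ and $a_k=k\,\partial/\partial p_k$ for $k\ge1$, $a_0=0$; let $:\,:$ denote normal ordering (multiplications to the left, derivations to the right), and $\zeta(z)=e^{z/2}-e^{-z/2}$. The completed cut-and-join operators $Q_1,Q_2,\dots$ are defined by $$Q_1z+Q_2z^2+\cdots=\frac1{\zeta(z)}\sum_{n\ge1}\frac1{n!}\sum_{\substack{k_1+\dots+k_n=0\\ k_i\in\mathbb{Z}\setminus\{0\}}}\zeta(k_1z)\cdots\zeta(k_nz)\,\frac{:a_{k_1}\cdots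 a_{k_n}:}{k_1\cdots k_n}.$$ For sequences $\mu=(\mu_1,\dots,\mu_m)$, $\nu=(\nu_1,\dots,\nu_n)$ of positive integers and $r,s\ge0$ put $$h^{(r),s}_{\mu,\nu}=\frac1{\prod_i\mu_i\prod_j\nu_j}\sum_{|\lambda|=|\mu|}\chi^\lambda_\mu\Big(\frac{\mathbf p_{r+1}(\lambda)}{(r+1)!}\Big)^{s}\chi^\lambda_\nu\quad\text{if }|\mu|=|\nu|,$$ and $h^{(r),s}_{\mu,\nu}=0$ otherwise, and $$H_{r+1}=\sum_{m,n,s\ge0}\ \sum_{\substack{\mu_1,\dots,\mu_m\ge1\\ \nu_1,\dots,\nu_n\ge1}}h^{(r),s}_{\mu,\nu}\,\frac{\beta^s}{s!}\,\frac{p_{\mu_1}\cdots p_{\mu_m}}{m!}\,\frac{q_{\nu_1}\cdots q_{\nu_n}}{n!}\in\mathbb{C}[[\beta,p_1,p_2,\dots,q_1,q_2,\dots]].$$ **Theorem.** Let $r\ge0$. 1. The completed $(r+1)$-cycle is well defined: there is exactly one $c\in\bigoplus_{d\ge0}Z\mathbb{C}S_d$ with $\phi(c)=\mathbf p_{r+1}/(r+1)!$.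 2. For every $n\ge0$ the map $p$ restricts to a bijection from $Z\mathbb{C}S_n$ onto the space $\mathbb{C}_n[p_1,\dots,p_n]$ of quasi-homogeneous polynomials of weight $n$, and it transforms multiplication by the completed $(r+1)$-cycle into $Q_{r+1}$: for every $x\in Z\mathbb{C}S_n$ one has $\overline{(r+1)}\cdot x\in Z\mathbb{C}S_n$ and $p\big(\overline{(r+1)}\cdot x\big)=Q_{r+1}\,p(x)$. 3. $\displaystyle\frac{\partial H_{r+1}}{\partial\beta}=Q_{r+1}H_{r+1}$, where $Q_{r+1}$ acts in the variables $p_1,p_2,\dots$. -/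

import Mathlib

noncomputable section

namespace CompletedCycles

open Equiv

/-! ### Irreducible characters of the symmetric groups -/

/-- The group algebra `ℂ S_n`. -/
abbrev GroupAlg (n : ℕ) : Type := MonoidAlgebra ℂ (Perm (Fin n))

/-- The parts of a partition in non-increasing order: `λ₁ ≥ λ₂ ≥ ⋯`. -/
def rows {n : ℕ} (l : Nat.Partition n) : List ℕ := l.parts.sort (· ≥ ·)

/-- Row and column (counted from `0`) of the box that carries the entry `i`, when the boxes of a
diagram with the given row lengths are filled with `0, 1, 2, …` row by row. -/
def box : List ℕ → ℕ → ℕ × ℕ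
  | [], i => (0, i)
  | a :: L, i => if i < a then (0, i) else ((box L (i - a)).1 + 1, (box L (i - a)).2)

open Classical in
/-- The Young symmetrizer `c_λ = a_λ b_λ` of the row-by-row tableau of shape `λ`: `a_λ` is the sum
of the permutations preserving every row, `b_λ` the signed sum of those preserving every column. -/
def youngSymmetrizer {n : ℕ} (l : Nat.Partition n) : GroupAlg n :=
  (∑ σ : Perm (Fin n) with ∀ i : Fin n, (box (rows l) (σ i)).1 = (box (rows l) i).1,
      MonoidAlgebra.of ℂ (Perm (Fin n)) σ) *
  (∑ σ : Perm (Fin n) with ∀ i : Fin n, (box (rows l) (σ i)).2 = (box (rows l) i).2,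
      ((Perm.sign σ : ℤ) : ℂ) • MonoidAlgebra.of ℂ (Perm (Fin n)) σ)

/-- The irreducible (Specht) module of `λ`: the left ideal `ℂ S_n · c_λ`. -/
abbrev Specht {n : ℕ} (l : Nat.Partition n) : Ideal (GroupAlg n) :=
  Ideal.span {youngSymmetrizer l}

/-- The irreducible representation of `S_n` given by `λ`: left multiplication on `ℂ S_n · c_λ`. -/
def spechtRep {n : ℕ} (l : Nat.Partition n) : Representation ℂ (Perm (Fin n)) (Specht l) :=
  ((Algebra.lsmul ℂ ℂ (Specht l) : GroupAlg n →ₐ[ℂ] Module.End ℂ (Specht l)) :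
    GroupAlg n →* Module.End ℂ (Specht l)).comp (MonoidAlgebra.of ℂ (Perm (Fin n)))

/-- `dim λ`. -/
def dim {n : ℕ} (l : Nat.Partition n) : ℕ := Module.finrank ℂ (Specht l)

/-- The conjugacy class of `S_n` of the permutations with multiset `m` of cycle lengths (fixed
points included as cycles of length `1`). -/
def conjClass (n : ℕ) (m : Multiset ℕ) : Finset (Perm (Fin n)) :=
  {σ | σ.partition.parts = m}

/-- `χ_m^λ`, the value of the irreducible character of `λ` on the class `m`; it is written as the
mean over the class, on which the character is constant. -/
def chi {n : ℕ} (l : Nat.Partition n) (m : Multiset ℕ) : ℂ :=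
  (∑ σ ∈ conjClass n m, (spechtRep l).character σ) / (conjClass n m).card

/-! ### Completed cycles -/

/-- The set of all partitions, of all sizes. -/
abbrev Part : Type := Σ d : ℕ, Nat.Partition d

/-- The shifted symmetric power sum
`p_k(λ) = ∑_{i ≥ 1} ((λ_i - i + 1/2)^k - (-i + 1/2)^k)`; the terms with `λ_i = 0` vanish. -/
def shiftedPowerSum (k : ℕ) (l : Part) : ℂ :=
  ∑ i ∈ Finset.range (rows l.2).length,
    ((((rows l.2).getD i 0 : ℂ) - ((i : ℂ) + 1) + 1 / 2) ^ k - (-((i : ℂ) + 1) + 1 / 2) ^ k)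

/-- `f_μ(λ) = binom(|λ|, |μ|) |C_μ| χ_μ^λ / dim λ`, where `C_μ ⊆ S_{|μ|}` and in `χ_μ^λ` the
partition `μ` is completed by parts `1` to a partition of `|λ|`. It is `0` for `|λ| < |μ|`, and the
binomial factor is `1` for `|λ| = |μ|`. -/
def f (μ l : Part) : ℂ :=
  (l.1.choose μ.1 : ℂ) * ((conjClass μ.1 μ.2.parts).card : ℂ) *
    chi l.2 (μ.2.parts + Multiset.replicate (l.1 - μ.1) 1) / (dim l.2 : ℂ)

/-- The direct sum of the class algebras `Z ℂ S_d` over `d ≥ 0`, in coordinates with respect to its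
basis of the class sums `C_μ`, `μ` ranging over all partitions. -/
abbrev ClassSpace : Type := Part →₀ ℂ

/-- The linear map `φ`, `C_μ ↦ f_μ`, with values in the functions on partitions. -/
def phi : ClassSpace →ₗ[ℂ] (Part → ℂ) := Finsupp.linearCombination ℂ f

/-- `c` is the completed `k`-cycle `φ⁻¹(p_k) / k!`. -/
def IsCompletedCycle (k : ℕ) (c : ClassSpace) : Prop :=
  phi c = ((k.factorial : ℂ)⁻¹) • shiftedPowerSum k

/-- The element of `ℂ S_n` by which `C_μ` acts: the sum, over the `|μ|`-element subsets `S` of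
`{0, …, n-1}` and over the permutations of `S` of cycle type `μ`, of that permutation extended by
the identity. For `n = |μ|` this is the class sum `C_μ`. -/
def classElt (n : ℕ) (μ : Part) : GroupAlg n :=
  ∑ S ∈ (Finset.univ : Finset (Fin n)).powersetCard μ.1,
    ∑ τ : Perm S with τ.partition.parts = μ.2.parts,
      MonoidAlgebra.of ℂ (Perm (Fin n)) (Perm.ofSubtype τ)

/-- The element of `ℂ S_n` by which an element of `⨁ Z ℂ S_d` acts. -/
def toGroupAlg (n : ℕ) : ClassSpace →ₗ[ℂ] GroupAlg n := Finsupp.linearCombination ℂ (classElt n)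

/-- The map `p`: a permutation with cycle lengths `k₁, …, k_s` goes to `p_{k₁} ⋯ p_{k_s}`. -/
def pMap (n : ℕ) (x : GroupAlg n) : MvPolynomial ℕ+ ℂ :=
  ∑ σ : Perm (Fin n),
    x.coeff σ • (σ.partition.parts.map fun k => MvPolynomial.X k.toPNat').prod

/-! ### The completed cut-and-join operators -/

/-- The coefficientwise sum of a family of power series. It is only used for families in which each
coefficient is nonzero for finitely many members. -/
def formalSum {ι σ : Type} (F : ι → MvPowerSeries σ ℂ) : MvPowerSeries σ ℂ :=
  fun N => ∑ᶠ i, MvPowerSeries.coeff N (F i)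

/-- The operators `a_k` on power series, where the variable `p_k` is `v k`:
`a_{-k} = p_k`, `a_0 = 0`, `a_k = k ∂/∂p_k` for `k ≥ 1`. -/
def a {σ : Type} (v : ℕ+ → σ) : ℤ → Module.End ℂ (MvPowerSeries σ ℂ)
  | Int.ofNat 0 => 0
  | Int.ofNat (k + 1) =>
      ((k + 1 : ℕ) : ℂ) • ((MvPowerSeries.pderiv ℂ (v k.succPNat)).toLinearMap)
  | Int.negSucc k => LinearMap.mulLeft ℂ (MvPowerSeries.X (v k.succPNat))

/-- The normally ordered product `:a_{k₁} ⋯ a_{k_n}:`, multiplications to the left and derivations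
to the right. -/
def normalOrdered {σ : Type} (v : ℕ+ → σ) (k : List ℤ) : Module.End ℂ (MvPowerSeries σ ℂ) :=
  ((k.filter (· < 0)).map (a v)).prod * ((k.filter (0 ≤ ·)).map (a v)).prod

/-- The power series `ζ(t z)` in `z`, where `ζ(z) = e^{z/2} - e^{-z/2}`. -/
def zeta (t : ℂ) : PowerSeries ℂ :=
  PowerSeries.rescale (t / 2) (PowerSeries.exp ℂ) -
    PowerSeries.rescale (-(t / 2)) (PowerSeries.exp ℂ)

/-- The coefficient of `z^j` in
`(1 / ζ(z)) (1 / n!) ζ(k₁ z) ⋯ ζ(k_n z) / (k₁ ⋯ k_n)`. -/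
def cutJoinCoeff (j : ℕ) (k : List ℤ) : ℂ :=
  ((((k.map fun i : ℤ => zeta i).prod : PowerSeries ℂ) : LaurentSeries ℂ) /
      ((zeta 1 : PowerSeries ℂ) : LaurentSeries ℂ)).coeff (j : ℤ) /
    ((k.length.factorial : ℂ) * (k.map fun i : ℤ => (i : ℂ)).prod)

/-- The `j`-th completed cut-and-join operator `Q_j`, i.e. the coefficient of `z^j` in
`(1 / ζ(z)) ∑_{n ≥ 1} (1 / n!) ∑_{k₁ + ⋯ + k_n = 0}
  ζ(k₁ z) ⋯ ζ(k_n z) :a_{k₁} ⋯ a_{k_n}: / (k₁ ⋯ k_n)`,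
applied to a power series. Integer tuples of all lengths `n ≥ 1` are nonempty lists. -/
def Q {σ : Type} (v : ℕ+ → σ) (j : ℕ) (F : MvPowerSeries σ ℂ) : MvPowerSeries σ ℂ :=
  formalSum fun k : {k : List ℤ // k ≠ [] ∧ k.sum = 0} =>
    cutJoinCoeff j k.1 • normalOrdered v k.1 F

/-! ### Double Hurwitz numbers with completed cycles -/

/-- The underlying multiset of natural numbers of a sequence of positive integers. -/
def profile (μ : List ℕ+) : Multiset ℕ := (μ.map fun k => (k : ℕ) : List ℕ)

/-- The disconnected double Hurwitz number `h_{μ,ν}^{(r),s}` with `s` completed `(r+1)`-cycles;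
it is `0` for `|μ| ≠ |ν|`. -/
def hurwitz (r s : ℕ) (μ ν : List ℕ+) : ℂ :=
  if (profile μ).sum = (profile ν).sum then
    (∑ l : Nat.Partition (profile μ).sum,
      chi l (profile μ) *
        (shiftedPowerSum (r + 1) ⟨_, l⟩ / ((r + 1).factorial : ℂ)) ^ s *
        chi l (profile ν)) /
      (((profile μ).prod : ℂ) * ((profile ν).prod : ℂ))
  else 0

/-- The variables `β, p₁, p₂, …, q₁, q₂, …`. -/
inductive HVar : Type
  | β : HVar
  | p : ℕ+ → HVar
  | q : ℕ+ → HVar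

/-- The generating series `H_{r+1}`: the sum, over `s ≥ 0` and over all finite sequences
`μ = (μ₁, …, μ_m)` and `ν = (ν₁, …, ν_n)` of positive integers, of
`h_{μ,ν}^{(r),s} (β^s / s!) (p_{μ₁} ⋯ p_{μ_m} / m!) (q_{ν₁} ⋯ q_{ν_n} / n!)`. -/
def H (r : ℕ) : MvPowerSeries HVar ℂ :=
  formalSum fun x : ℕ × List ℕ+ × List ℕ+ =>
    (hurwitz r x.1 x.2.1 x.2.2 /
        ((x.1.factorial : ℂ) * (x.2.1.length.factorial : ℂ) * (x.2.2.length.factorial : ℂ))) •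
      (MvPowerSeries.X HVar.β ^ x.1 *
        (x.2.1.map fun k => MvPowerSeries.X (HVar.p k)).prod *
        (x.2.2.map fun k => MvPowerSeries.X (HVar.q k)).prod)

end CompletedCycles

end

noncomputable section

namespace CompletedCycles

open Equiv Finset

section

/-! ### Exponent vectors -/

/-! Put t = e^{z/2} and u = e^{-z/2}, so that tu = 1 and ζ(kz) = t^k - u^k. A normally ordered
product depends only on the multiset of its indices, so the factor 1/n! turns the sum over tuples
into an exponential series. Hence 1 + ζ(z) ∑ Q_j z^j is the weight-preserving part V of exp(∑ ζ(kz)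
p_k/k) exp(∑ ζ(kz) ∂/∂p_k), a vertex operator (`coeff_Q_eq_zetaQuot`). The theorem comes down to
diagonalising V in the basis of Schur functions, and this works over any commutative ℂ-algebra with
elements satisfying tu = 1.

Two facts about V suffice. It is self-adjoint for the form in which the p^γ are orthogonal with
square `zee γ`, because each of its summands is a multiplication composed with the adjoint of that
multiplication (`form_vertexOp`). It is triangular on products h_λ of complete symmetric functions:
the diagonal entry is 1 + (t - u) ∑_{i≥0} u^{2i+1} (t^{2λ_{i+1}} - 1), and the other terms involve
lexicographically larger indices (`vertexSum_sub_mem`, `vertexEigen_eq`, `Exceeds.lt`).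

The Schur function of λ is taken, up to a factor, as the image under p of the Young symmetrizer c_λ.
Under p the form becomes the trace of h ↦ x h y on the group algebra (`form_toSer`). Young's row and
column combinatorics then shows that Schur functions of different shapes are orthogonal and that the
one of λ is orthogonal to h_μ for μ lexicographically larger than λ. Self-adjointness and
triangularity together force the Schur functions to be eigenvectors of V (`vertexOp_schur`). Since t
- u = ζ(z), division by ζ(z) leaves the exponential generating function of the shifted power sums,
so Q_j has eigenvalue p_j(λ)/j! (`cutJoin_schur`).

A central element acts on c_λ by a scalar. For the action of c ∈ ⨁ Z ℂS_d this scalar is φ(c)(λ)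
(`phi_eq`), and p carries the multiplication to the operator with the same scalars on Schur
functions (`form_toSer_center_mul`). Therefore multiplication by a completed cycle becomes Q_j, and
c is a completed cycle exactly when its image in each ℂS_n corresponds to Q_j p_1^n
(`isCompletedCycle_iff`). A term of Q_j p_1^n that moves b points carries ζ(z)^b/ζ(z) and vanishes
for b > j + 1, so one finite combination of classes serves all n. This gives existence; uniqueness
is triangularity in the size of the classes.

For the evolution equation, the coefficient of β^s q^ν in H is a combination of Schur functions
whose coefficients contain (p_{r+1}(λ)/(r+1)!)^s / s!. Both ∂/∂β and Q_{r+1} multiply the summand of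
λ by one more eigenvalue. -/

/-- The exponent vectors of monomials in `p₁, p₂, …`. -/
abbrev Expo : Type := ℕ+ →₀ ℕ

/-- The weight of a monomial, `p_k` being of weight `k`. -/
abbrev wt : Expo →+ ℕ := Finsupp.weight fun k : ℕ+ => (k : ℕ)

lemma wt_single (k : ℕ+) (e : ℕ) : wt (Finsupp.single k e) = e * k := by
  simp [wt, Finsupp.weight_single]

lemma wt_apply (α : Expo) : wt α = α.sum fun k e => e * (k : ℕ) := by
  simp [wt, Finsupp.weight_apply]

lemma mul_le_wt (α : Expo) (k : ℕ+) : α k * k ≤ wt α := by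
  by_cases h : k ∈ α.support
  · rw [wt_apply]
    exact Finset.single_le_sum (f := fun k => α k * (k : ℕ)) (fun _ _ => Nat.zero_le _) h
  · simp [Finsupp.notMem_support_iff.mp h]

/-- The order of the centralizer of a permutation with `α k` cycles of length `k` for all `k`. -/
def zee (α : Expo) : ℕ := α.prod fun k e => (k : ℕ) ^ e * e.factorial

lemma zee_pos (α : Expo) : 0 < zee α :=
  Finset.prod_pos fun k _ => Nat.mul_pos (pow_pos k.pos _) (Nat.factorial_pos _)

lemma zee_ne_zero (α : Expo) : (zee α : ℂ) ≠ 0 := by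
  exact_mod_cast (zee_pos α).ne'

@[simp] lemma zee_zero : zee 0 = 1 := by simp [zee]

/-- Finsupp products of functions of the exponents, one exponent being raised. -/
lemma prod_add_single {ι M : Type*} [CommMonoid M] (u : ι → ℕ → M) (hu : ∀ k, u k 0 = 1)
    (α : ι →₀ ℕ) (k : ι) (c : M) (h : u k (α k + 1) = u k (α k) * c) :
    (α + Finsupp.single k 1).prod u = α.prod u * c := by
  classical
  have hs : (α + Finsupp.single k 1).support ⊆ insert k α.support := by
    intro j hj
    by_cases hjk : j = k
    · simp [hjk]
    · simp_all
  rw [Finsupp.prod_of_support_subset _ hs _ (by simp [hu]),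
    Finsupp.prod_of_support_subset α (subset_insert k _) _ (by simp [hu]),
    ← mul_prod_erase _ _ (mem_insert_self k _), ← mul_prod_erase _ _ (mem_insert_self k _)]
  have : ∀ j ∈ (insert k α.support).erase k,
      u j ((α + Finsupp.single k 1 : ι →₀ ℕ) j) = u j (α j) := by
    intro j hj
    rw [Finsupp.add_apply, Finsupp.single_eq_of_ne (ne_of_mem_erase hj), add_zero]
  rw [prod_congr rfl this, Finsupp.add_apply, Finsupp.single_eq_same, h]
  exact mul_right_comm _ _ _

lemma zee_add_single (α : Expo) (k : ℕ+) :
    zee (α + Finsupp.single k 1) = zee α * (k * (α k + 1)) :=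
  prod_add_single _ (by simp) α k _ (by rw [pow_succ, Nat.factorial_succ]; ring)

/-- The finite set of the exponent vectors of weight `n`. -/
def expos (n : ℕ) : Finset Expo :=
  (Finset.Iic (∑ k ∈ Finset.range (n + 1), Finsupp.single k.toPNat' n)).filter fun α => wt α = n

-- If k occurs in a monomial of weight n, then both k and its exponent are at most n; the box used
-- to define `expos` is therefore large enough.
@[simp] lemma mem_expos {n : ℕ} {α : Expo} : α ∈ expos n ↔ wt α = n := by
  refine ⟨fun h => (mem_filter.mp h).2, fun h => mem_filter.mpr ⟨?_, h⟩⟩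
  rw [mem_Iic]
  intro k
  rw [Finsupp.finsetSum_apply]
  have hk := mul_le_wt α k
  rw [h] at hk
  by_cases h0 : α k = 0
  · simp [h0]
  have h1 : (k : ℕ) ≤ n := le_trans (Nat.le_mul_of_pos_left _ (Nat.pos_of_ne_zero h0)) hk
  have h2 : α k ≤ n := le_trans (Nat.le_mul_of_pos_right _ k.pos) hk
  calc α k ≤ Finsupp.single (k : ℕ).toPNat' n k := by simpa using h2
    _ ≤ _ := Finset.single_le_sum (f := fun j : ℕ => Finsupp.single j.toPNat' n k)
        (fun _ _ => Nat.zero_le _) (by simp; omega)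

lemma eq_zero_of_wt {α : Expo} (h : wt α = 0) : α = 0 := by
  ext k
  have := mul_le_wt α k
  rw [h] at this
  simpa using this

lemma expos_zero : expos 0 = {0} := by
  ext α
  simp only [mem_expos, mem_singleton]
  exact ⟨eq_zero_of_wt, fun h => by simp [h]⟩

/-! ### Exponential families -/

variable {R : Type*} [CommRing R] [Algebra ℂ R]

/-- The coefficient of `p^α` in `exp (∑_k x_k p_k / k)`. -/
def expCoeff (x : ℕ → R) (α : Expo) : R :=
  algebraMap ℂ R (zee α : ℂ)⁻¹ * α.prod fun k e => x k ^ e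

@[simp] lemma expCoeff_zero (x : ℕ → R) : expCoeff x 0 = 1 := by simp [expCoeff]

/-- This is the differential equation k ∂E/∂p_k = x_k E of the exponential, read on coefficients. -/
lemma expCoeff_add_single (x : ℕ → R) (α : Expo) (k : ℕ+) :
    ((k * (α k + 1) : ℕ) : R) * expCoeff x (α + Finsupp.single k 1) = x k * expCoeff x α := by
  rw [expCoeff, expCoeff, zee_add_single,
    prod_add_single (fun (k : ℕ+) e => x k ^ e) (by simp) α k (x k) (pow_succ _ _), Nat.cast_mul (zee α),
    mul_inv, map_mul]
  have h : ((k * (α k + 1) : ℕ) : R) * algebraMap ℂ R ((k * (α k + 1) : ℕ) : ℂ)⁻¹ = 1 := by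
    rw [← map_natCast (algebraMap ℂ R), ← map_mul, mul_inv_cancel₀, map_one]
    exact_mod_cast Nat.mul_ne_zero k.ne_zero (Nat.succ_ne_zero _)
  linear_combination (x k * algebraMap ℂ R (zee α : ℂ)⁻¹ * α.prod fun k e => x k ^ e) * h

lemma expCoeff_pow_mul (r : R) (x : ℕ → R) (α : Expo) :
    expCoeff (fun k => r ^ k * x k) α = r ^ wt α * expCoeff x α := by
  rw [expCoeff, expCoeff, wt_apply, Finsupp.sum, ← prod_pow_eq_pow_sum]
  simp only [Finsupp.prod, mul_pow, prod_mul_distrib, ← pow_mul]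
  simp only [mul_comm (_ : ℕ) (α _)]
  ring

/-- The recursion of Newton type for the homogeneous parts of an exponential family. -/
lemma newton_sum {M : Type*} [AddCommGroup M] [Module R M] (x : ℕ → R) (Φ : Expo → M)
    (L : ℕ → M →ₗ[R] M) (hL0 : L 0 = 0)
    (hL : ∀ (k : ℕ+) (β : Expo), L k (Φ β) = Φ (β + Finsupp.single k 1)) (m : ℕ) :
    (m : R) • ∑ β ∈ expos m, expCoeff x β • Φ β =
      ∑ ij ∈ antidiagonal m, x ij.1 • L ij.1 (∑ β ∈ expos ij.2, expCoeff x β • Φ β) := by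
  -- The scalar m is the weight ∑ k β_k, so it can be distributed over the variables that occur in
  -- p^β.
  have lhs : (m : R) • ∑ β ∈ expos m, expCoeff x β • Φ β =
      ∑ β ∈ expos m, ∑ k ∈ β.support, ((β k * k : ℕ) : R) • expCoeff x β • Φ β := by
    rw [smul_sum]
    refine sum_congr rfl fun β hβ => ?_
    rw [← sum_smul, ← Nat.cast_sum]
    congr 2
    rw [← mem_expos.mp hβ, wt_apply]
    rfl
  rw [lhs]
  simp only [map_sum, smul_sum, map_smul]
  rw [sum_sigma', sum_sigma']
  symm
  -- The terms of index 0 vanish and must be discarded before reindexing, because `Nat.toPNat'`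
  -- sends 0 to 1.
  rw [← sum_filter_of_ne (p := fun y => y.1.1 ≠ 0)]
  swap
  · rintro ⟨⟨i, j⟩, β⟩ _ h hi
    simp only at hi
    simp [hi, hL0] at h
  refine sum_bij'
    (fun y _ => ⟨y.2 + Finsupp.single y.1.1.toPNat' 1, y.1.1.toPNat'⟩)
    (fun y _ => ⟨(y.2, m - y.2), y.1 - Finsupp.single y.2 1⟩) ?_ ?_ ?_ ?_ ?_
  · rintro ⟨⟨i, j⟩, β⟩ h
    simp only [mem_filter, mem_sigma, HasAntidiagonal.mem_antidiagonal, mem_expos] at h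
    obtain ⟨⟨h1, h2⟩, h3⟩ := h
    simp only [mem_sigma, mem_expos, map_add, wt_single, Finsupp.mem_support_iff,
      Finsupp.add_apply, Finsupp.single_eq_same]
    rw [Nat.toPNat'_coe, if_pos (Nat.pos_of_ne_zero h3)]
    omega
  · rintro ⟨β, k⟩ h
    simp only [mem_sigma, mem_expos, Finsupp.mem_support_iff] at h
    obtain ⟨h1, h2⟩ := h
    have hle : Finsupp.single k 1 ≤ β := by
      rw [Finsupp.single_le_iff]; omega
    have hw : wt (β - Finsupp.single k 1) + k = m := by
      rw [← h1]
      conv_rhs => rw [← tsub_add_cancel_of_le hle]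
      simp [wt_single]
    simp only [mem_filter, mem_sigma, HasAntidiagonal.mem_antidiagonal, mem_expos]
    have := k.ne_zero
    omega
  · rintro ⟨⟨i, j⟩, β⟩ h
    simp only [mem_filter, mem_sigma, HasAntidiagonal.mem_antidiagonal, mem_expos] at h
    obtain ⟨⟨h1, h2⟩, h3⟩ := h
    have hi : ((i.toPNat' : ℕ+) : ℕ) = i := by
      rw [Nat.toPNat'_coe, if_pos (Nat.pos_of_ne_zero h3)]
    simp only [hi, add_tsub_cancel_right]
    congr
    omega
  · rintro ⟨β, k⟩ h
    simp only [mem_sigma, mem_expos, Finsupp.mem_support_iff] at h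
    obtain ⟨h1, h2⟩ := h
    have hle : Finsupp.single k 1 ≤ β := by
      rw [Finsupp.single_le_iff]; omega
    simp [tsub_add_cancel_of_le hle]
  · rintro ⟨⟨i, j⟩, β⟩ h
    simp only [mem_filter, mem_sigma, HasAntidiagonal.mem_antidiagonal, mem_expos] at h
    obtain ⟨⟨h1, h2⟩, h3⟩ := h
    have hi : ((i.toPNat' : ℕ+) : ℕ) = i := by
      rw [Nat.toPNat'_coe, if_pos (Nat.pos_of_ne_zero h3)]
    have := expCoeff_add_single x β i.toPNat'
    have hL' := hL i.toPNat' β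
    rw [hi] at this hL'
    simp only [Finsupp.add_apply, Finsupp.single_eq_same, hi]
    rw [hL', smul_smul, smul_smul, ← this]
    congr 2
    push_cast
    ring

end

section

variable {R : Type*} [CommRing R] [Algebra ℂ R]

/-- Power series in `p₁, p₂, …` with coefficients in `R`. -/
abbrev Ser (R : Type*) : Type _ := MvPowerSeries ℕ+ R

/-! ### Differential operators with constant coefficients -/

/-- The operator `∏_k (k ∂/∂p_k)^{β_k}`. -/
def diffOp (β : Expo) : Ser R →ₗ[R] Ser R where
  -- The quotient is ∏ k^{β_k} (γ_k + β_k)! / γ_k!, the factor that the derivations produce from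
  -- p^{γ+β}.
  toFun F := fun γ => algebraMap ℂ R ((zee (γ + β) : ℂ) / zee γ) * MvPowerSeries.coeff (γ + β) F
  map_add' F G := by
    ext γ
    simp only [MvPowerSeries.coeff_apply, map_add, mul_add]
    rfl
  map_smul' r F := by
    ext γ
    change algebraMap ℂ R _ * MvPowerSeries.coeff _ (r • F) = r * (algebraMap ℂ R _ * _)
    rw [map_smul, smul_eq_mul, mul_left_comm]

lemma coeff_diffOp (β γ : Expo) (F : Ser R) : MvPowerSeries.coeff γ (diffOp β F) =
    algebraMap ℂ R ((zee (γ + β) : ℂ) / zee γ) * MvPowerSeries.coeff (γ + β) F := rfl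

lemma diffOp_diffOp (α β : Expo) (F : Ser R) : diffOp α (diffOp β F) = diffOp (α + β) F := by
  ext γ
  rw [coeff_diffOp, coeff_diffOp, coeff_diffOp, ← mul_assoc, ← map_mul, add_assoc]
  congr 2
  have := zee_ne_zero (γ + α)
  have := zee_ne_zero γ
  field_simp

@[simp] lemma diffOp_zero (F : Ser R) : diffOp 0 F = F := by
  ext γ
  rw [coeff_diffOp, add_zero, div_self (zee_ne_zero γ), map_one, one_mul]

lemma diffOp_single (k : ℕ+) (F : Ser R) :
    diffOp (Finsupp.single k 1) F = ((k : ℕ) : R) • MvPowerSeries.pderiv R k F := by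
  ext γ
  rw [coeff_diffOp, map_smul, MvPowerSeries.coeff_pderiv, zee_add_single, Nat.cast_mul,
    mul_div_cancel_left₀ _ (zee_ne_zero γ), smul_eq_mul]
  simp only [Nat.cast_mul, map_mul, map_natCast, Nat.cast_add, Nat.cast_one, map_add, map_one]
  ring

/-- The operator `k ∂/∂p_k` for `k ≥ 1`, and `0` for `k = 0`. -/
def diffVar (k : ℕ) : Ser R →ₗ[R] Ser R :=
  if k = 0 then 0 else diffOp (Finsupp.single k.toPNat' 1)

lemma diffVar_mul (k : ℕ) (F G : Ser R) :
    diffVar k (F * G) = diffVar k F * G + F * diffVar k G := by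
  unfold diffVar
  split_ifs
  · simp
  · simp only [diffOp_single, Derivation.leibniz, smul_eq_mul, smul_add]
    rw [add_comm, mul_smul_comm, smul_mul_assoc, mul_comm G]

/-- The variable `p_k` for `k ≥ 1`, and `0` for `k = 0`. -/
def pvar (k : ℕ) : Ser R := if k = 0 then 0 else MvPowerSeries.X k.toPNat'

/-! ### The homogeneous parts of exponentials -/

/-- The part of weight `m` of `exp (∑_k x_k p_k / k)`. -/
def expPart (x : ℕ → R) (m : ℕ) : Ser R :=
  ∑ α ∈ expos m, expCoeff x α • MvPowerSeries.monomial α 1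

/-- The part of weight `m` of `exp (∑_k x_k ∂/∂p_k)`. -/
def expDiff (x : ℕ → R) (m : ℕ) : Ser R →ₗ[R] Ser R :=
  ∑ β ∈ expos m, expCoeff x β • diffOp β

/-- The part of weight `m` of `exp (∑_k x_k / k)`, `x_k` being of weight `k`. -/
def expVal (x : ℕ → R) (m : ℕ) : R := ∑ α ∈ expos m, expCoeff x α

lemma coeff_expPart (x : ℕ → R) (m : ℕ) (γ : Expo) :
    MvPowerSeries.coeff γ (expPart x m) = if wt γ = m then expCoeff x γ else 0 := by
  classical
  simp only [expPart, map_sum, map_smul, MvPowerSeries.coeff_monomial, smul_eq_mul, mul_ite,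
    mul_one, mul_zero]
  rw [sum_ite_eq]
  simp

lemma expPart_zero (x : ℕ → R) : expPart x 0 = 1 := by
  rw [expPart, expos_zero, sum_singleton, expCoeff_zero, one_smul]
  rfl

lemma expDiff_zero (x : ℕ → R) (F : Ser R) : expDiff x 0 F = F := by
  rw [expDiff, expos_zero, sum_singleton, expCoeff_zero, one_smul, diffOp_zero]

lemma expVal_zero (x : ℕ → R) : expVal x 0 = 1 := by
  rw [expVal, expos_zero, sum_singleton, expCoeff_zero]

lemma expPart_pow_mul (r : R) (x : ℕ → R) (m : ℕ) :
    expPart (fun k => r ^ k * x k) m = r ^ m • expPart x m := by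
  ext γ
  rw [map_smul, coeff_expPart, coeff_expPart]
  split_ifs with h
  · rw [expCoeff_pow_mul, h, smul_eq_mul]
  · simp

/-- Such Newton recursions stand in for infinite exponentials: they determine all homogeneous parts
from the part of weight 0. -/
lemma newton_expPart (x : ℕ → R) (m : ℕ) :
    (m : R) • expPart x m = ∑ ij ∈ antidiagonal m, x ij.1 • (pvar ij.1 * expPart x ij.2) := by
  refine newton_sum x (fun α => (MvPowerSeries.monomial α 1 : Ser R))
    (fun k => LinearMap.mulLeft R (pvar k)) ?_ (fun k β => ?_) m
  · ext F; simp [pvar]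
  · simp only [LinearMap.mulLeft_apply, pvar, if_neg k.ne_zero, PNat.coe_toPNat',
      MvPowerSeries.X]
    rw [MvPowerSeries.monomial_mul_monomial, one_mul, add_comm]

lemma newton_expDiff (x : ℕ → R) (m : ℕ) (F : Ser R) :
    (m : R) • expDiff x m F =
      ∑ ij ∈ antidiagonal m, x ij.1 • diffVar ij.1 (expDiff x ij.2 F) := by
  have := newton_sum x (fun α => diffOp α F) diffVar (by simp [diffVar]) (fun k β => ?_) m
  · simpa only [expDiff, LinearMap.sum_apply, LinearMap.smul_apply] using this
  · rw [diffVar, if_neg k.ne_zero, PNat.coe_toPNat', diffOp_diffOp, add_comm]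

lemma newton_expVal (x : ℕ → R) (hx : x 0 = 0) (m : ℕ) :
    (m : R) * expVal x m = ∑ ij ∈ antidiagonal m, x ij.1 * expVal x ij.2 := by
  have := newton_sum x (fun _ => (1 : R)) (fun k => if k = 0 then 0 else LinearMap.id) (by simp)
    (fun k β => by simp) m
  simp only [smul_eq_mul, mul_one] at this
  refine this.trans (sum_congr rfl fun ij _ => ?_)
  split_ifs with h
  · simp [h, hx]
  · rfl

/-! ### Sequences determined by a Newton recursion -/

section Uniqueness

variable {M : Type*} [AddCommGroup M] [Module R M]

lemma eq_of_natCast_smul_eq {m : ℕ} (hm : m ≠ 0) {x y : M} (h : (m : R) • x = (m : R) • y) :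
    x = y := by
  have hu : algebraMap ℂ R (m : ℂ)⁻¹ * (m : R) = 1 := by
    rw [← map_natCast (algebraMap ℂ R), ← map_mul, inv_mul_cancel₀ (by exact_mod_cast hm), map_one]
  rw [← one_smul R x, ← one_smul R y, ← hu, mul_smul, mul_smul, h]

/-- The summand with `L 0` is zero, so m times the m-th term is expressed through earlier terms, and
m is invertible in a ℂ-algebra. Exponential identities are proved by checking that both sides
satisfy the same recursion. -/
lemma newton_unique (L : ℕ → M →ₗ[R] M) (hL : L 0 = 0) {a b : ℕ → M} (h0 : a 0 = b 0)
    (ha : ∀ m : ℕ, (m : R) • a m = ∑ ij ∈ antidiagonal m, L ij.1 (a ij.2))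
    (hb : ∀ m : ℕ, (m : R) • b m = ∑ ij ∈ antidiagonal m, L ij.1 (b ij.2)) (m : ℕ) : a m = b m := by
  induction m using Nat.strong_induction_on with
  | _ m ih =>
    rcases eq_or_ne m 0 with rfl | hm
    · exact h0
    refine eq_of_natCast_smul_eq (R := R) hm ?_
    rw [ha, hb]
    refine sum_congr rfl fun ij hij => ?_
    rw [HasAntidiagonal.mem_antidiagonal] at hij
    rcases eq_or_ne ij.1 0 with h | h
    · simp [h, hL]
    · rw [ih _ (by omega)]

end Uniqueness

/-- Both double sums run over the triples of natural numbers with sum m. -/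
lemma sum_antidiagonal_rotate {M : Type*} [AddCommMonoid M] (u : ℕ → ℕ → ℕ → M) (m : ℕ) :
    ∑ ij ∈ antidiagonal m, ∑ ab ∈ antidiagonal ij.2, u ij.1 ab.1 ab.2 =
      ∑ cb ∈ antidiagonal m, ∑ ia ∈ antidiagonal cb.1, u ia.1 ia.2 cb.2 := by
  rw [sum_sigma', sum_sigma']
  refine sum_bij' (fun y _ => ⟨(y.1.1 + y.2.1, y.2.2), (y.1.1, y.2.1)⟩)
    (fun y _ => ⟨(y.2.1, y.2.2 + y.1.2), (y.2.2, y.1.2)⟩) ?_ ?_ ?_ ?_ ?_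
  all_goals
    rintro ⟨⟨i, j⟩, ⟨a, b⟩⟩ h
    simp only [mem_sigma, HasAntidiagonal.mem_antidiagonal] at h
  · simp only [mem_sigma, HasAntidiagonal.mem_antidiagonal, and_true]; omega
  · simp only [mem_sigma, HasAntidiagonal.mem_antidiagonal, and_true]; omega
  · rw [← h.2]
  · rw [← h.2]
  · rfl

lemma sum_antidiagonal_swap_inner {M : Type*} [AddCommMonoid M] (u : ℕ → ℕ → ℕ → M) (m : ℕ) :
    ∑ ij ∈ antidiagonal m, ∑ ab ∈ antidiagonal ij.2, u ij.1 ab.1 ab.2 =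
      ∑ ac ∈ antidiagonal m, ∑ ib ∈ antidiagonal ac.2, u ib.1 ac.1 ib.2 := by
  rw [sum_antidiagonal_rotate, sum_antidiagonal_rotate fun a i b => u i a b]
  refine sum_congr rfl fun cb _ => ?_
  rw [← Finset.Nat.sum_antidiagonal_swap]
  rfl

/-- `exp (∑_k x_k ∂/∂p_k)` is multiplicative. -/
lemma expDiff_mul (x : ℕ → R) (F G : Ser R) (m : ℕ) : expDiff x m (F * G) =
    ∑ ij ∈ antidiagonal m, expDiff x ij.1 F * expDiff x ij.2 G := by
  refine newton_unique (fun k => x k • diffVar k) (by simp [diffVar])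
    (a := fun m => expDiff x m (F * G)) (b := fun m => ∑ ij ∈ antidiagonal m,
      expDiff x ij.1 F * expDiff x ij.2 G) (by simp [expDiff_zero])
    (fun m => newton_expDiff x m _) (fun m => ?_) m
  -- Writing m = i + j lets each factor use its own recursion, as for a derivation applied to a
  -- product.
  have hl : (m : R) • ∑ ij ∈ antidiagonal m, expDiff x ij.1 F * expDiff x ij.2 G =
      ∑ ij ∈ antidiagonal m, (((ij.1 : R) • expDiff x ij.1 F) * expDiff x ij.2 G +
        expDiff x ij.1 F * ((ij.2 : R) • expDiff x ij.2 G)) := by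
    rw [smul_sum]
    refine sum_congr rfl fun ij hij => ?_
    rw [HasAntidiagonal.mem_antidiagonal] at hij
    rw [← hij, Nat.cast_add, add_smul, smul_mul_assoc, mul_smul_comm]
  rw [hl]
  simp only [newton_expDiff, LinearMap.smul_apply, map_sum, diffVar_mul, smul_add,
    sum_add_distrib, sum_mul, mul_sum]
  congr 1
  · rw [sum_antidiagonal_rotate fun i a b =>
      x i • (diffVar i (expDiff x a F) * expDiff x b G)]
    simp only [smul_mul_assoc]
  · rw [sum_antidiagonal_swap_inner fun i a b =>
      x i • (expDiff x a F * diffVar i (expDiff x b G))]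
    simp only [mul_smul_comm]

/-- The exponential law for the homogeneous parts of exponentials. -/
lemma sum_expPart_mul_expPart (x y : ℕ → R) (m : ℕ) :
    ∑ ij ∈ antidiagonal m, expPart x ij.1 * expPart y ij.2 = expPart (fun k => x k + y k) m := by
  refine newton_unique (fun k => LinearMap.mulLeft R ((x k + y k) • pvar k))
    (by ext; simp [pvar])
    (a := fun m => ∑ ij ∈ antidiagonal m, expPart x ij.1 * expPart y ij.2) (b := expPart _)
    (by simp [expPart_zero]) (fun m => ?_) (fun m => ?_) m
  · have hl : (m : R) • ∑ ij ∈ antidiagonal m, expPart x ij.1 * expPart y ij.2 =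
        ∑ ij ∈ antidiagonal m, (((ij.1 : R) • expPart x ij.1) * expPart y ij.2 +
          expPart x ij.1 * ((ij.2 : R) • expPart y ij.2)) := by
      rw [smul_sum]
      refine sum_congr rfl fun ij hij => ?_
      rw [HasAntidiagonal.mem_antidiagonal] at hij
      rw [← hij, Nat.cast_add, add_smul, smul_mul_assoc, mul_smul_comm]
    rw [hl]
    simp only [newton_expPart]
    simp only [LinearMap.mulLeft_apply, add_smul, add_mul]
    rw [sum_add_distrib, sum_add_distrib]
    simp only [sum_mul, mul_sum]
    refine congrArg₂ (· + ·) ?_ ?_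
    · rw [sum_antidiagonal_rotate fun i a b =>
        x i • pvar i * (expPart x a * expPart y b)]
      simp only [smul_mul_assoc, mul_assoc]
    · rw [sum_antidiagonal_swap_inner fun i a b =>
        y i • pvar i * (expPart x a * expPart y b)]
      simp only [smul_mul_assoc, mul_smul_comm, mul_left_comm (pvar _)]
  · simpa only [LinearMap.mulLeft_apply, smul_mul_assoc] using newton_expPart _ m

/-! ### Complete homogeneous symmetric functions -/

/-- The complete homogeneous symmetric function `h_n`. -/
def complete (R : Type*) [CommRing R] [Algebra ℂ R] (n : ℕ) : Ser R := expPart (fun _ => 1) n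

lemma coeff_complete (n : ℕ) (γ : Expo) : MvPowerSeries.coeff γ (complete R n) =
    if wt γ = n then algebraMap ℂ R (zee γ : ℂ)⁻¹ else 0 := by
  rw [complete, coeff_expPart]
  simp [expCoeff, Finsupp.prod]

lemma complete_zero : complete R 0 = 1 := expPart_zero _

/-- The coefficient of p^γ in h_n is 1 / `zee γ`, which cancels the factor in `diffOp`. The result
depends on β only through its weight. -/
lemma diffOp_complete (β : Expo) (n : ℕ) :
    diffOp β (complete R n) = if wt β ≤ n then complete R (n - wt β) else 0 := by
  ext γ
  rw [coeff_diffOp, coeff_complete, map_add]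
  have h1 := zee_ne_zero γ
  have h2 := zee_ne_zero (γ + β)
  split_ifs with h3 h4 h4
  · rw [coeff_complete, if_pos (by omega), ← map_mul]
    congr 1
    field_simp
  · omega
  · rw [coeff_complete, if_neg (by omega), mul_zero]
  · simp

/-- All monomial operators of weight m act alike on h_n, so the exponential acts through the sum of
its coefficients. -/
lemma expDiff_complete (x : ℕ → R) (m n : ℕ) : expDiff x m (complete R n) =
    if m ≤ n then expVal x m • complete R (n - m) else 0 := by
  rw [expDiff, LinearMap.sum_apply, expVal, sum_smul]
  have : ∀ β ∈ expos m, (expCoeff x β • diffOp β) (complete R n) =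
      if m ≤ n then expCoeff x β • complete R (n - m) else 0 := by
    intro β hβ
    rw [LinearMap.smul_apply, diffOp_complete, mem_expos.mp hβ]
    split_ifs <;> simp
  rw [sum_congr rfl this]
  split_ifs <;> simp

end

section

variable {R : Type*} [CommRing R] [Algebra ℂ R]

/-! ### The vertex operator on products of complete symmetric functions -/

/-- The sequence `t^k - u^k`; it is used with `u = t⁻¹`. -/
def powDiff (t u : R) (k : ℕ) : R := t ^ k - u ^ k

variable {t u : R}

lemma pow_mul_pow_eq_one {A : Type*} [CommMonoid A] {t u : A} (htu : t * u = 1) (n : ℕ) : t ^ n * u ^ n = 1 := by rw [← mul_pow, htu, one_pow]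

/-- The generating function exp(∑ (t^k - u^k) w^k / k) equals (1 - uw)/(1 - tw), and t^m - u t^{m-1}
= (1 - u²) t^m because tu = 1. The proof checks the Newton recursion. -/
lemma expVal_powDiff (htu : t * u = 1) (m : ℕ) :
    expVal (powDiff t u) m = if m = 0 then 1 else (1 - u ^ 2) * t ^ m := by
  refine newton_unique (R := R) (fun k => LinearMap.mulLeft R (powDiff t u k))
    (by ext; simp [powDiff]) (a := expVal _)
    (b := fun m => if m = 0 then (1 : R) else (1 - u ^ 2) * t ^ m) (by simp [expVal_zero])
    (fun m => newton_expVal _ (by simp [powDiff]) m) (fun m => ?_) m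
  rw [Nat.sum_antidiagonal_eq_sum_range_succ
    (fun i j => LinearMap.mulLeft R (powDiff t u i) (if j = 0 then (1 : R) else (1 - u ^ 2) * t ^ j)),
    sum_range_succ]
  -- The products t^i t^{m-i} are constant and the products u^i t^{m-i} = u^{2i} t^m form a
  -- geometric series.
  have key : ∀ n ≤ m, ∑ i ∈ range n, LinearMap.mulLeft R (powDiff t u i)
      (if m - i = 0 then (1 : R) else (1 - u ^ 2) * t ^ (m - i)) =
      n * ((1 - u ^ 2) * t ^ m) - t ^ m * (1 - u ^ (2 * n)) := by
    intro n
    induction n with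
    | zero => simp
    | succ n ih =>
      intro hn
      rw [sum_range_succ, ih (by omega), if_neg (by omega), LinearMap.mulLeft_apply, powDiff]
      obtain ⟨d, rfl⟩ : ∃ d, m = n + d := ⟨m - n, by omega⟩
      rw [Nat.add_sub_cancel_left]
      have := pow_mul_pow_eq_one htu n
      push_cast
      linear_combination ((1 - u ^ 2) * t ^ d * u ^ n) * this
  rw [key m le_rfl]
  rcases eq_or_ne m 0 with rfl | hm
  · simp [powDiff]
  · rw [if_neg hm]
    have := pow_mul_pow_eq_one htu m
    simp only [Nat.sub_self, if_true, LinearMap.mulLeft_apply, powDiff, smul_eq_mul]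
    linear_combination (-u ^ m) * this

/-- The relation between the vertex operator coefficients and the complete symmetric functions. -/
lemma sum_expPart_powDiff_mul_complete (htu : t * u = 1) (n k : ℕ) :
    ∑ i ∈ range (n + 1), t ^ i • (expPart (powDiff t u) (k + i) * complete R (n - i)) +
      ∑ j ∈ range k, (u ^ k * t ^ j) • (expPart (powDiff t u) j * complete R (n + k - j)) =
    (u ^ k * t ^ (2 * (n + k))) • complete R (n + k) := by
  -- Since t^k (t^k - u^k) + 1 = t^{2k}, the exponential law expresses the complete series at t²w as
  -- a product. Its part of weight k + n is split at index k and multiplied by u^k.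
  have h := sum_expPart_mul_expPart (fun k => t ^ k * powDiff t u k) (fun _ => (1 : R)) (k + n)
  have h1 : (fun k => t ^ k * powDiff t u k + 1) = fun k => (t ^ 2) ^ k * 1 := by
    funext k
    have := pow_mul_pow_eq_one htu k
    rw [powDiff]
    linear_combination -this
  rw [h1, expPart_pow_mul (t ^ 2), Nat.sum_antidiagonal_eq_sum_range_succ
    (fun i j => expPart (fun k => t ^ k * powDiff t u k) i * expPart (fun _ => (1 : R)) j),
    Nat.succ_eq_add_one, add_assoc, sum_range_add] at h
  simp only [expPart_pow_mul, smul_mul_assoc] at h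
  have h2 := congrArg (fun y => u ^ k • y) h
  simp only [smul_add, smul_sum, smul_smul] at h2
  rw [add_comm, add_comm n k, pow_mul]
  refine Eq.trans (congrArg₂ (· + ·) rfl (sum_congr rfl fun i _ => ?_)) h2
  rw [Nat.add_sub_add_left, pow_add, ← mul_assoc, mul_comm (u ^ k), pow_mul_pow_eq_one htu, one_mul]
  rfl

/-- The product of the complete symmetric functions with the given indices. -/
def completeProd (R : Type*) [CommRing R] [Algebra ℂ R] (μ : Multiset ℕ) : Ser R :=
  (μ.map (complete R)).prod

lemma completeProd_cons (n : ℕ) (μ : Multiset ℕ) :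
    completeProd R (n ::ₘ μ) = complete R n * completeProd R μ := by
  simp [completeProd]

lemma expDiff_completeProd_eq_zero (x : ℕ → R) (L : List ℕ) {m : ℕ} (hm : L.sum < m) :
    expDiff x m (completeProd R L) = 0 := by
  induction L generalizing m with
  | nil =>
    have h0 : completeProd R (([] : List ℕ) : Multiset ℕ) = complete R 0 := by
      simp [completeProd, complete_zero]
    rw [h0, expDiff_complete, if_neg]
    simp only [List.sum_nil] at hm
    omega
  | cons n L ih =>
    rw [← Multiset.cons_coe, completeProd_cons, expDiff_mul]
    refine sum_eq_zero fun ij hij => ?_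
    rw [HasAntidiagonal.mem_antidiagonal] at hij
    rw [List.sum_cons] at hm
    rcases le_or_gt ij.1 n with h | h
    · rw [ih (by omega), mul_zero]
    · rw [expDiff_complete, if_neg (by omega), zero_mul]

/-- The `k`-th mode of the vertex operator on the product of the complete symmetric functions
with indices `L`, in expanded form. -/
def vertexSum (t u : R) : List ℕ → ℕ → Ser R
  | [], k => expPart (powDiff t u) k
  | n :: L, k => ∑ i ∈ range (n + 1),
      expVal (powDiff t u) i • (complete R (n - i) * vertexSum t u L (k + i))

lemma sum_range_antidiagonal {M : Type*} [AddCommMonoid M] (v : ℕ → ℕ → M) (n N : ℕ)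
    (hv : ∀ i j, n < i ∨ N < j → v i j = 0) :
    ∑ m ∈ range (n + N + 1), ∑ ij ∈ antidiagonal m, v ij.1 ij.2 =
      ∑ i ∈ range (n + 1), ∑ j ∈ range (N + 1), v i j := by
  rw [← sum_product', ← sum_fiberwise_of_maps_to (t := range (n + N + 1))
    (g := fun ij : ℕ × ℕ => ij.1 + ij.2)]
  · refine sum_congr rfl fun m _ => (sum_subset ?_ ?_).symm
    · intro ij
      simp
    · intro ij h1 h2
      refine hv _ _ ?_
      simp only [mem_filter, mem_product, mem_range, HasAntidiagonal.mem_antidiagonal] at h1 h2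
      by_contra hc
      exact h2 ⟨by omega, h1⟩
  · intro ij
    simp only [mem_product, mem_range]
    omega

/-- The derivation half is multiplicative and turns h_n into multiples of h_{n-i}. Peeling off one
factor at a time moves the weight i it loses into the index of the multiplication half. -/
lemma vertexSum_eq (L : List ℕ) (k : ℕ) :
    ∑ m ∈ range (L.sum + 1), expPart (powDiff t u) (k + m) *
      expDiff (powDiff t u) m (completeProd R L) = vertexSum t u L k := by
  induction L generalizing k with
  | nil => simp [vertexSum, expDiff_zero, completeProd]
  | cons n L ih =>
    rw [vertexSum, List.sum_cons]
    simp only [← ih, ← Multiset.cons_coe, completeProd_cons, expDiff_mul, mul_sum, smul_sum]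
    have h1 : ∀ i ∈ range (n + 1), ∀ j, expVal (powDiff t u) i • (complete R (n - i) *
        (expPart (powDiff t u) (k + i + j) * expDiff (powDiff t u) j (completeProd R L))) =
        expPart (powDiff t u) (k + (i + j)) * (expDiff (powDiff t u) i (complete R n) *
          expDiff (powDiff t u) j (completeProd R L)) := by
      intro i hi j
      rw [mem_range] at hi
      rw [expDiff_complete, if_pos (by omega), smul_mul_assoc, mul_smul_comm, add_assoc,
        mul_left_comm]
    rw [sum_congr rfl fun i hi => sum_congr rfl fun j _ => h1 i hi j,
      ← sum_range_antidiagonal (fun i j => expPart (powDiff t u) (k + (i + j)) *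
        (expDiff (powDiff t u) i (complete R n) * expDiff (powDiff t u) j (completeProd R L)))]
    · refine sum_congr rfl fun m _ => sum_congr rfl fun ij hij => ?_
      rw [HasAntidiagonal.mem_antidiagonal.mp hij]
    · rintro i j (h | h)
      · rw [expDiff_complete, if_neg (by omega), zero_mul, mul_zero]
      · rw [expDiff_completeProd_eq_zero _ _ h, mul_zero, mul_zero]

/-! ### Triangularity -/

/-- The multisets that contain the indices `m, λ_1, …, λ_i` with `m > λ_{i+1}` for some `i`, where
`L` is the list `λ` in reversed order. -/
def Exceeds : List ℕ → Multiset ℕ → Prop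
  | [], _ => False
  | n :: L, μ => Exceeds L μ ∨ ∃ m, n < m ∧ m ::ₘ (L : Multiset ℕ) ≤ μ

lemma Exceeds.mono {L : List ℕ} {μ ν : Multiset ℕ} (h : μ ≤ ν) (hμ : Exceeds L μ) :
    Exceeds L ν := by
  induction L with
  | nil => exact hμ
  | cons n L ih =>
    rcases hμ with hμ | ⟨m, hm, hμ⟩
    · exact Or.inl (ih hμ)
    · exact Or.inr ⟨m, hm, hμ.trans h⟩

/-- The span of the products of complete symmetric functions that exceed `L`. -/
def exceedSpan (R : Type*) [CommRing R] [Algebra ℂ R] (L : List ℕ) : Submodule R (Ser R) :=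
  Submodule.span R {F | ∃ μ, Exceeds L μ ∧ completeProd R μ = F}

lemma exceedSpan_le_cons (n : ℕ) (L : List ℕ) : exceedSpan R L ≤ exceedSpan R (n :: L) :=
  Submodule.span_mono fun _ ⟨μ, hμ, h⟩ => ⟨μ, Or.inl hμ, h⟩

lemma completeProd_mem_exceedSpan {n m : ℕ} (h : n < m) (L : List ℕ) :
    complete R m * completeProd R L ∈ exceedSpan R (n :: L) :=
  Submodule.subset_span ⟨m ::ₘ L, Or.inr ⟨m, h, le_rfl⟩, completeProd_cons _ _⟩

/-- The algebra generated by the complete symmetric functions. -/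
abbrev completeAlg (R : Type*) [CommRing R] [Algebra ℂ R] : Subalgebra R (Ser R) :=
  Algebra.adjoin R (Set.range (complete R))

lemma complete_mem_completeAlg (n : ℕ) : complete R n ∈ completeAlg R :=
  Algebra.subset_adjoin ⟨n, rfl⟩

/-- Exceeding is inherited by larger multisets, so further complete functions may be multiplied in.
-/
lemma mul_mem_exceedSpan {L : List ℕ} {F G : Ser R} (hF : F ∈ completeAlg R)
    (hG : G ∈ exceedSpan R L) : F * G ∈ exceedSpan R L := by
  induction hF using Algebra.adjoin_induction generalizing G with
  | mem x hx =>
    obtain ⟨n, rfl⟩ := hx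
    induction hG using Submodule.span_induction with
    | mem x hx =>
      obtain ⟨μ, hμ, rfl⟩ := hx
      rw [← completeProd_cons]
      exact Submodule.subset_span ⟨_, hμ.mono (Multiset.le_cons_self _ _), rfl⟩
    | zero => simp
    | add x y _ _ hx hy => rw [mul_add]; exact add_mem hx hy
    | smul a x _ hx => rw [mul_smul_comm]; exact Submodule.smul_mem _ _ hx
  | algebraMap r =>
    rw [← Algebra.smul_def]
    exact Submodule.smul_mem _ _ hG
  | add x y _ _ hx hy => rw [add_mul]; exact add_mem (hx hG) (hy hG)
  | mul x y _ _ hx hy => rw [mul_assoc]; exact hx (hy hG)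

/-- For n = 0 the relation `sum_expPart_powDiff_mul_complete` can be solved for the coefficient of
highest index. -/
lemma expPart_powDiff_mem_completeAlg (htu : t * u = 1) (N : ℕ) :
    expPart (powDiff t u) N ∈ completeAlg R := by
  induction N using Nat.strong_induction_on with
  | _ N ih =>
    have h := sum_expPart_powDiff_mul_complete htu 0 N
    simp only [zero_add, range_one, sum_singleton, pow_zero, one_smul, add_zero, Nat.sub_self,
      complete_zero, mul_one] at h
    rw [eq_sub_of_add_eq h]
    refine sub_mem (Subalgebra.smul_mem _ (complete_mem_completeAlg _) _) (sum_mem fun j hj => ?_)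
    exact Subalgebra.smul_mem _ (mul_mem (ih j (mem_range.mp hj)) (complete_mem_completeAlg _)) _

/-- The diagonal entries of the vertex operator on products of complete symmetric functions. -/
def vertexEigen (t u : R) : List ℕ → R
  | [] => 1
  | n :: L => vertexEigen t u L +
      u ^ (2 * L.length) * (u ^ 2 + (1 - u ^ 2) * t ^ (2 * n) - 1)

/-- The value 1 at i = 0 differs from the general formula (1 - u²) t^i by u²; this correction is the
first term on the right. -/
lemma sum_expVal_smul (htu : t * u = 1) (n k : ℕ) :
    ∑ i ∈ range (n + 1), expVal (powDiff t u) i •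
      (expPart (powDiff t u) (k + i) * complete R (n - i)) =
    u ^ 2 • (expPart (powDiff t u) k * complete R n) + (1 - u ^ 2) •
      ∑ i ∈ range (n + 1), t ^ i • (expPart (powDiff t u) (k + i) * complete R (n - i)) := by
  rw [sum_range_succ', sum_range_succ', smul_add, expVal_zero, smul_sum]
  have : ∀ i ∈ range n, expVal (powDiff t u) (i + 1) •
      (expPart (powDiff t u) (k + (i + 1)) * complete R (n - (i + 1))) =
      (1 - u ^ 2) • t ^ (i + 1) • (expPart (powDiff t u) (k + (i + 1)) *
        complete R (n - (i + 1))) := by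
    intro i _
    rw [expVal_powDiff htu, if_neg (Nat.succ_ne_zero i), smul_smul]
  rw [sum_congr rfl this]
  simp only [pow_zero, add_zero, Nat.sub_zero]
  module

/-- Every term contains some h_{n+k-j} with j < k, whose index is larger than n, next to the whole
product over L. -/
lemma completeProd_mul_remainder_mem (htu : t * u = 1) (n k : ℕ) (hk : 0 < k) (L : List ℕ) :
    completeProd R L * ((u ^ k * t ^ (2 * (n + k))) • complete R (n + k) - ∑ j ∈ range k,
      (u ^ k * t ^ j) • (expPart (powDiff t u) j * complete R (n + k - j))) ∈
      exceedSpan R (n :: L) := by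
  rw [mul_sub, mul_sum]
  refine sub_mem ?_ (sum_mem fun j hj => ?_)
  · rw [mul_smul_comm, mul_comm (completeProd R _)]
    exact Submodule.smul_mem _ _ (completeProd_mem_exceedSpan (by omega) L)
  · rw [mem_range] at hj
    rw [mul_smul_comm, mul_left_comm, mul_comm (completeProd R _)]
    exact Submodule.smul_mem _ _ (mul_mem_exceedSpan (expPart_powDiff_mem_completeAlg htu j)
      (completeProd_mem_exceedSpan (by omega) L))

lemma vertexSum_summand_mem {L : List ℕ}
    (ih : ∀ k, 0 < k → vertexSum t u L k -
      u ^ (2 * L.length) • (expPart (powDiff t u) k * completeProd R L) ∈ exceedSpan R L)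
    (n i k : ℕ) (hk : 0 < k + i) :
    expVal (powDiff t u) i • (complete R (n - i) * vertexSum t u L (k + i)) -
      u ^ (2 * L.length) • (completeProd R L * expVal (powDiff t u) i •
        (expPart (powDiff t u) (k + i) * complete R (n - i))) ∈ exceedSpan R L := by
  have := Submodule.smul_mem _ (expVal (powDiff t u) i)
    (mul_mem_exceedSpan (complete_mem_completeAlg (n - i)) (ih (k + i) hk))
  rw [mul_sub, smul_sub, mul_smul_comm, smul_comm (expVal (powDiff t u) i),
    show complete R (n - i) * (expPart (powDiff t u) (k + i) * completeProd R L) =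
      completeProd R L * (expPart (powDiff t u) (k + i) * complete R (n - i)) by ring,
    ← mul_smul_comm _ (completeProd R L)] at this
  exact this

/-- In mode zero the relation for k = 0 has no remainder, so the sum is an exact multiple of h_n.
This is the increment of the diagonal entry when the part n is added. -/
lemma sum_expVal_succ_smul (htu : t * u = 1) (n : ℕ) :
    ∑ i ∈ range n, expVal (powDiff t u) (i + 1) • (expPart (powDiff t u)
      (0 + (i + 1)) * complete R (n - (i + 1))) =
      (u ^ 2 + (1 - u ^ 2) * t ^ (2 * n) - 1) • complete R n := by
  have e1 := sum_expVal_smul htu n 0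
  have e2 := sum_expPart_powDiff_mul_complete htu n 0
  simp only [range_zero, sum_empty, add_zero, pow_zero, one_mul] at e2
  rw [e2, sum_range_succ', expVal_zero, expPart_zero, one_mul] at e1
  simp only [one_mul, one_smul, Nat.sub_zero] at e1
  rw [eq_sub_of_add_eq e1]
  module

/-- Modulo products that exceed `L`, the vertex operator multiplies `h_L` by a power series in the
case of a positive mode, and by its diagonal entry in the case of mode zero. -/
lemma vertexSum_sub_mem (htu : t * u = 1) (L : List ℕ) :
    (∀ k, 0 < k → vertexSum t u L k -
      u ^ (2 * L.length) • (expPart (powDiff t u) k * completeProd R L) ∈ exceedSpan R L) ∧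
    vertexSum t u L 0 - vertexEigen t u L • completeProd R L ∈ exceedSpan R L := by
  induction L with
  | nil =>
    constructor
    · intro k _
      simp [vertexSum, completeProd]
    · simp [vertexSum, completeProd, vertexEigen, expPart_zero]
  | cons n L ih =>
    obtain ⟨ih1, ih2⟩ := ih
    have hcons : completeProd R ((n :: L : List ℕ) : Multiset ℕ) =
        complete R n * completeProd R L := by
      rw [← Multiset.cons_coe, completeProd_cons]
    have hlen : u ^ (2 * (n :: L).length) = u ^ (2 * L.length) * u ^ 2 := by
      rw [List.length_cons, mul_add, pow_add, mul_one]
    constructor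
    · intro k hk
      rw [vertexSum, hcons, hlen]
      -- All modes k + i are positive, so the first induction hypothesis applies to each summand. By
      -- the relation, the sum with coefficients t^i is negligible, and only the correction u²
      -- survives.
      have h1 := sum_mem fun i (_ : i ∈ range (n + 1)) =>
        vertexSum_summand_mem ih1 n i k (by omega)
      rw [sum_sub_distrib, ← smul_sum, ← mul_sum, sum_expVal_smul htu,
        eq_sub_of_add_eq (sum_expPart_powDiff_mul_complete htu n k)] at h1
      have h3 := add_mem (exceedSpan_le_cons n L h1)
        (Submodule.smul_mem _ (u ^ (2 * L.length) * (1 - u ^ 2))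
          (completeProd_mul_remainder_mem htu n k hk L))
      rw [mul_add, mul_smul_comm, mul_smul_comm, smul_add, smul_smul, smul_smul, sub_add,
        add_sub_cancel_right, mul_left_comm, mul_comm (completeProd R _)] at h3
      exact h3
    · rw [vertexSum, hcons, sum_range_succ']
      -- The summands with i > 0 involve positive modes of the shorter product and yield the
      -- diagonal increment; the summand i = 0 uses the induction hypothesis for mode zero.
      have h1 := sum_mem fun i (_ : i ∈ range n) => vertexSum_summand_mem ih1 n (i + 1) 0 (by omega)
      rw [sum_sub_distrib, ← smul_sum, ← mul_sum, sum_expVal_succ_smul htu] at h1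
      have h3 := mul_mem_exceedSpan (complete_mem_completeAlg n) ih2
      have h4 := exceedSpan_le_cons n L (add_mem h1 h3)
      rw [mul_sub, mul_smul_comm, mul_smul_comm, mul_comm (completeProd R _), smul_smul,
        sub_add_sub_comm, ← add_smul] at h4
      rw [vertexEigen, expVal_zero, one_smul, add_comm (vertexEigen t u L)]
      exact h4

end

section

variable {R : Type*} [CommRing R] [Algebra ℂ R]

/-! ### The invariant bilinear form -/

/-- The bilinear form on power series of weight `n` for which the monomials `p^γ` are orthogonal
and have square `zee γ`. -/
def form (n : ℕ) : Ser R →ₗ[R] Ser R →ₗ[R] R :=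
  LinearMap.mk₂ R (fun F G => ∑ γ ∈ expos n,
      (zee γ : R) * (MvPowerSeries.coeff γ F * MvPowerSeries.coeff γ G))
    (fun F F' G => by simp only [map_add, add_mul, mul_add, sum_add_distrib])
    (fun r F G => by
      simp only [map_smul, smul_eq_mul, mul_sum]
      exact sum_congr rfl fun _ _ => by ring)
    (fun F G G' => by simp only [map_add, mul_add, sum_add_distrib])
    (fun r F G => by
      simp only [map_smul, smul_eq_mul, mul_sum]
      exact sum_congr rfl fun _ _ => by ring)

lemma form_apply (n : ℕ) (F G : Ser R) : form n F G = ∑ γ ∈ expos n,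
    (zee γ : R) * (MvPowerSeries.coeff γ F * MvPowerSeries.coeff γ G) := rfl

lemma form_comm (n : ℕ) (F G : Ser R) : form n F G = form n G F := by
  rw [form_apply, form_apply]
  exact sum_congr rfl fun _ _ => by ring

/-- The operators `p^α` and `∏_k (k ∂/∂p_k)^{α_k}` are adjoint. -/
lemma form_monomial_mul (n : ℕ) (α : Expo) (F G : Ser R) :
    form (n + wt α) (MvPowerSeries.monomial α 1 * F) G = form n F (diffOp α G) := by
  classical
  rw [form_apply, form_apply]
  symm
  refine sum_of_injOn (fun γ => γ + α) (fun _ _ _ _ h => by simpa using h) ?_ ?_ ?_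
  · intro γ hγ
    simp_all
  · intro γ hγ hγ'
    rw [MvPowerSeries.coeff_monomial_mul, if_neg]
    · simp
    · intro hle
      refine hγ' ⟨γ - α, ?_, tsub_add_cancel_of_le hle⟩
      rw [mem_expos] at hγ
      rw [mem_coe, mem_expos]
      have := congrArg wt (tsub_add_cancel_of_le hle)
      rw [map_add] at this
      omega
  · intro γ _
    rw [MvPowerSeries.coeff_monomial_mul, if_pos le_add_self, add_tsub_cancel_right, one_mul,
      coeff_diffOp]
    have h : (zee γ : R) * algebraMap ℂ R ((zee (γ + α) : ℂ) / zee γ) = (zee (γ + α) : R) := by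
      rw [← map_natCast (algebraMap ℂ R), ← map_mul, mul_div_cancel₀ _ (zee_ne_zero γ),
        map_natCast]
    rw [← h]
    ring

lemma form_expPart_mul (x : ℕ → R) {m n : ℕ} (h : m ≤ n) (F G : Ser R) :
    form n (expPart x m * F) G = form (n - m) F (expDiff x m G) := by
  rw [expPart, sum_mul, map_sum, LinearMap.sum_apply, expDiff, LinearMap.sum_apply, map_sum]
  refine sum_congr rfl fun α hα => ?_
  rw [mem_expos] at hα
  rw [LinearMap.smul_apply, map_smul, smul_mul_assoc, map_smul, LinearMap.smul_apply,
    ← form_monomial_mul, hα, Nat.sub_add_cancel h]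

/-- The zero mode of the vertex operator, on power series of weight at most `n`. -/
def vertexOp (t u : R) (n : ℕ) : Ser R →ₗ[R] Ser R :=
  ∑ m ∈ range (n + 1),
    (LinearMap.mulLeft R (expPart (powDiff t u) m)).comp (expDiff (powDiff t u) m)

lemma vertexOp_apply (t u : R) (n : ℕ) (F : Ser R) : vertexOp t u n F =
    ∑ m ∈ range (n + 1), expPart (powDiff t u) m * expDiff (powDiff t u) m F := by
  simp [vertexOp, LinearMap.sum_apply]

/-- Each summand is multiplication by `expPart` after its adjoint `expDiff`, so it is self-adjoint.
-/
lemma form_vertexOp (t u : R) (n : ℕ) (F G : Ser R) :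
    form n (vertexOp t u n F) G = form n F (vertexOp t u n G) := by
  rw [form_comm n F, vertexOp_apply, vertexOp_apply, map_sum, map_sum, LinearMap.sum_apply,
    LinearMap.sum_apply]
  refine sum_congr rfl fun m hm => ?_
  rw [mem_range] at hm
  rw [form_expPart_mul _ (by omega), form_expPart_mul _ (by omega), form_comm]

lemma vertexOp_completeProd_sub_mem {t u : R} (htu : t * u = 1) (L : List ℕ) :
    vertexOp t u L.sum (completeProd R L) - vertexEigen t u L • completeProd R L ∈
      exceedSpan R L := by
  have h := vertexSum_eq (t := t) (u := u) L 0
  simp only [zero_add] at h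
  rw [vertexOp_apply, h]
  exact (vertexSum_sub_mem htu L).2

/-- Reversal makes the head of the recursion the last row, so the length of the tail is its index i
counted from 0. The increment is u^{2i} (1 - u²)(t^{2n} - 1), and 1 - u² = (t - u) u. -/
lemma vertexEigen_eq {t u : R} (htu : t * u = 1) (L : List ℕ) : vertexEigen t u L.reverse =
    1 + (t - u) * ∑ i ∈ range L.length, u ^ (2 * i + 1) * (t ^ (2 * L.getD i 0) - 1) := by
  induction L using List.reverseRecOn with
  | nil => simp [vertexEigen]
  | append_singleton L n ih =>
    rw [List.reverse_append, List.reverse_singleton, List.singleton_append, vertexEigen, ih,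
      List.length_append, List.length_singleton, sum_range_succ, List.length_reverse]
    have h1 : ∀ i ∈ range L.length, u ^ (2 * i + 1) * (t ^ (2 * (L ++ [n]).getD i 0) - 1) =
        u ^ (2 * i + 1) * (t ^ (2 * L.getD i 0) - 1) := by
      intro i hi
      rw [mem_range] at hi
      rw [List.getD_append _ _ _ _ hi]
    rw [sum_congr rfl h1, List.getD_append_right _ _ _ _ le_rfl]
    simp only [Nat.sub_self, List.getD_cons_zero]
    linear_combination (-u ^ (2 * L.length) * (t ^ (2 * n) - 1)) * htu

end

section

/-! ### Cycle types as exponent vectors -/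

/-- The exponent vector of the monomial `∏_{k ∈ m} p_k`. -/
def expo (m : Multiset ℕ) : Expo := Multiset.toFinsupp (m.map Nat.toPNat')

@[simp] lemma expo_zero : expo 0 = 0 := by simp [expo]

lemma expo_add (m m' : Multiset ℕ) : expo (m + m') = expo m + expo m' := by
  simp [expo]

lemma expo_cons (a : ℕ) (m : Multiset ℕ) :
    expo (a ::ₘ m) = expo m + Finsupp.single a.toPNat' 1 := by
  rw [← Multiset.singleton_add, expo_add, add_comm]
  simp [expo]

lemma expo_sum {ι : Type*} (s : Finset ι) (m : ι → Multiset ℕ) :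
    expo (∑ i ∈ s, m i) = ∑ i ∈ s, expo (m i) := by
  classical
  induction s using Finset.induction_on with
  | empty => simp
  | insert i s hi ih => rw [sum_insert hi, sum_insert hi, expo_add, ih]

lemma toPNat'_val {a : ℕ} (h : 0 < a) : ((a.toPNat' : ℕ+) : ℕ) = a := by
  rw [Nat.toPNat'_coe, if_pos h]

lemma wt_expo {m : Multiset ℕ} (hm : ∀ a ∈ m, 0 < a) : wt (expo m) = m.sum := by
  induction m using Multiset.induction_on with
  | empty => simp
  | cons a m ih =>
    rw [expo_cons, map_add, wt_single, ih fun b hb => hm b (Multiset.mem_cons_of_mem hb),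
      toPNat'_val (hm a (Multiset.mem_cons_self a m)), Multiset.sum_cons]
    ring

/-- The multiset of indices of the monomial `p^γ`. -/
def indices (γ : Expo) : Multiset ℕ := (Finsupp.toMultiset γ).map fun k : ℕ+ => (k : ℕ)

@[simp] lemma expo_indices (γ : Expo) : expo (indices γ) = γ := by
  simp [expo, indices, Multiset.map_map]

lemma indices_expo {m : Multiset ℕ} (hm : ∀ a ∈ m, 0 < a) : indices (expo m) = m := by
  rw [indices, expo, Multiset.toFinsupp_toMultiset, Multiset.map_map]
  conv_rhs => rw [← Multiset.map_id m]
  exact Multiset.map_congr rfl fun a ha => toPNat'_val (hm a ha)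

lemma indices_pos (γ : Expo) : ∀ a ∈ indices γ, 0 < a := by
  intro a ha
  obtain ⟨k, _, rfl⟩ := Multiset.mem_map.mp ha
  exact k.pos

lemma sum_indices (γ : Expo) : (indices γ).sum = wt γ := by
  rw [← wt_expo (indices_pos γ), expo_indices]

lemma expo_injective {m m' : Multiset ℕ} (hm : ∀ a ∈ m, 0 < a) (hm' : ∀ a ∈ m', 0 < a)
    (h : expo m = expo m') : m = m' := by
  rw [← indices_expo hm, h, indices_expo hm']

lemma wt_expo_parts {n : ℕ} (l : Nat.Partition n) : wt (expo l.parts) = n := by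
  rw [wt_expo fun _ h => l.parts_pos h, l.parts_sum]

lemma expo_parts_injective {n : ℕ} {l l' : Nat.Partition n} (h : expo l.parts = expo l'.parts) :
    l = l' :=
  Nat.Partition.ext (expo_injective (fun _ h => l.parts_pos h) (fun _ h => l'.parts_pos h) h)

/-- The partition with the parts of the monomial `p^γ`. -/
def toPartition {n : ℕ} (γ : Expo) (h : wt γ = n) : Nat.Partition n where
  parts := indices γ
  parts_pos h := indices_pos γ _ h
  parts_sum := (sum_indices γ).trans h

lemma sum_expos_eq_sum_partition {M : Type*} [AddCommMonoid M] (n : ℕ) (u : Expo → M) :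
    ∑ γ ∈ expos n, u γ = ∑ l : Nat.Partition n, u (expo l.parts) := by
  symm
  refine sum_bij (fun l _ => expo l.parts) (fun l _ => by simp [wt_expo_parts])
    (fun l _ l' _ h => expo_parts_injective h) (fun γ hγ => ?_) (fun _ _ => rfl)
  exact ⟨toPartition γ (mem_expos.mp hγ), mem_univ _, expo_indices γ⟩

/-! ### Conjugacy classes -/

variable {α : Type*} [Fintype α] [DecidableEq α]

/-- The cycle type of a permutation as an exponent vector. -/
def cyc (σ : Perm α) : Expo := expo σ.partition.parts

lemma wt_cyc (σ : Perm α) : wt (cyc σ) = Fintype.card α := wt_expo_parts _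

lemma cyc_eq_iff {σ τ : Perm α} : cyc σ = cyc τ ↔ IsConj σ τ := by
  rw [Perm.partition_eq_of_isConj]
  exact ⟨expo_parts_injective, fun h => by rw [cyc, h, ← cyc]⟩

lemma cyc_inv (σ : Perm α) : cyc σ⁻¹ = cyc σ := by
  rw [cyc_eq_iff, Perm.isConj_iff_cycleType_eq, Perm.cycleType_inv]

lemma cyc_conj (g σ : Perm α) : cyc (g * σ * g⁻¹) = cyc σ := by
  rw [cyc_eq_iff, isConj_comm]
  exact isConj_iff.mpr ⟨g, rfl⟩

lemma exists_cyc_eq (γ : Expo) (h : wt γ = Fintype.card α) : ∃ σ : Perm α, cyc σ = γ := by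
  -- `cycleType` ignores fixed points: the parts 1 are removed here and return as the points outside
  -- the support.
  have h1 := (Perm.exists_with_cycleType_iff α (m := (indices γ).filter (2 ≤ ·))).mpr ⟨?_, ?_⟩
  · obtain ⟨σ, hσ⟩ := h1
    refine ⟨σ, ?_⟩
    have h2 : indices γ = (indices γ).filter (2 ≤ ·) +
        Multiset.replicate (((indices γ).filter (¬ 2 ≤ ·)).card) 1 := by
      conv_lhs => rw [← Multiset.filter_add_not (2 ≤ ·) (indices γ)]
      congr 1
      refine Multiset.eq_replicate_card.mpr fun b hb => ?_
      have := indices_pos γ b (Multiset.mem_of_mem_filter hb)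
      have := Multiset.of_mem_filter hb
      omega
    have h3 : (indices γ).sum = Fintype.card α := by rw [sum_indices, h]
    rw [h2, Multiset.sum_add, Multiset.sum_replicate, smul_eq_mul, mul_one] at h3
    rw [cyc, Perm.parts_partition, ← Perm.sum_cycleType, hσ, ← h3, Nat.add_sub_cancel_left, ← h2,
      expo_indices]
  · rw [← h, ← sum_indices]
    conv_rhs => rw [← Multiset.filter_add_not (2 ≤ ·) (indices γ)]
    rw [Multiset.sum_add]
    exact Nat.le_add_right _ _
  · intro a ha
    exact Multiset.of_mem_filter ha

lemma count_cons_prod {ι : Type*} [DecidableEq ι] (a : ι) (m : Multiset ι) :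
    ∏ k ∈ (a ::ₘ m).toFinset, ((a ::ₘ m).count k).factorial =
      (m.count a + 1) * ∏ k ∈ m.toFinset, (m.count k).factorial := by
  have h1 : ∏ k ∈ m.toFinset, (m.count k).factorial =
      ∏ k ∈ (a ::ₘ m).toFinset, (m.count k).factorial := by
    refine prod_subset (by simp) fun k _ hk => ?_
    rw [Multiset.count_eq_zero_of_notMem (by simpa using hk), Nat.factorial_zero]
  have ha : a ∈ (a ::ₘ m).toFinset := by simp
  rw [h1, ← mul_prod_erase _ _ ha, ← mul_prod_erase _ (fun k => (m.count k).factorial) ha,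
    Multiset.count_cons_self, Nat.factorial_succ, mul_assoc]
  congr 2
  refine prod_congr rfl fun k hk => ?_
  rw [Multiset.count_cons_of_ne (ne_of_mem_erase hk)]

lemma expo_apply_toPNat' {a : ℕ} (ha : 0 < a) {m : Multiset ℕ} (hm : ∀ b ∈ m, 0 < b) :
    expo m a.toPNat' = m.count a := by
  rw [expo, Multiset.toFinsupp_apply]
  induction m using Multiset.induction_on with
  | empty => simp
  | cons b m ih =>
    rw [Multiset.map_cons, Multiset.count_cons, Multiset.count_cons,
      ih fun c hc => hm c (Multiset.mem_cons_of_mem hc)]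
    congr 1
    have hb := hm b (Multiset.mem_cons_self b m)
    refine if_congr ⟨fun h => ?_, fun h => by rw [h]⟩ rfl rfl
    rw [← toPNat'_val ha, h, toPNat'_val hb]

lemma zee_expo {m : Multiset ℕ} (hm : ∀ a ∈ m, 0 < a) :
    zee (expo m) = m.prod * ∏ k ∈ m.toFinset, (m.count k).factorial := by
  induction m using Multiset.induction_on with
  | empty => simp
  | cons a m ih =>
    have hm' := fun b hb => hm b (Multiset.mem_cons_of_mem hb)
    have ha := hm a (Multiset.mem_cons_self a m)
    rw [expo_cons, zee_add_single, ih hm', count_cons_prod, Multiset.prod_cons,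
      expo_apply_toPNat' ha hm', toPNat'_val ha]
    ring

/-- The available formula treats the r fixed points separately, with a factor r!. Adding the parts 1
one at a time to the exponent vector builds up the same factor. -/
lemma card_centralizer_eq_zee (σ : Perm α) :
    Nat.card (Subgroup.centralizer {σ}) = zee (cyc σ) := by
  rw [Perm.nat_card_centralizer, cyc, Perm.parts_partition, ← Perm.sum_cycleType]
  have h2 : ∀ a ∈ σ.cycleType, 0 < a := fun a ha => by
    have := Perm.two_le_of_mem_cycleType ha; omega
  have h1 : σ.cycleType.count 1 = 0 := Multiset.count_eq_zero_of_notMem fun h => by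
    have := Perm.two_le_of_mem_cycleType h; omega
  generalize Fintype.card α - σ.cycleType.sum = r
  rw [mul_assoc, ← zee_expo h2]
  induction r with
  | zero => simp
  | succ r ih =>
    have h3 : ∀ b ∈ σ.cycleType + Multiset.replicate r 1, 0 < b := by
      intro b hb
      rcases Multiset.mem_add.mp hb with hb | hb
      · exact h2 b hb
      · rw [Multiset.eq_of_mem_replicate hb]; exact one_pos
    rw [Multiset.replicate_succ, Multiset.add_cons, expo_cons, zee_add_single, ← ih,
      expo_apply_toPNat' one_pos h3, Multiset.count_add, h1, Multiset.count_replicate_self,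
      Nat.factorial_succ]
    simp
    ring

/-- The elements conjugating σ to τ form a coset of the centralizer of σ. -/
lemma card_conj_eq {σ τ : Perm α} (h : cyc σ = cyc τ) :
    #{g : Perm α | g * σ * g⁻¹ = τ} = zee (cyc σ) := by
  obtain ⟨c, rfl⟩ := isConj_iff.mp (cyc_eq_iff.mp h)
  have h1 : Nat.card (Subgroup.centralizer {σ}) = #{g : Perm α | σ * g = g * σ} :=
    Nat.subtype_card _ fun g => by simp [Subgroup.mem_centralizer_singleton_iff, eq_comm]
  rw [← card_centralizer_eq_zee, h1]
  refine card_bij' (fun g _ => c⁻¹ * g) (fun g _ => c * g) ?_ ?_ ?_ ?_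
  · intro g hg
    rw [mem_filter, mul_inv_eq_iff_eq_mul] at hg
    rw [mem_filter, mul_assoc, hg.2]
    simp [mul_assoc]
  · intro g hg
    rw [mem_filter] at hg
    rw [mem_filter, mul_inv_eq_iff_eq_mul, mul_assoc, ← hg.2]
    simp [mul_assoc]
  · intro g _; simp
  · intro g _; simp

/-- Sums over a conjugacy class as sums over the group. -/
lemma sum_conj_eq {M : Type*} [AddCommMonoid M] (σ : Perm α) (u : Perm α → M) :
    ∑ g : Perm α, u (g * σ * g⁻¹) = zee (cyc σ) • ∑ τ with cyc τ = cyc σ, u τ := by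
  rw [← sum_fiberwise_of_maps_to (t := {τ : Perm α | cyc τ = cyc σ})
    (g := fun g => g * σ * g⁻¹) (fun g _ => by simp [cyc_conj]), smul_sum]
  refine sum_congr rfl fun τ hτ => ?_
  rw [mem_filter] at hτ
  rw [← card_conj_eq hτ.2.symm, ← sum_const]
  refine sum_congr rfl fun g hg => ?_
  rw [(mem_filter.mp hg).2]

lemma card_cyc_mul_zee (γ : Expo) (h : wt γ = Fintype.card α) :
    #{σ : Perm α | cyc σ = γ} * zee γ = (Fintype.card α).factorial := by
  obtain ⟨σ, rfl⟩ := exists_cyc_eq γ h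
  have := sum_conj_eq σ fun _ => 1
  rw [sum_const, sum_const, card_univ, Fintype.card_perm, smul_eq_mul, smul_eq_mul, smul_eq_mul,
    mul_one, mul_one] at this
  rw [this, mul_comm]

end

/-! ### Cycle types on Young subgroups -/

section

variable {α : Type*} [Fintype α] [DecidableEq α]

/-- The sum over all permutations of the monomials of their cycle types is a multiple of the
complete symmetric function. -/
lemma sum_monomial_cyc : ∑ σ : Perm α, (MvPowerSeries.monomial (cyc σ) 1 : Ser ℂ) =
    ((Fintype.card α).factorial : ℂ) • complete ℂ (Fintype.card α) := by
  ext γ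
  simp only [map_sum, MvPowerSeries.coeff_monomial, map_smul, coeff_complete, smul_eq_mul]
  rw [← sum_filter, sum_const, nsmul_eq_mul, mul_one]
  split_ifs with h
  · rw [← card_cyc_mul_zee γ h]
    simp only [Algebra.algebraMap_self, RingHom.id_apply, Nat.cast_mul]
    rw [mul_inv_cancel_right₀ (zee_ne_zero γ)]
    simp only [eq_comm]
  · rw [mul_zero, Nat.cast_eq_zero, card_eq_zero, filter_eq_empty_iff]
    rintro σ _ rfl
    exact h (wt_cyc σ)

lemma parts_partition' (σ : Perm α) : σ.partition.parts =
    σ.cycleType + (Fintype.card α - σ.cycleType.sum) • ({1} : Multiset ℕ) := by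
  rw [Perm.parts_partition, Perm.sum_cycleType, Multiset.nsmul_singleton]

variable {ι : Type*} [DecidableEq ι]

lemma ofSubtype_subtypePerm_apply {α : Type*} {p : α → Prop} [DecidablePred p] (σ : Perm α)
    (h : ∀ a, p (σ a) ↔ p a) (a : α) :
    Perm.ofSubtype (σ.subtypePerm h) a = if p a then σ a else a := by
  split_ifs with ha
  · rw [Perm.ofSubtype_apply_of_mem _ ha]
    rfl
  · rw [Perm.ofSubtype_apply_of_not_mem _ ha]

/-- The restriction of a permutation that preserves the fibres of `f` to a union of fibres. -/
lemma cycleType_restrict (f : α → ι) (σ : Perm α) (hσ : ∀ a, f (σ a) = f a) (s : Finset ι) :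
    (σ.subtypePerm (p := fun a => f a ∈ s) fun a => by rw [hσ]).cycleType =
      ∑ i ∈ s, (σ.subtypePerm (p := fun a => f a = i) fun a => by rw [hσ]).cycleType := by
  induction s using Finset.induction_on with
  | empty =>
    rw [sum_empty, Perm.cycleType_eq_zero]
    ext ⟨a, ha⟩
    simp at ha
  | insert i s hi ih =>
    rw [sum_insert hi, ← ih, ← Perm.cycleType_ofSubtype, ← Perm.cycleType_ofSubtype,
      ← Perm.cycleType_ofSubtype, ← Perm.Disjoint.cycleType_mul]
    · congr 1
      ext a
      rw [Perm.mul_apply, ofSubtype_subtypePerm_apply, ofSubtype_subtypePerm_apply,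
        ofSubtype_subtypePerm_apply]
      by_cases h1 : f a = i
      · simp [h1, hi]
      · by_cases h2 : f a ∈ s
        · simp [h1, h2, hσ]
        · simp [h1, h2]
    · intro a
      rw [ofSubtype_subtypePerm_apply, ofSubtype_subtypePerm_apply]
      by_cases h1 : f a = i
      · simp [h1, hi]
      · simp [h1]

lemma cyc_eq_sum_cyc [Fintype ι] (f : α → ι) (σ : Perm α) (hσ : ∀ a, f (σ a) = f a) :
    cyc σ = ∑ i, cyc (σ.subtypePerm (p := fun a => f a = i) fun a => by rw [hσ]) := by
  have h1 : σ.cycleType =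
      ∑ i, (σ.subtypePerm (p := fun a => f a = i) fun a => by rw [hσ]).cycleType := by
    rw [← cycleType_restrict f σ hσ univ, ← Perm.cycleType_ofSubtype]
    congr 1
    ext a
    rw [ofSubtype_subtypePerm_apply, if_pos (mem_univ _)]
  simp only [cyc]
  rw [← expo_sum]
  congr 1
  simp only [parts_partition']
  rw [sum_add_distrib, ← h1, ← Finset.sum_smul]
  congr 2
  rw [h1, Multiset.sum_sum, sum_tsub_distrib]
  · congr 1
    simp only [Fintype.card_subtype]
    rw [← card_univ]
    exact card_eq_sum_card_fiberwise fun a _ => mem_univ (f a)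
  · intro i _
    rw [Perm.sum_cycleType]
    exact card_le_univ _

/-- The sum of the monomials of the cycle types over the permutations that preserve the fibres of
`f`. -/
lemma sum_monomial_cyc_fiber [Fintype ι] (f : α → ι) :
    ∑ σ : Perm α with ∀ a, f (σ a) = f a, (MvPowerSeries.monomial (cyc σ) 1 : Ser ℂ) =
      ∏ i, ∑ τ : Perm {a // f a = i}, (MvPowerSeries.monomial (cyc τ) 1 : Ser ℂ) := by
  rw [prod_univ_sum]
  -- A permutation preserving the fibres is the same as a family of permutations, one for each
  -- fibre.
  refine sum_bij' (fun σ hσ i => σ.subtypePerm (p := fun a => f a = i)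
      fun a => by rw [(mem_filter.mp hσ).2])
    (fun F _ => (sigmaFiberEquiv f).permCongr (Perm.sigmaCongrRight F)) ?_ ?_ ?_ ?_ ?_
  · intro σ _; simp
  · intro F _
    simp only [mem_filter, mem_univ, true_and]
    intro a
    exact (F (f a) ⟨a, rfl⟩).2
  · intro σ hσ
    ext a
    rfl
  · intro F _
    funext i
    ext ⟨a, rfl⟩
    rfl
  · intro σ hσ
    rw [cyc_eq_sum_cyc f σ (mem_filter.mp hσ).2, MvPowerSeries.prod_monomial, prod_const_one]

end

section

/-! ### Row-by-row tableaux -/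

lemma box_injective (L : List ℕ) : Function.Injective (box L) := by
  induction L with
  | nil => intro i j h; simpa [box] using h
  | cons a L ih =>
    intro i j h
    simp only [box] at h
    split_ifs at h with h1 h2 h2
    · simpa using h
    · simp at h
    · simp at h
    · have h3 : box L (i - a) = box L (j - a) := by
        simp only [Prod.mk.injEq, add_left_inj] at h
        exact Prod.ext h.1 h.2
      have := ih h3
      omega

lemma box_snd_lt (L : List ℕ) {i : ℕ} (hi : i < L.sum) :
    (box L i).2 < L.getD (box L i).1 0 := by
  induction L generalizing i with
  | nil => simp at hi
  | cons a L ih =>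
    simp only [box]
    split_ifs with h1
    · simpa using h1
    · simp only [List.getD_cons_succ]
      exact ih (by rw [List.sum_cons] at hi; omega)

lemma exists_box_eq (L : List ℕ) {a b : ℕ} (h : b < L.getD a 0) :
    ∃ i < L.sum, box L i = (a, b) := by
  induction L generalizing a with
  | nil => simp at h
  | cons c L ih =>
    cases a with
    | zero =>
      rw [List.getD_cons_zero] at h
      exact ⟨b, by rw [List.sum_cons]; omega, by simp [box, h]⟩
    | succ a =>
      rw [List.getD_cons_succ] at h
      obtain ⟨i, hi, h1⟩ := ih h
      exact ⟨c + i, by rw [List.sum_cons]; omega, by simp [box, h1]⟩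

section Rows

variable {n : ℕ} (l : Nat.Partition n)

lemma coe_rows : (rows l : Multiset ℕ) = l.parts := Multiset.sort_eq _ _

lemma sum_rows : (rows l).sum = n := by
  rw [← Multiset.sum_coe, coe_rows, l.parts_sum]

lemma rows_pairwise : (rows l).Pairwise (· ≥ ·) := Multiset.pairwise_sort _ _

lemma rows_pos {a : ℕ} (h : a ∈ rows l) : 0 < a :=
  l.parts_pos (by rw [← coe_rows]; exact h)

lemma rows_injective {l l' : Nat.Partition n} (h : rows l = rows l') : l = l' :=
  Nat.Partition.ext (by rw [← coe_rows, ← coe_rows, h])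

/-- The row of the box that carries `i`. -/
def row (i : Fin n) : ℕ := (box (rows l) i).1

/-- The column of the box that carries `i`. -/
def col (i : Fin n) : ℕ := (box (rows l) i).2

variable {l}

lemma eq_of_row_of_col {i j : Fin n} (h1 : row l i = row l j) (h2 : col l i = col l j) :
    i = j :=
  Fin.ext (box_injective (rows l) (Prod.ext h1 h2))

lemma col_lt (i : Fin n) : col l i < (rows l).getD (row l i) 0 :=
  box_snd_lt _ (by rw [sum_rows]; exact i.2)

lemma exists_row_col {a b : ℕ} (h : b < (rows l).getD a 0) :
    ∃ i : Fin n, row l i = a ∧ col l i = b := by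
  obtain ⟨i, hi, h1⟩ := exists_box_eq _ h
  rw [sum_rows] at hi
  exact ⟨⟨i, hi⟩, congrArg Prod.fst h1, congrArg Prod.snd h1⟩

lemma getD_anti {L : List ℕ} (hL : L.Pairwise (· ≥ ·)) {a b : ℕ} (h : a ≤ b) :
    L.getD b 0 ≤ L.getD a 0 := by
  rcases lt_or_ge b L.length with hb | hb
  · rw [List.getD_eq_getElem _ _ hb, List.getD_eq_getElem _ _ (lt_of_le_of_lt h hb)]
    rcases eq_or_lt_of_le h with rfl | h
    · exact le_rfl
    · exact List.pairwise_iff_getElem.mp hL _ _ _ _ h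
  · rw [List.getD_eq_default _ _ hb]
    exact Nat.zero_le _

lemma exists_above {i : Fin n} {a : ℕ} (h : a ≤ row l i) :
    ∃ j : Fin n, row l j = a ∧ col l j = col l i :=
  exists_row_col (lt_of_lt_of_le (col_lt i) (getD_anti (rows_pairwise l) h))

lemma card_row (a : ℕ) : #{i : Fin n | row l i = a} = (rows l).getD a 0 := by
  rw [← card_range ((rows l).getD a 0)]
  refine card_bij (fun i _ => col l i) ?_ ?_ ?_
  · intro i hi
    rw [mem_filter] at hi
    rw [mem_range, ← hi.2]
    exact col_lt i
  · intro i hi j hj h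
    rw [mem_filter] at hi hj
    exact eq_of_row_of_col (hi.2.trans hj.2.symm) h
  · intro b hb
    obtain ⟨i, h1, h2⟩ := exists_row_col (mem_range.mp hb)
    exact ⟨i, by simp [h1], h2⟩

lemma sum_take_eq (L : List ℕ) (k : ℕ) : (L.take k).sum = ∑ a ∈ range k, L.getD a 0 := by
  induction L generalizing k with
  | nil => simp
  | cons b L ih =>
    cases k with
    | zero => simp
    | succ k => rw [List.take_succ_cons, List.sum_cons, ih, sum_range_succ']; simp [add_comm]

lemma card_row_lt (k : ℕ) : #{i : Fin n | row l i < k} = ((rows l).take k).sum := by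
  rw [sum_take_eq, card_eq_sum_card_fiberwise (f := row l) (t := range k)]
  · refine sum_congr rfl fun a ha => ?_
    rw [← card_row, filter_filter]
    congr 1
    ext i
    simp only [mem_filter, mem_univ, true_and, and_iff_right_iff_imp]
    rintro rfl
    exact mem_range.mp ha
  · intro i hi
    simpa using hi

/-! ### Rows against columns -/

/-- No two entries of one row of the tableau `m`, moved by `g`, are in one column of the tableau
`l`. -/
def Transverse (l m : Nat.Partition n) (g : Perm (Fin n)) : Prop :=
  ∀ i j, i ≠ j → row m i = row m j → col l (g i) ≠ col l (g j)

/-- If column c of `l` extends beyond the first k rows, the right side is at least k, while the left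
side is at most k because entries landing in one column come from different rows. Otherwise the
whole column lies in the first k rows and `g` is an injection. -/
lemma Transverse.card_col_le {m : Nat.Partition n} {g : Perm (Fin n)} (H : Transverse l m g)
    (k c : ℕ) : #{i : Fin n | row m i < k ∧ col l (g i) = c} ≤
      #{j : Fin n | row l j < k ∧ col l j = c} := by
  by_cases hc : ∃ j, col l j = c ∧ k ≤ row l j
  · obtain ⟨j, rfl, hj⟩ := hc
    refine le_trans (b := k) ?_ ?_
    · conv_rhs => rw [← card_range k]
      refine card_le_card_of_injOn (row m) (fun i hi => by simp_all) ?_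
      intro i hi i' hi' h
      by_contra hne
      simp only [coe_filter, mem_univ, true_and, Set.mem_ofPred_eq] at hi hi'
      exact H i i' hne h (hi.2.trans hi'.2.symm)
    · have h1 : ∀ a ∈ range k, ∃ i : Fin n, row l i = a ∧ col l i = col l j := fun a ha =>
        exists_above ((mem_range.mp ha).le.trans hj)
      have : Nonempty (Fin n) := ⟨j⟩
      choose! u hu using h1
      conv_lhs => rw [← card_range k]
      refine card_le_card_of_injOn u (fun a ha => ?_) ?_
      · have := hu a ha
        simp_all
      · intro a ha b hb h
        rw [← (hu a ha).1, h, (hu b hb).1]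
  · push Not at hc
    refine card_le_card_of_injOn g (fun i hi => ?_) (g.injective.injOn)
    simp only [coe_filter, mem_univ, true_and, Set.mem_ofPred_eq] at hi ⊢
    exact ⟨hc _ hi.2, hi.2⟩

lemma card_eq_sum_col (l : Nat.Partition n) (p : Fin n → Prop) [DecidablePred p]
    (g : Perm (Fin n)) : #{i : Fin n | p i} =
      ∑ c ∈ univ.image (col l), #{i : Fin n | p i ∧ col l (g i) = c} := by
  rw [card_eq_sum_card_fiberwise (f := fun i => col l (g i)) (t := univ.image (col l))]
  · exact sum_congr rfl fun c _ => by rw [filter_filter]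
  · intro i _
    simp

/-- Summing the bound over all columns gives dominance. -/
lemma Transverse.sum_take_le {m : Nat.Partition n} {g : Perm (Fin n)} (H : Transverse l m g)
    (k : ℕ) : ((rows m).take k).sum ≤ ((rows l).take k).sum := by
  rw [← card_row_lt, ← card_row_lt, card_eq_sum_col l _ g, card_eq_sum_col l _ 1]
  exact sum_le_sum fun c _ => H.card_col_le k c

/-- Dominance implies the lexicographic comparison. Positivity of the entries of `A` excludes the
case in which `B` is a proper prefix of `A`. -/
lemma not_lt_of_sum_take_le {A B : List ℕ} (hA : ∀ a ∈ A, 0 < a)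
    (h : ∀ k, (A.take k).sum ≤ (B.take k).sum) : ¬ B < A := by
  induction A generalizing B with
  | nil => simp
  | cons a A ih =>
    have h1 := h 1
    cases B with
    | nil =>
      have := hA a (by simp)
      simp at h1
      omega
    | cons b B =>
      simp at h1
      rw [List.cons_lt_cons_iff]
      rintro (h2 | ⟨rfl, h2⟩)
      · omega
      · refine ih (fun a ha => hA a (by simp [ha])) (fun k => ?_) h2
        simpa using h (k + 1)

lemma Transverse.rows_le {m : Nat.Partition n} {g : Perm (Fin n)} (H : Transverse l m g) :
    rows m ≤ rows l :=
  not_lt.mp (not_lt_of_sum_take_le (fun _ h => rows_pos m h) H.sum_take_le)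

/-- A permutation that puts the entries of every row into different columns is the product of a
row preserving permutation and a column preserving one. -/
lemma Transverse.exists_col_mul_row {g : Perm (Fin n)} (H : Transverse l l g) :
    ∃ q : Perm (Fin n), (∀ i, col l (q i) = col l i) ∧ ∀ i, row l ((q * g) i) = row l i := by
  -- With equal shapes the totals over all columns agree, so each column inequality is an equality.
  have hcard : ∀ k, ∀ c ∈ univ.image (col l),
      #{i : Fin n | row l i < k ∧ col l (g i) = c} =
        #{j : Fin n | row l j < k ∧ col l j = c} := by
    intro k
    refine (sum_eq_sum_iff_of_le fun c _ => H.card_col_le k c).mp ?_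
    rw [← card_eq_sum_col l _ g]
    exact card_eq_sum_col l _ 1
  have hbox : ∀ i, ∃ j : Fin n, row l j = row l i ∧ col l j = col l (g i) := by
    -- If the box in the row of i and the column of g i were missing, that column would lie in
    -- earlier rows. The equality of counts would then put every entry moved into the column in an
    -- earlier row, but i is one of them.
    intro i
    by_contra hi
    push Not at hi
    have hlt : ∀ j, col l j = col l (g i) → row l j < row l i := by
      intro j hj
      by_contra hc
      push Not at hc
      obtain ⟨j', h1, h2⟩ := exists_above hc
      exact hi j' h1 (h2.trans hj)
    have h1 := hcard (row l i) (col l (g i)) (mem_image_of_mem _ (mem_univ _))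
    have h2 : #{j : Fin n | row l j < row l i ∧ col l j = col l (g i)} =
        #{j : Fin n | col l (g j) = col l (g i)} := by
      refine card_bij (fun j _ => g⁻¹ j) (fun j hj => ?_) (fun j _ j' _ h => by simpa using h)
        (fun j hj => ⟨g j, ?_, by simp⟩)
      · simp only [mem_filter, mem_univ, true_and] at hj ⊢
        simpa using hj.2
      · simp only [mem_filter, mem_univ, true_and] at hj ⊢
        exact ⟨hlt _ hj, hj⟩
    rw [h2] at h1
    have h3 := eq_of_subset_of_card_le (s := {j : Fin n | row l j < row l i ∧
      col l (g j) = col l (g i)}) (t := {j : Fin n | col l (g j) = col l (g i)})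
      (fun j hj => by simp only [mem_filter, mem_univ, true_and] at hj ⊢; exact hj.2) h1.ge
    have h4 : i ∈ ({j : Fin n | col l (g j) = col l (g i)} : Finset (Fin n)) := by simp
    rw [← h3] at h4
    simp at h4
  choose u hu1 hu2 using hbox
  have huinj : Function.Injective u := by
    intro i j h
    by_contra hne
    refine H i j hne ?_ ?_
    · rw [← hu1, h, hu1]
    · rw [← hu2, h, hu2]
  -- `U` sends i to the box in its own row and in the column of g i; the column permutation is U
  -- g⁻¹.
  let U : Perm (Fin n) := ofBijective u (Finite.injective_iff_bijective.mp huinj)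
  refine ⟨U * g⁻¹, fun i => ?_, fun i => ?_⟩
  · have := hu2 (g⁻¹ i)
    rw [show g (g⁻¹ i) = i by simp] at this
    exact this
  · rw [inv_mul_cancel_right]
    exact hu1 i

end Rows

/-! ### Exceeding multisets are lexicographically larger -/

lemma Exceeds.exists_split {K : List ℕ} {μ : Multiset ℕ} (h : Exceeds K μ) :
    ∃ K₁ n K₂ m, K = K₁ ++ n :: K₂ ∧ n < m ∧ m ::ₘ (K₂ : Multiset ℕ) ≤ μ := by
  induction K with
  | nil => exact h.elim
  | cons n K ih =>
    rcases h with h | ⟨m, h1, h2⟩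
    · obtain ⟨K₁, n', K₂, m, h1, h2, h3⟩ := ih h
      exact ⟨n :: K₁, n', K₂, m, by simp [h1], h2, h3⟩
    · exact ⟨[], n, K, m, rfl, h1, h2⟩

/-- The first entry of the sorted list `A` bounds every entry of the submultiset. Either it already
decides the comparison, or it equals the head of `L₁` and both are cancelled. -/
lemma lt_of_cons_le {A : List ℕ} (hA : A.Pairwise (· ≥ ·)) {L₁ L₂ : List ℕ} {n m : ℕ}
    (hnm : n < m) (h : m ::ₘ (L₁ : Multiset ℕ) ≤ A) : L₁ ++ n :: L₂ < A := by
  induction L₁ generalizing A with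
  | nil =>
    have hm : m ∈ A := Multiset.mem_of_le h (Multiset.mem_cons_self _ _)
    cases A with
    | nil => simp at hm
    | cons a A =>
      rw [List.nil_append, List.cons_lt_cons_iff]
      left
      rcases List.mem_cons.mp hm with rfl | hm
      · exact hnm
      · exact lt_of_lt_of_le hnm (List.rel_of_pairwise_cons hA hm)
  | cons b L₁ ih =>
    have hb : b ∈ A := Multiset.mem_of_le h (by simp)
    cases A with
    | nil => simp at hb
    | cons a A =>
      rw [List.cons_append, List.cons_lt_cons_iff]
      have hba : b ≤ a := by
        rcases List.mem_cons.mp hb with rfl | hb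
        · exact le_rfl
        · exact List.rel_of_pairwise_cons hA hb
      rcases lt_or_eq_of_le hba with h1 | rfl
      · exact Or.inl h1
      · refine Or.inr ⟨rfl, ih hA.of_cons ?_⟩
        rw [← Multiset.cons_coe, ← Multiset.cons_coe, Multiset.cons_swap,
          Multiset.cons_le_cons_iff] at h
        exact h

lemma Exceeds.lt {A L : List ℕ} (hA : A.Pairwise (· ≥ ·)) (h : Exceeds L.reverse A) : L < A := by
  obtain ⟨K₁, n, K₂, m, h1, h2, h3⟩ := h.exists_split
  have h4 : L = K₂.reverse ++ n :: K₁.reverse := by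
    rw [← L.reverse_reverse, h1]
    simp
  rw [h4]
  exact lt_of_cons_le hA h2 (by rwa [Multiset.coe_reverse])

end

section

/-! ### Symmetrizers and antisymmetrizers -/

variable {n : ℕ}

/-- A group element in the group algebra. -/
abbrev grp (σ : Perm (Fin n)) : GroupAlg n := MonoidAlgebra.of ℂ (Perm (Fin n)) σ

lemma coeff_grp (σ τ : Perm (Fin n)) : (grp σ).coeff τ = if σ = τ then 1 else 0 := by
  simp [grp, MonoidAlgebra.of_apply, Finsupp.single_apply]

lemma eq_sum_coeff_smul (x : GroupAlg n) : x = ∑ σ, x.coeff σ • grp σ := by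
  ext τ
  simp [MonoidAlgebra.coeff_sum]

/-- The sum of the permutations that preserve `f`. -/
def symSum (f : Fin n → ℕ) : GroupAlg n :=
  ∑ σ : Perm (Fin n) with ∀ i, f (σ i) = f i, grp σ

/-- The signed sum of the permutations that preserve `f`. -/
def altSum (f : Fin n → ℕ) : GroupAlg n :=
  ∑ σ : Perm (Fin n) with ∀ i, f (σ i) = f i, ((Perm.sign σ : ℤ) : ℂ) • grp σ

lemma youngSymmetrizer_eq (l : Nat.Partition n) :
    youngSymmetrizer l = symSum (row l) * altSum (col l) := by
  unfold youngSymmetrizer symSum altSum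
  congr!

lemma mem_preserve_mul_right {f : Fin n → ℕ} {p : Perm (Fin n)} (hp : ∀ i, f (p i) = f i)
    (σ : Perm (Fin n)) : (∀ i, f ((σ * p) i) = f i) ↔ ∀ i, f (σ i) = f i := by
  refine ⟨fun h i => ?_, fun h i => by rw [Perm.mul_apply, h, hp]⟩
  have h1 := h (p⁻¹ i)
  have h2 := hp (p⁻¹ i)
  rw [Perm.mul_apply, show p (p⁻¹ i) = i by simp] at h1
  rw [show p (p⁻¹ i) = i by simp] at h2
  rw [h1, h2]

lemma grp_mul_symSum {f : Fin n → ℕ} {p : Perm (Fin n)} (hp : ∀ i, f (p i) = f i) :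
    grp p * symSum f = symSum f := by
  rw [symSum, mul_sum]
  refine sum_equiv (Equiv.mulLeft p) (fun σ => ?_) (fun σ _ => ?_)
  · simp [hp]
  · exact (map_mul _ p σ).symm

lemma grp_mul_altSum {f : Fin n → ℕ} {p : Perm (Fin n)} (hp : ∀ i, f (p i) = f i) :
    grp p * altSum f = ((Perm.sign p : ℤ) : ℂ) • altSum f := by
  rw [altSum, mul_sum, smul_sum]
  refine sum_equiv (Equiv.mulLeft p) (fun σ => ?_) (fun σ _ => ?_)
  · simp [hp]
  · rw [Equiv.coe_mulLeft, mul_smul_comm, smul_smul, ← map_mul, Perm.sign_mul]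
    congr 1
    rcases Int.units_eq_one_or (Perm.sign p) with h | h <;> simp [h]

lemma altSum_mul_grp {f : Fin n → ℕ} {p : Perm (Fin n)} (hp : ∀ i, f (p i) = f i) :
    altSum f * grp p = ((Perm.sign p : ℤ) : ℂ) • altSum f := by
  rw [altSum, sum_mul, smul_sum]
  refine sum_equiv (Equiv.mulRight p) (fun σ => ?_) (fun σ _ => ?_)
  · simp only [mem_filter, mem_univ, true_and, coe_mulRight]
    exact (mem_preserve_mul_right hp σ).symm
  · rw [Equiv.coe_mulRight, smul_mul_assoc, smul_smul, ← map_mul, Perm.sign_mul]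
    congr 1
    rcases Int.units_eq_one_or (Perm.sign p) with h | h <;> simp [h]

lemma symSum_mul_grp {f : Fin n → ℕ} {p : Perm (Fin n)} (hp : ∀ i, f (p i) = f i) :
    symSum f * grp p = symSum f := by
  rw [symSum, sum_mul]
  refine sum_equiv (Equiv.mulRight p) (fun σ => ?_) (fun σ _ => ?_)
  · simp only [mem_filter, mem_univ, true_and, coe_mulRight]
    exact (mem_preserve_mul_right hp σ).symm
  · exact (map_mul _ σ p).symm

lemma symSum_mul_symSum (f : Fin n → ℕ) : symSum f * symSum f =
    (#{σ : Perm (Fin n) | ∀ i, f (σ i) = f i} : ℂ) • symSum f := by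
  conv_lhs => enter [1]; rw [symSum]
  rw [sum_mul, sum_congr rfl fun σ hσ => grp_mul_symSum (mem_filter.mp hσ).2, sum_const,
    Nat.cast_smul_eq_nsmul]

lemma swap_preserve {f : Fin n → ℕ} {i j : Fin n} (h : f i = f j) (k : Fin n) :
    f (swap i j k) = f k := by
  rw [swap_apply_def]
  split_ifs with h1 h2
  · rw [h1, h]
  · rw [h2, h]
  · rfl

lemma eq_zero_of_eq_neg_smul {x : GroupAlg n} (h : x = (-1 : ℂ) • x) : x = 0 := by
  have h2 : (2 : ℂ) • x = 0 := by
    calc (2 : ℂ) • x = x + x := two_smul ℂ x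
      _ = x + (-1 : ℂ) • x := by rw [← h]
      _ = 0 := by simp
  simpa using h2

/-- The transposition of i and j is absorbed by the row sum; moved across `g` it becomes a column
transposition, which changes the sign. The product is its own negative. -/
lemma altSum_mul_grp_mul_symSum_eq_zero {r c : Fin n → ℕ} {g : Perm (Fin n)} {i j : Fin n}
    (hij : i ≠ j) (hr : r i = r j) (hc : c (g i) = c (g j)) :
    altSum c * grp g * symSum r = 0 := by
  apply eq_zero_of_eq_neg_smul
  have h1 : grp g * grp (swap i j) = grp (swap (g i) (g j)) * grp g := by
    rw [← map_mul, ← map_mul, swap_apply_apply]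
    simp [mul_assoc]
  calc altSum c * grp g * symSum r = altSum c * grp g * (grp (swap i j) * symSum r) := by
        rw [grp_mul_symSum (swap_preserve hr)]
    _ = altSum c * grp (swap (g i) (g j)) * grp g * symSum r := by
        rw [mul_assoc (altSum c) _ (grp g), ← h1]; simp only [mul_assoc]
    _ = _ := by
        rw [altSum_mul_grp (swap_preserve hc), Perm.sign_swap (g.injective.ne hij)]
        simp

lemma symSum_mul_grp_inv_mul_altSum_eq_zero {r c : Fin n → ℕ} {g : Perm (Fin n)} {i j : Fin n}
    (hij : i ≠ j) (hr : r i = r j) (hc : c (g i) = c (g j)) :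
    symSum r * grp g⁻¹ * altSum c = 0 := by
  apply eq_zero_of_eq_neg_smul
  have h1 : grp (swap i j) * grp g⁻¹ = grp g⁻¹ * grp (swap (g i) (g j)) := by
    rw [← map_mul, ← map_mul, swap_apply_apply]
    simp [mul_assoc]
  calc symSum r * grp g⁻¹ * altSum c = symSum r * grp (swap i j) * grp g⁻¹ * altSum c := by
        rw [symSum_mul_grp (swap_preserve hr)]
    _ = symSum r * grp g⁻¹ * (grp (swap (g i) (g j)) * altSum c) := by
        rw [mul_assoc (symSum r), h1]; simp only [mul_assoc]
    _ = _ := by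
        rw [grp_mul_altSum (swap_preserve hc), Perm.sign_swap (g.injective.ne hij)]
        simp

section Young

variable (l : Nat.Partition n)

lemma eq_one_of_preserve {σ : Perm (Fin n)} (hr : ∀ i, row l (σ i) = row l i)
    (hc : ∀ i, col l (σ i) = col l i) : σ = 1 := by
  ext i
  rw [eq_of_row_of_col (hr i) (hc i), Perm.one_apply]

lemma preserve_inv {f : Fin n → ℕ} {σ : Perm (Fin n)} (h : ∀ i, f (σ i) = f i) (i : Fin n) :
    f (σ⁻¹ i) = f i := by
  have := h (σ⁻¹ i)
  rw [show σ (σ⁻¹ i) = i by simp] at this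
  exact this.symm

/-- Only the identity preserves both rows and columns, so it arises from exactly one pair of
factors. -/
lemma coeff_one_symSum_mul_altSum : (symSum (row l) * altSum (col l)).coeff 1 = 1 := by
  rw [symSum, altSum, sum_mul_sum, MonoidAlgebra.coeff_sum, Finsupp.finsetSum_apply]
  rw [sum_eq_single 1]
  · rw [MonoidAlgebra.coeff_sum, Finsupp.finsetSum_apply, sum_eq_single 1]
    · simp
    · intro σ _ h
      rw [mul_smul_comm, ← map_mul, MonoidAlgebra.coeff_smul, Finsupp.smul_apply, coeff_grp,
        if_neg (by simpa using h), smul_zero]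
    · simp
  · intro σ hσ h
    rw [MonoidAlgebra.coeff_sum, Finsupp.finsetSum_apply]
    refine sum_eq_zero fun τ hτ => ?_
    rw [mul_smul_comm, ← map_mul, MonoidAlgebra.coeff_smul, Finsupp.smul_apply, coeff_grp,
      if_neg, smul_zero]
    intro h1
    rw [mul_eq_one_iff_eq_inv] at h1
    refine h (eq_one_of_preserve l (mem_filter.mp hσ).2 ?_)
    rw [h1]
    exact preserve_inv (mem_filter.mp hτ).2
  · simp

lemma coeff_one_altSum_mul_symSum : (altSum (col l) * symSum (row l)).coeff 1 = 1 := by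
  rw [← coeff_one_symSum_mul_altSum l]
  classical
  rw [MonoidAlgebra.coeff_mul, MonoidAlgebra.coeff_mul, Finsupp.sum_comm]
  refine Finsupp.sum_congr fun σ _ => Finsupp.sum_congr fun τ _ => ?_
  rw [mul_comm (MonoidAlgebra.coeff _ τ)]
  exact if_congr mul_eq_one_comm rfl rfl

/-- Either two entries of a row meet in a column and the product is 0, or g = q⁻¹ (qg) with a column
factor and a row factor, both absorbed up to sign. -/
lemma exists_altSum_mul_grp_mul_symSum (g : Perm (Fin n)) : ∃ s : ℂ,
    altSum (col l) * grp g * symSum (row l) = s • (altSum (col l) * symSum (row l)) := by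
  by_cases H : Transverse l l g
  · obtain ⟨q, hq1, hq2⟩ := H.exists_col_mul_row
    refine ⟨((Perm.sign q⁻¹ : ℤ) : ℂ), ?_⟩
    have : grp g = grp q⁻¹ * grp (q * g) := by rw [← map_mul, inv_mul_cancel_left]
    rw [this, ← mul_assoc, altSum_mul_grp (preserve_inv hq1), mul_assoc, grp_mul_symSum hq2,
      smul_mul_assoc]
  · simp only [Transverse, ne_eq, not_forall, not_not] at H
    obtain ⟨i, j, h1, h2, h3⟩ := H
    exact ⟨0, by rw [altSum_mul_grp_mul_symSum_eq_zero h1 h2 h3, zero_smul]⟩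

lemma exists_symSum_mul_grp_mul_altSum (g : Perm (Fin n)) : ∃ s : ℂ,
    symSum (row l) * grp g * altSum (col l) = s • (symSum (row l) * altSum (col l)) := by
  obtain ⟨g, rfl⟩ := inv_surjective g
  by_cases H : Transverse l l g
  · obtain ⟨q, hq1, hq2⟩ := H.exists_col_mul_row
    refine ⟨((Perm.sign q : ℤ) : ℂ), ?_⟩
    have : grp g⁻¹ = grp (q * g)⁻¹ * grp q := by rw [← map_mul]; simp
    rw [this, ← mul_assoc, symSum_mul_grp (preserve_inv hq2), mul_assoc, grp_mul_altSum hq1,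
      mul_smul_comm]
  · simp only [Transverse, ne_eq, not_forall, not_not] at H
    obtain ⟨i, j, h1, h2, h3⟩ := H
    exact ⟨0, by rw [symSum_mul_grp_inv_mul_altSum_eq_zero h1 h2 h3, zero_smul]⟩

/-- If `y g z` is a multiple of `w` for all group elements `g`, and `w` has constant coefficient
`1`, then `y x z` is a multiple of `w` for all `x`. -/
lemma mul_mul_eq_coeff_smul {y z w : GroupAlg n} (hw : w.coeff 1 = 1)
    (h : ∀ g, ∃ s : ℂ, y * grp g * z = s • w) (x : GroupAlg n) :
    y * x * z = (y * x * z).coeff 1 • w := by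
  conv_lhs => rw [eq_sum_coeff_smul x]
  conv_rhs => rw [eq_sum_coeff_smul x]
  simp only [mul_sum, sum_mul, mul_smul_comm, smul_mul_assoc, MonoidAlgebra.coeff_sum,
    Finsupp.finsetSum_apply, sum_smul, MonoidAlgebra.coeff_smul, Finsupp.smul_apply]
  refine sum_congr rfl fun g _ => ?_
  obtain ⟨s, hs⟩ := h g
  rw [hs, MonoidAlgebra.coeff_smul, Finsupp.smul_apply, hw, smul_smul]
  simp

lemma altSum_mul_mul_symSum (x : GroupAlg n) : altSum (col l) * x * symSum (row l) =
    (altSum (col l) * x * symSum (row l)).coeff 1 • (altSum (col l) * symSum (row l)) :=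
  mul_mul_eq_coeff_smul (coeff_one_altSum_mul_symSum l) (exists_altSum_mul_grp_mul_symSum l) x

lemma symSum_mul_mul_altSum (x : GroupAlg n) : symSum (row l) * x * altSum (col l) =
    (symSum (row l) * x * altSum (col l)).coeff 1 • youngSymmetrizer l := by
  rw [youngSymmetrizer_eq]
  exact mul_mul_eq_coeff_smul (coeff_one_symSum_mul_altSum l) (exists_symSum_mul_grp_mul_altSum l) x

lemma coeff_one_youngSymmetrizer : (youngSymmetrizer l).coeff 1 = 1 := by
  rw [youngSymmetrizer_eq, coeff_one_symSum_mul_altSum]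

/-- The scalar `n_λ` with `c_λ² = n_λ c_λ`. -/
def youngScalar : ℂ := (youngSymmetrizer l * youngSymmetrizer l).coeff 1

/-- The element c_λ x c_λ has the form a_λ y b_λ with y = b_λ x a_λ. -/
lemma youngSymmetrizer_mul_mul (x : GroupAlg n) :
    youngSymmetrizer l * x * youngSymmetrizer l =
      (youngSymmetrizer l * x * youngSymmetrizer l).coeff 1 • youngSymmetrizer l := by
  have h : youngSymmetrizer l * x * youngSymmetrizer l = symSum (row l) *
      (altSum (col l) * x * symSum (row l)) * altSum (col l) := by
    rw [youngSymmetrizer_eq]; simp only [mul_assoc]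
  rw [h]
  exact symSum_mul_mul_altSum l _

lemma youngSymmetrizer_mul_self :
    youngSymmetrizer l * youngSymmetrizer l = youngScalar l • youngSymmetrizer l := by
  simpa [youngScalar] using youngSymmetrizer_mul_mul l 1

/-- The trace of an endomorphism of the group algebra. -/
lemma trace_eq_sum_coeff (T : GroupAlg n →ₗ[ℂ] GroupAlg n) :
    LinearMap.trace ℂ _ T = ∑ h, (T (grp h)).coeff h := by
  rw [LinearMap.trace_eq_matrix_trace ℂ (MonoidAlgebra.basis (Perm (Fin n)) ℂ), Matrix.trace]
  refine sum_congr rfl fun h _ => ?_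
  rw [Matrix.diag_apply, LinearMap.toMatrix_apply, MonoidAlgebra.basis_apply]
  rfl

lemma trace_mulRight_youngSymmetrizer :
    LinearMap.trace ℂ _ (LinearMap.mulRight ℂ (youngSymmetrizer l)) = (n.factorial : ℂ) := by
  rw [trace_eq_sum_coeff]
  have : ∀ h ∈ (univ : Finset (Perm (Fin n))),
      (LinearMap.mulRight ℂ (youngSymmetrizer l) (grp h)).coeff h = 1 := by
    intro h _
    rw [LinearMap.mulRight_apply, grp, MonoidAlgebra.of_apply, MonoidAlgebra.coeff_single_mul_apply,
      inv_mul_cancel, coeff_one_youngSymmetrizer, one_mul]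
  rw [sum_congr rfl this, sum_const, card_univ, Fintype.card_perm, Fintype.card_fin]
  simp

/-- If the scalar were 0, right multiplication by c_λ would be nilpotent and have trace 0; its trace
is n!, as c_λ has coefficient 1 at the identity. -/
lemma youngScalar_ne_zero : youngScalar l ≠ 0 := by
  intro h0
  have h1 := youngSymmetrizer_mul_self l
  rw [h0, zero_smul] at h1
  have h2 : IsNilpotent (LinearMap.mulRight ℂ (youngSymmetrizer l)) := by
    refine ⟨2, ?_⟩
    refine LinearMap.ext fun x => ?_
    rw [pow_two, Module.End.mul_apply, LinearMap.mulRight_apply, LinearMap.mulRight_apply,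
      mul_assoc, h1, mul_zero, LinearMap.zero_apply]
  have h3 := (LinearMap.isNilpotent_trace_of_isNilpotent h2).eq_zero
  rw [trace_mulRight_youngSymmetrizer] at h3
  exact Nat.factorial_ne_zero n (by exact_mod_cast h3)

end Young

end

section

variable {n : ℕ}

/-! ### The characteristic map -/

/-- The map `p` with values in power series. -/
def toSer : GroupAlg n →ₗ[ℂ] Ser ℂ where
  toFun x := ∑ σ, x.coeff σ • MvPowerSeries.monomial (cyc σ) 1
  map_add' x y := by
    simp only [MonoidAlgebra.coeff_add, Finsupp.add_apply, add_smul, sum_add_distrib]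
  map_smul' r x := by
    simp only [MonoidAlgebra.coeff_smul, Finsupp.smul_apply, smul_sum, smul_assoc,
      RingHom.id_apply]

lemma toSer_apply (x : GroupAlg n) :
    toSer x = ∑ σ, x.coeff σ • MvPowerSeries.monomial (cyc σ) 1 := rfl

lemma toSer_grp (σ : Perm (Fin n)) : toSer (grp σ) = MvPowerSeries.monomial (cyc σ) 1 := by
  simp only [toSer_apply, coeff_grp, ite_smul, one_smul, zero_smul]
  simp

lemma coeff_toSer (x : GroupAlg n) (γ : Expo) :
    MvPowerSeries.coeff γ (toSer x) = ∑ σ with cyc σ = γ, x.coeff σ := by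
  simp only [toSer_apply, map_sum, map_smul, MvPowerSeries.coeff_monomial, smul_eq_mul, mul_ite,
    mul_one, mul_zero, sum_filter]
  exact sum_congr rfl fun σ _ => if_congr eq_comm rfl rfl

lemma coeff_toSer_of_wt_ne (x : GroupAlg n) {γ : Expo} (h : wt γ ≠ n) :
    MvPowerSeries.coeff γ (toSer x) = 0 := by
  rw [coeff_toSer]
  refine sum_eq_zero fun σ hσ => absurd ?_ h
  rw [← (mem_filter.mp hσ).2, wt_cyc, Fintype.card_fin]

lemma prod_map_X (m : Multiset ℕ) : (m.map fun k => (MvPolynomial.X k.toPNat' :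
    MvPolynomial ℕ+ ℂ)).prod = MvPolynomial.monomial (expo m) 1 := by
  induction m using Multiset.induction_on with
  | empty => simp
  | cons a m ih =>
    rw [Multiset.map_cons, Multiset.prod_cons, ih, expo_cons, MvPolynomial.X,
      MvPolynomial.monomial_mul, one_mul, add_comm]

lemma pMap_eq (x : GroupAlg n) :
    pMap n x = ∑ σ, MvPolynomial.monomial (cyc σ) (x.coeff σ) := by
  rw [pMap]
  refine sum_congr rfl fun σ _ => ?_
  rw [prod_map_X, MvPolynomial.smul_monomial, smul_eq_mul, mul_one]
  rfl

lemma coeff_pMap (x : GroupAlg n) (γ : Expo) :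
    MvPolynomial.coeff γ (pMap n x) = ∑ σ with cyc σ = γ, x.coeff σ := by
  simp only [pMap_eq, MvPolynomial.coeff_sum, MvPolynomial.coeff_monomial, sum_filter]

lemma coe_pMap (x : GroupAlg n) : (pMap n x : MvPowerSeries ℕ+ ℂ) = toSer x := by
  ext γ
  rw [MvPolynomial.coeff_coe, coeff_pMap, coeff_toSer]

lemma linearMap_ext_grp {M : Type*} [AddCommMonoid M] [Module ℂ M] {T U : GroupAlg n →ₗ[ℂ] M}
    (h : ∀ σ, T (grp σ) = U (grp σ)) : T = U := by
  ext σ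
  simpa using h σ

/-- The trace of `h ↦ x h y` on the group algebra, as a bilinear form. -/
def traceForm : GroupAlg n →ₗ[ℂ] GroupAlg n →ₗ[ℂ] ℂ :=
  LinearMap.mk₂ ℂ (fun x y => ∑ h, (x * grp h * y).coeff h)
    (fun x x' y => by simp only [add_mul, MonoidAlgebra.coeff_add, Finsupp.add_apply,
      sum_add_distrib])
    (fun r x y => by simp only [smul_mul_assoc, MonoidAlgebra.coeff_smul, Finsupp.smul_apply,
      smul_sum])
    (fun x y y' => by simp only [mul_add, MonoidAlgebra.coeff_add, Finsupp.add_apply,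
      sum_add_distrib])
    (fun r x y => by simp only [mul_smul_comm, MonoidAlgebra.coeff_smul, Finsupp.smul_apply,
      smul_sum])

lemma traceForm_apply (x y : GroupAlg n) :
    traceForm x y = ∑ h, (x * grp h * y).coeff h := rfl

/-- The form on symmetric functions is the trace form on the group algebra. -/
lemma form_toSer (x y : GroupAlg n) : form n (toSer x) (toSer y) = traceForm x y := by
  have h : (form n).compl₁₂ toSer toSer = (traceForm : GroupAlg n →ₗ[ℂ] GroupAlg n →ₗ[ℂ] ℂ) := by
    refine linearMap_ext_grp fun σ => linearMap_ext_grp fun τ => ?_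
    rw [LinearMap.compl₁₂_apply, toSer_grp, toSer_grp, form_apply, traceForm_apply]
    simp only [← map_mul, coeff_grp, MvPowerSeries.coeff_monomial]
    rw [sum_eq_single (cyc σ)]
    · rw [if_pos rfl, one_mul]
      -- The trace counts the h conjugating σ to τ⁻¹. As τ⁻¹ has the cycle type of τ, there are
      -- `zee` many or none.
      have h2 : ∀ h : Perm (Fin n), (h = σ * h * τ) ↔ h⁻¹ * σ * h⁻¹⁻¹ = τ⁻¹ := by
        intro h
        rw [inv_inv, eq_inv_iff_mul_eq_one, mul_assoc, mul_assoc, mul_assoc, inv_mul_eq_one]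
      have h3 : ∑ h : Perm (Fin n), (if σ * h * τ = h then (1 : ℂ) else 0) =
          ∑ h : Perm (Fin n), if h * σ * h⁻¹ = τ⁻¹ then (1 : ℂ) else 0 := by
        rw [← Equiv.sum_comp (Equiv.inv (Perm (Fin n))) fun h => if h * σ * h⁻¹ = τ⁻¹ then (1 : ℂ) else 0]
        exact sum_congr rfl fun h _ => if_congr (eq_comm.trans (h2 h)) rfl rfl
      rw [h3, sum_boole]
      by_cases hc : cyc σ = cyc τ
      · rw [if_pos hc, mul_one, card_conj_eq (hc.trans (cyc_inv τ).symm)]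
      · rw [if_neg hc, mul_zero, filter_false_of_mem, card_empty, Nat.cast_zero]
        intro h _ hh
        exact hc (by rw [← cyc_conj h σ, hh, cyc_inv])
    · intro γ _ hγ
      simp [hγ]
    · intro hσ
      exact absurd (wt_cyc σ) (by simpa using hσ)
  exact LinearMap.congr_fun₂ h x y

end

section

variable {n : ℕ}

/-! ### Orthogonality -/

lemma coeff_one_mul_comm (x y : GroupAlg n) : (x * y).coeff 1 = (y * x).coeff 1 := by
  rw [MonoidAlgebra.coeff_mul, MonoidAlgebra.coeff_mul, Finsupp.sum_comm]
  refine Finsupp.sum_congr fun σ _ => Finsupp.sum_congr fun τ _ => ?_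
  rw [mul_comm (MonoidAlgebra.coeff _ τ)]
  exact if_congr mul_eq_one_comm rfl rfl

/-- In the sum over group elements h, the coefficient of h in u h v contributes the coefficient w_h,
and these reassemble w in the place of x. -/
lemma traceForm_eq_coeff_one {u v u' v' w : GroupAlg n}
    (h : ∀ x, u * x * v = (u' * x * v').coeff 1 • w) : traceForm u v = (u' * w * v').coeff 1 := by
  rw [traceForm_apply]
  conv_rhs => rw [eq_sum_coeff_smul w]
  rw [mul_sum, sum_mul, MonoidAlgebra.coeff_sum, Finsupp.finsetSum_apply]
  refine sum_congr rfl fun σ _ => ?_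
  rw [h, mul_smul_comm, smul_mul_assoc, MonoidAlgebra.coeff_smul, MonoidAlgebra.coeff_smul,
    Finsupp.smul_apply, Finsupp.smul_apply, smul_eq_mul, smul_eq_mul, mul_comm]

section

variable (l : Nat.Partition n)

lemma traceForm_youngSymmetrizer_self :
    traceForm (youngSymmetrizer l) (youngSymmetrizer l) = youngScalar l ^ 2 := by
  rw [traceForm_eq_coeff_one (youngSymmetrizer_mul_mul l), youngSymmetrizer_mul_self,
    smul_mul_assoc, youngSymmetrizer_mul_self, smul_smul, MonoidAlgebra.coeff_smul,
    Finsupp.smul_apply, coeff_one_youngSymmetrizer, smul_eq_mul, mul_one, pow_two]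

lemma traceForm_youngSymmetrizer_symSum_row :
    traceForm (youngSymmetrizer l) (symSum (row l)) =
      (#{σ : Perm (Fin n) | ∀ i, row l (σ i) = row l i} : ℂ) * youngScalar l := by
  have h : ∀ x, youngSymmetrizer l * x * symSum (row l) =
      (altSum (col l) * x * symSum (row l)).coeff 1 • (youngSymmetrizer l * symSum (row l)) := by
    intro x
    have h1 : youngSymmetrizer l * x * symSum (row l) =
        symSum (row l) * (altSum (col l) * x * symSum (row l)) := by
      rw [youngSymmetrizer_eq]
      simp only [mul_assoc]
    rw [h1, altSum_mul_mul_symSum, mul_smul_comm, ← mul_assoc, ← youngSymmetrizer_eq,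
      ← altSum_mul_mul_symSum]
  rw [traceForm_eq_coeff_one h, mul_assoc, mul_assoc, symSum_mul_symSum, mul_smul_comm,
    mul_smul_comm, MonoidAlgebra.coeff_smul, Finsupp.smul_apply, smul_eq_mul, ← mul_assoc,
    coeff_one_mul_comm, ← mul_assoc, ← youngSymmetrizer_eq]
  rfl

variable {l}

/-- A transverse g would force the shape `m` to be at most `l`; hence each g puts two entries of a
row into one column. -/
lemma altSum_mul_mul_symSum_eq_zero {m : Nat.Partition n} (h : rows l < rows m) (x : GroupAlg n) :
    altSum (col l) * x * symSum (row m) = 0 := by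
  rw [eq_sum_coeff_smul x, mul_sum, sum_mul]
  refine sum_eq_zero fun g _ => ?_
  have h1 : ¬ Transverse l m g := fun H => not_le_of_gt h H.rows_le
  unfold Transverse at h1
  push Not at h1
  obtain ⟨i, j, hij, hr, hc⟩ := h1
  rw [mul_smul_comm, smul_mul_assoc, altSum_mul_grp_mul_symSum_eq_zero hij hr hc, smul_zero]

lemma traceForm_youngSymmetrizer_symSum_eq_zero {m : Nat.Partition n} (h : rows l < rows m) :
    traceForm (youngSymmetrizer l) (symSum (row m)) = 0 := by
  rw [traceForm_apply]
  refine sum_eq_zero fun g _ => ?_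
  rw [youngSymmetrizer_eq, mul_assoc, mul_assoc, ← mul_assoc (altSum (col l)),
    altSum_mul_mul_symSum_eq_zero h]
  simp

lemma traceForm_comm (x y : GroupAlg n) : traceForm x y = traceForm y x := by
  rw [← form_toSer, form_comm, form_toSer]

lemma traceForm_youngSymmetrizer_eq_zero {m : Nat.Partition n} (h : l ≠ m) :
    traceForm (youngSymmetrizer l) (youngSymmetrizer m) = 0 := by
  -- The vanishing argument works in one lexicographic order only; the symmetry of the form supplies
  -- the other.
  wlog hlt : rows l < rows m generalizing l m
  · rw [traceForm_comm]
    refine this h.symm (lt_of_le_of_ne (not_lt.mp hlt) fun h' => h (rows_injective h').symm)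
  rw [traceForm_apply]
  refine sum_eq_zero fun g _ => ?_
  rw [youngSymmetrizer_eq, youngSymmetrizer_eq, mul_assoc (symSum (row l)), mul_assoc,
    ← mul_assoc _ (symSum (row m)), altSum_mul_mul_symSum_eq_zero hlt]
  simp

end

/-- The Schur function of `λ`, up to a nonzero factor. -/
def schur (l : Nat.Partition n) : Ser ℂ := toSer (youngSymmetrizer l)

lemma form_schur_self (l : Nat.Partition n) : form n (schur l) (schur l) = youngScalar l ^ 2 := by
  rw [schur, form_toSer, traceForm_youngSymmetrizer_self]

lemma form_schur_eq_zero {l m : Nat.Partition n} (h : l ≠ m) : form n (schur l) (schur m) = 0 := by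
  rw [schur, schur, form_toSer, traceForm_youngSymmetrizer_eq_zero h]

lemma row_lt_length (l : Nat.Partition n) (i : Fin n) : row l i < (rows l).length := by
  by_contra h
  have := col_lt (l := l) i
  rw [List.getD_eq_default _ _ (not_lt.mp h)] at this
  omega

/-- The row group is a product of symmetric groups, each contributing λ_i! times the complete
function h_{λ_i}. -/
lemma toSer_symSum_row (l : Nat.Partition n) : ∃ s : ℂ, s ≠ 0 ∧
    toSer (symSum (row l)) = s • completeProd ℂ l.parts := by
  refine ⟨∏ i : Fin (rows l).length, (((rows l).get i).factorial : ℂ),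
    prod_ne_zero_iff.mpr fun i _ => Nat.cast_ne_zero.mpr (Nat.factorial_ne_zero _), ?_⟩
  rw [symSum, map_sum]
  simp only [toSer_grp]
  have h := sum_monomial_cyc_fiber fun i => (⟨row l i, row_lt_length l i⟩ : Fin (rows l).length)
  simp only [Fin.mk.injEq] at h
  rw [h, ← coe_rows l, completeProd, Multiset.map_coe, Multiset.prod_coe,
    ← Fin.prod_univ_fun_getElem, ← Finset.prod_smul]
  refine prod_congr rfl fun i _ => ?_
  rw [sum_monomial_cyc, Fintype.card_subtype]
  have h1 : #{x : Fin n | (⟨row l x, row_lt_length l x⟩ : Fin (rows l).length) = i} =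
      (rows l).get i := by
    simp only [Fin.ext_iff]
    rw [card_row]
    simp
  rw [h1]
  rfl

end

section

variable {R : Type*} [CommRing R] [Algebra ℂ R] {n : ℕ}

/-! ### Schur functions as eigenvectors -/

/-- The power series that are quasi-homogeneous of weight `n`. -/
def HasWt (n : ℕ) (F : Ser R) : Prop := ∀ γ, wt γ ≠ n → MvPowerSeries.coeff γ F = 0

lemma HasWt.mul {m n : ℕ} {F G : Ser R} (hF : HasWt m F) (hG : HasWt n G) :
    HasWt (m + n) (F * G) := by
  intro γ hγ
  classical
  rw [MvPowerSeries.coeff_mul]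
  refine sum_eq_zero fun x hx => ?_
  by_cases h1 : wt x.1 = m
  · rw [hG x.2 fun h2 => hγ ?_, mul_zero]
    rw [← HasAntidiagonal.mem_antidiagonal.mp hx, map_add, h1, h2]
  · rw [hF _ h1, zero_mul]

lemma hasWt_expPart (x : ℕ → R) (m : ℕ) : HasWt m (expPart x m) := by
  intro γ hγ
  rw [coeff_expPart, if_neg hγ]

lemma hasWt_expDiff (x : ℕ → R) (m : ℕ) {F : Ser R} (hF : HasWt (n + m) F) :
    HasWt n (expDiff x m F) := by
  intro γ hγ
  rw [expDiff, LinearMap.sum_apply, map_sum]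
  refine sum_eq_zero fun β hβ => ?_
  rw [LinearMap.smul_apply, map_smul, coeff_diffOp, hF, mul_zero, smul_zero]
  rw [map_add, mem_expos.mp hβ]
  omega

lemma hasWt_vertexOp (t u : R) {F : Ser R} (hF : HasWt n F) : HasWt n (vertexOp t u n F) := by
  intro γ hγ
  rw [vertexOp_apply, map_sum]
  refine sum_eq_zero fun m hm => ?_
  have hmn : n - m + m = n := Nat.sub_add_cancel (by simpa [Nat.lt_succ_iff] using hm)
  have := (hasWt_expPart (powDiff t u) m).mul
    (hasWt_expDiff (n := n - m) (powDiff t u) m (F := F) (by rwa [hmn]))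
  rw [add_comm, hmn] at this
  exact this γ hγ

lemma hasWt_completeProd (μ : Multiset ℕ) : HasWt μ.sum (completeProd R μ) := by
  induction μ using Multiset.induction_on with
  | empty =>
    intro γ hγ
    classical
    rw [completeProd, Multiset.map_zero, Multiset.prod_zero, MvPowerSeries.coeff_one, if_neg]
    rintro rfl
    simp at hγ
  | cons a μ ih =>
    rw [completeProd_cons, Multiset.sum_cons]
    exact (hasWt_expPart _ _).mul ih

lemma hasWt_toSer (x : GroupAlg n) : HasWt n (toSer x) := fun _ h => coeff_toSer_of_wt_ne x h

lemma hasWt_schur (l : Nat.Partition n) : HasWt n (schur l) := hasWt_toSer _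

lemma HasWt.form_eq_zero {m : ℕ} {F : Ser R} (hF : HasWt m F) (h : m ≠ n) (G : Ser R) :
    form n F G = 0 := by
  rw [form_apply]
  refine sum_eq_zero fun γ hγ => ?_
  rw [hF γ (by rw [mem_expos.mp hγ]; exact h.symm), zero_mul, mul_zero]

lemma completeProd_filter (μ : Multiset ℕ) :
    completeProd R (μ.filter (0 < ·)) = completeProd R μ := by
  induction μ using Multiset.induction_on with
  | empty => rfl
  | cons a μ ih =>
    rcases Nat.eq_zero_or_pos a with rfl | ha
    · rw [Multiset.filter_cons_of_neg _ (lt_irrefl 0), completeProd_cons, complete_zero, one_mul, ih]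
    · rw [Multiset.filter_cons_of_pos (p := (0 < ·)) _ ha, completeProd_cons, completeProd_cons, ih]

lemma form_schur_completeProd_parts {l m : Nat.Partition n} (h : rows l < rows m) :
    form n (schur l) (completeProd ℂ m.parts) = 0 := by
  obtain ⟨s, hs, h1⟩ := toSer_symSum_row m
  have h2 := traceForm_youngSymmetrizer_symSum_eq_zero h
  rw [← form_toSer, h1, map_smul, smul_eq_mul] at h2
  exact (mul_eq_zero.mp h2).resolve_left hs

lemma form_schur_completeProd_self (l : Nat.Partition n) :
    form n (schur l) (completeProd ℂ l.parts) ≠ 0 := by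
  obtain ⟨s, hs, h1⟩ := toSer_symSum_row l
  have h2 := traceForm_youngSymmetrizer_symSum_row l
  rw [← form_toSer, h1, map_smul, smul_eq_mul] at h2
  intro h3
  rw [schur] at h3
  rw [h3, mul_zero] at h2
  refine mul_ne_zero ?_ (youngScalar_ne_zero l) h2.symm
  rw [Nat.cast_ne_zero, ← Nat.pos_iff_ne_zero, card_pos]
  exact ⟨1, by simp⟩

lemma Exceeds.filter {L : List ℕ} (hL : ∀ a ∈ L, 0 < a) {μ : Multiset ℕ} (h : Exceeds L μ) :
    Exceeds L (μ.filter (0 < ·)) := by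
  induction L with
  | nil => exact h
  | cons n L ih =>
    rcases h with h | ⟨m, hm, h⟩
    · exact Or.inl (ih (fun a ha => hL a (List.mem_cons_of_mem _ ha)) h)
    · refine Or.inr ⟨m, hm, Multiset.le_filter.mpr ⟨h, fun a ha => ?_⟩⟩
      rcases Multiset.mem_cons.mp ha with rfl | ha
      · omega
      · exact hL a (List.mem_cons_of_mem _ ha)

/-- Zeros in μ do not matter because h_0 = 1. The rest either has the wrong weight or is a partition
lexicographically larger than `m`, hence than `l`. -/
lemma form_schur_completeProd_eq_zero {l m : Nat.Partition n} (hlm : rows l ≤ rows m)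
    {μ : Multiset ℕ} (h : Exceeds (rows m).reverse μ) :
    form n (schur l) (completeProd ℂ μ) = 0 := by
  rw [← completeProd_filter]
  have h1 : Exceeds (rows m).reverse (μ.filter (0 < ·)) :=
    h.filter fun a ha => rows_pos m (List.mem_reverse.mp ha)
  by_cases hn : (μ.filter (0 < ·)).sum = n
  · let k : Nat.Partition n := ⟨μ.filter (0 < ·), fun h => (Multiset.mem_filter.mp h).2, hn⟩
    refine form_schur_completeProd_parts (m := k) (hlm.trans_lt ?_)
    refine Exceeds.lt (rows_pairwise k) ?_
    rwa [coe_rows]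
  · rw [form_comm]
    exact (hasWt_completeProd _).form_eq_zero hn _

/-! ### Extension of scalars -/

/-- Extension of scalars from `ℂ` to `R`. -/
abbrev extend (R : Type*) [CommRing R] [Algebra ℂ R] : Ser ℂ →+* Ser R :=
  MvPowerSeries.map (algebraMap ℂ R)

lemma extend_completeProd (μ : Multiset ℕ) :
    extend R (completeProd ℂ μ) = completeProd R μ := by
  rw [completeProd, completeProd, map_multiset_prod, Multiset.map_map]
  congr 1
  refine Multiset.map_congr rfl fun a _ => ?_
  ext γ
  rw [Function.comp_apply, MvPowerSeries.coeff_map, coeff_complete, coeff_complete]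
  split_ifs <;> simp

lemma form_extend (F G : Ser ℂ) :
    form n (extend R F) (extend R G) = algebraMap ℂ R (form n F G) := by
  simp only [form_apply, MvPowerSeries.coeff_map, map_sum, map_mul, map_natCast]

lemma HasWt.extend {F : Ser ℂ} (h : HasWt n F) : HasWt n (extend R F) := by
  intro γ hγ
  rw [MvPowerSeries.coeff_map, h γ hγ, map_zero]

/-- The second orthogonality relation. -/
lemma sum_schur_mul_schur {γ δ : Expo} (hγ : wt γ = n) (hδ : wt δ = n) :
    ∑ l : Nat.Partition n, (youngScalar l ^ 2)⁻¹ *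
      (MvPowerSeries.coeff γ (schur l) * MvPowerSeries.coeff δ (schur l)) =
      if γ = δ then (zee γ : ℂ)⁻¹ else 0 := by
  -- Orthogonality of the Schur functions says AB = 1; for square matrices BA = 1 follows, which is
  -- the dual relation.
  let A : Matrix (Nat.Partition n) (Nat.Partition n) ℂ :=
    Matrix.of fun l m => MvPowerSeries.coeff (expo m.parts) (schur l)
  let B : Matrix (Nat.Partition n) (Nat.Partition n) ℂ :=
    Matrix.of fun m l => zee (expo m.parts) * MvPowerSeries.coeff (expo m.parts) (schur l) *
      (youngScalar l ^ 2)⁻¹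
  have hAB : A * B = 1 := by
    ext l m
    rw [Matrix.mul_apply, Matrix.one_apply]
    have h1 : ∑ j, A l j * B j m = form n (schur l) (schur m) * (youngScalar m ^ 2)⁻¹ := by
      rw [form_apply, sum_expos_eq_sum_partition, sum_mul]
      exact sum_congr rfl fun j _ => by simp only [A, B, Matrix.of_apply]; ring
    rw [h1]
    split_ifs with h
    · rw [h, form_schur_self, mul_inv_cancel₀ (pow_ne_zero 2 (youngScalar_ne_zero m))]
    · rw [form_schur_eq_zero h, zero_mul]
  have hBA : B * A = 1 := mul_eq_one_comm.mp hAB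
  have h2 := congrFun (congrFun hBA (toPartition γ hγ)) (toPartition δ hδ)
  rw [Matrix.mul_apply, Matrix.one_apply] at h2
  have h3 : (toPartition γ hγ = toPartition δ hδ) ↔ γ = δ := by
    refine ⟨fun h => ?_, fun h => by subst h; rfl⟩
    rw [← expo_indices γ, ← expo_indices δ]
    exact congrArg (fun l : Nat.Partition n => expo l.parts) h
  have h4 : ∑ j, B (toPartition γ hγ) j * A j (toPartition δ hδ) = zee γ *
      ∑ l : Nat.Partition n, (youngScalar l ^ 2)⁻¹ *
      (MvPowerSeries.coeff γ (schur l) * MvPowerSeries.coeff δ (schur l)) := by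
    rw [mul_sum]
    refine sum_congr rfl fun j _ => ?_
    simp only [A, B, Matrix.of_apply, toPartition, expo_indices]
    ring
  rw [h4] at h2
  rw [eq_comm, ← mul_left_inj' (zee_ne_zero γ), mul_comm _ (zee γ : ℂ), mul_comm _ (zee γ : ℂ), h2]
  by_cases h : γ = δ
  · rw [if_pos h, if_pos (h3.mpr h), mul_inv_cancel₀ (zee_ne_zero γ)]
  · rw [if_neg h, if_neg fun h' => h (h3.mp h'), mul_zero]

/-- The expansion of a quasi-homogeneous power series in Schur functions. -/
lemma HasWt.eq_sum_schur {F : Ser R} (hF : HasWt n F) :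
    F = ∑ l : Nat.Partition n, (algebraMap ℂ R (youngScalar l ^ 2)⁻¹ *
      form n F (CompletedCycles.extend R (schur l))) • CompletedCycles.extend R (schur l) := by
  ext δ
  simp only [map_sum, map_smul, smul_eq_mul, form_apply, MvPowerSeries.coeff_map]
  by_cases hδ : wt δ = n
  · simp only [mul_sum, sum_mul]
    rw [sum_comm, sum_eq_single δ]
    · have h := congrArg (fun z => algebraMap ℂ R (zee δ * z)) (sum_schur_mul_schur hδ hδ)
      simp only [if_true, mul_inv_cancel₀ (zee_ne_zero δ), map_one, mul_sum, map_sum] at h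
      conv_lhs => rw [← mul_one (MvPowerSeries.coeff δ F), ← h, mul_sum]
      refine sum_congr rfl fun l _ => ?_
      simp only [map_mul, map_natCast]
      ring
    · intro γ hγ hne
      have h := congrArg (fun z => algebraMap ℂ R (zee γ * z))
        (sum_schur_mul_schur (mem_expos.mp hγ) hδ)
      simp only [if_neg hne, mul_zero, map_zero, mul_sum, map_sum] at h
      conv_rhs => rw [← mul_zero (MvPowerSeries.coeff γ F), ← h, mul_sum]
      refine sum_congr rfl fun l _ => ?_
      simp only [map_mul, map_natCast]
      ring
    · intro h
      exact absurd (mem_expos.mpr hδ) h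
  · rw [hF δ hδ]
    symm
    refine sum_eq_zero fun l _ => ?_
    rw [schur, coeff_toSer_of_wt_ne _ hδ, map_zero, mul_zero]

lemma HasWt.eq_zero {F : Ser R} (hF : HasWt n F)
    (h : ∀ l : Nat.Partition n, form n F (CompletedCycles.extend R (schur l)) = 0) : F = 0 := by
  rw [hF.eq_sum_schur]
  exact sum_eq_zero fun l _ => by rw [h, mul_zero, zero_smul]

lemma form_schur_of_mem_exceedSpan {l m : Nat.Partition n} (hlm : rows l ≤ rows m) {F : Ser R}
    (hF : F ∈ exceedSpan R (rows m).reverse) : form n F (extend R (schur l)) = 0 := by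
  induction hF using Submodule.span_induction with
  | mem F h =>
    obtain ⟨μ, h1, rfl⟩ := h
    rw [form_comm, ← extend_completeProd, form_extend, form_schur_completeProd_eq_zero hlm h1,
      map_zero]
  | zero => simp
  | add F G _ _ h1 h2 => rw [map_add, LinearMap.add_apply, h1, h2, add_zero]
  | smul r F _ h => rw [map_smul, LinearMap.smul_apply, h, smul_zero]

/-- Schur functions are eigenvectors of the zero mode of the vertex operator. -/
theorem vertexOp_schur {t u : R} (htu : t * u = 1) (l : Nat.Partition n) :
    vertexOp t u n (extend R (schur l)) =
      vertexEigen t u (rows l).reverse • extend R (schur l) := by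
  -- The induction descends from the lexicographically largest shape.
  have hfin : WellFounded fun a b : Nat.Partition n => rows b < rows a :=
    Finite.wellFounded_of_trans_of_irrefl (r := fun a b : Nat.Partition n => rows b < rows a)
  induction l using hfin.induction with
  | _ l ih =>
  have hw : ∀ m : Nat.Partition n, HasWt n (extend R (schur m)) := fun m =>
    (hasWt_schur m).extend
  have horth : ∀ {m k : Nat.Partition n}, m ≠ k →
      form n (extend R (schur m)) (extend R (schur k)) = 0 := fun h => by
    rw [form_extend, form_schur_eq_zero h, map_zero]
  rw [← sub_eq_zero]
  have hweight : HasWt n (vertexOp t u n (extend R (schur l)) -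
      vertexEigen t u (rows l).reverse • extend R (schur l)) := by
    intro γ hγ
    rw [map_sub, hasWt_vertexOp t u (hw l) γ hγ, map_smul, hw l γ hγ, smul_zero, sub_zero]
  refine hweight.eq_zero fun k => ?_
  rcases lt_or_ge (rows l) (rows k) with hk | hk
  -- For larger k, self-adjointness moves the operator to the Schur function of k, which is already
  -- known to be an eigenvector.
  · have hne : l ≠ k := by rintro rfl; exact lt_irrefl _ hk
    rw [map_sub, LinearMap.sub_apply, form_vertexOp, ih k hk, map_smul, map_smul,
      LinearMap.smul_apply, horth hne, smul_zero, smul_zero, sub_zero]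
  -- For k at most l, triangularity makes `T` vanish on h_l. In the Schur expansion of h_l, smaller
  -- shapes have coefficient 0, larger ones are killed by induction and orthogonality, and the
  -- coefficient of l is invertible. So `T` vanishes on the Schur function of l.
  · let T : Ser R →ₗ[R] R := (form n).flip (extend R (schur k)) ∘ₗ
      (vertexOp t u n - vertexEigen t u (rows l).reverse • LinearMap.id)
    have hT : ∀ F, T F = form n (vertexOp t u n F - vertexEigen t u (rows l).reverse • F)
        (extend R (schur k)) := fun F => rfl
    rw [← hT]
    have h1 : T (completeProd R l.parts) = 0 := by
      have h := vertexOp_completeProd_sub_mem htu (rows l).reverse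
      rw [List.sum_reverse, sum_rows, Multiset.coe_reverse, coe_rows] at h
      exact form_schur_of_mem_exceedSpan hk h
    have hwt : HasWt n (completeProd R l.parts) := by
      have := hasWt_completeProd (R := R) l.parts
      rwa [l.parts_sum] at this
    rw [hwt.eq_sum_schur, map_sum, sum_eq_single l] at h1
    · rw [map_smul, smul_eq_mul, ← extend_completeProd, form_extend, ← map_mul] at h1
      refine (IsUnit.mul_right_eq_zero (IsUnit.map _ ?_)).mp h1
      rw [form_comm, isUnit_iff_ne_zero]
      exact mul_ne_zero (inv_ne_zero (pow_ne_zero 2 (youngScalar_ne_zero l)))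
        (form_schur_completeProd_self l)
    · intro m _ hm
      rcases lt_or_ge (rows m) (rows l) with hml | hml
      · rw [← extend_completeProd, form_extend, form_comm, form_schur_completeProd_parts hml,
          map_zero, mul_zero, zero_smul, map_zero]
      · have hlt : rows l < rows m := lt_of_le_of_ne hml fun h => hm (rows_injective h).symm
        have hne : m ≠ k := by rintro rfl; exact absurd hlt (not_lt.mpr hk)
        rw [map_smul, hT, ih m hlt, ← sub_smul, map_smul, LinearMap.smul_apply, horth hne,
          smul_zero, smul_zero]
    · intro h
      exact absurd (mem_univ l) h

end

section

/-! ### Sums over finite sequences -/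

section

variable {ι : Type*}

open Classical in
/-- The finite set of the sequences with a given multiset of entries. -/
def words (M : Multiset ι) : Finset (List ι) := M.lists.toFinset

lemma mem_words {M : Multiset ι} {k : List ι} : k ∈ words M ↔ (k : Multiset ι) = M := by
  classical
  rw [words, Multiset.mem_toFinset, Multiset.mem_lists_iff, eq_comm]
  rfl

-- Words are sorted by their first letter a; the words beginning with a contribute n! times the
-- multiplicity of a, and the multiplicities add up to n + 1.
open Classical in
lemma card_words_mul (M : Multiset ι) :
    #(words M) * ∏ a ∈ M.toFinset, (M.count a).factorial = M.card.factorial := by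
  induction hn : M.card generalizing M with
  | zero =>
    rw [Multiset.card_eq_zero] at hn
    subst hn
    have : words (0 : Multiset ι) = {[]} := by
      ext k
      simp [mem_words]
    simp [this]
  | succ n ih =>
    have h1 : words M = M.toFinset.biUnion fun a => (words (M.erase a)).map
        ⟨List.cons a, List.cons_injective⟩ := by
      ext k
      simp only [mem_words, mem_biUnion, Finset.mem_map, Function.Embedding.coeFn_mk,
        Multiset.mem_toFinset]
      constructor
      · rintro rfl
        cases k with
        | nil => simp at hn
        | cons a k => exact ⟨a, by simp, k, by simp, rfl⟩
      · rintro ⟨a, ha, k, hk, rfl⟩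
        rw [← Multiset.cons_coe, hk, Multiset.cons_erase ha]
    rw [h1, card_biUnion, sum_mul]
    · have h2 : ∀ a ∈ M.toFinset, #((words (M.erase a)).map ⟨List.cons a, List.cons_injective⟩) *
          ∏ b ∈ M.toFinset, (M.count b).factorial = n.factorial * M.count a := by
        intro a ha
        rw [Multiset.mem_toFinset] at ha
        have h3 := count_cons_prod a (M.erase a)
        have h4 : M.count a = (M.erase a).count a + 1 := by
          conv_lhs => rw [← Multiset.cons_erase ha, Multiset.count_cons_self]
        rw [Multiset.cons_erase ha] at h3
        rw [h3, card_map, h4, ← ih (M.erase a) (by rw [Multiset.card_erase_of_mem ha, hn]; rfl)]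
        ring
      rw [sum_congr rfl h2, ← mul_sum, Multiset.toFinset_sum_count_eq, hn, Nat.factorial_succ,
        mul_comm]
    · intro a _ b _ hab
      rw [Function.onFun, disjoint_left]
      intro k hk hk'
      obtain ⟨k1, -, rfl⟩ := Finset.mem_map.mp hk
      obtain ⟨k2, -, h⟩ := Finset.mem_map.mp hk'
      exact hab (List.cons.inj h).1.symm

open Classical in
/-- The exponents of the monomial that is the product of a sequence of variables. -/
def wordExpo (k : List ι) : ι →₀ ℕ := Multiset.toFinsupp (k : Multiset ι)

lemma wordExpo_nil : wordExpo ([] : List ι) = 0 := by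
  simp [wordExpo]

lemma wordExpo_cons (a : ι) (k : List ι) :
    wordExpo (a :: k) = wordExpo k + Finsupp.single a 1 := by
  classical
  rw [wordExpo, wordExpo, ← Multiset.cons_coe, ← Multiset.singleton_add, map_add,
    Multiset.toFinsupp_singleton, add_comm]

lemma wordExpo_eq_iff {k : List ι} {e : ι →₀ ℕ} :
    wordExpo k = e ↔ k ∈ words (Finsupp.toMultiset e) := by
  classical
  rw [mem_words, wordExpo]
  constructor
  · rintro rfl
    simp
  · intro h
    rw [h]
    simp

lemma card_words_toMultiset_mul (e : ι →₀ ℕ) :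
    (#(words (Finsupp.toMultiset e)) : ℂ) * (((Finsupp.toMultiset e).card.factorial : ℂ))⁻¹ =
      (e.prod fun _ m => (m.factorial : ℂ))⁻¹ := by
  classical
  have h := card_words_mul (Finsupp.toMultiset e)
  rw [Finsupp.toFinset_toMultiset] at h
  simp only [Finsupp.count_toMultiset] at h
  have h2 : (e.prod fun _ m => (m.factorial : ℂ)) ≠ 0 :=
    prod_ne_zero_iff.mpr fun i _ => Nat.cast_ne_zero.mpr (Nat.factorial_ne_zero _)
  rw [Finsupp.prod] at h2
  rw [← h, Finsupp.prod]
  push_cast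
  rw [mul_inv, ← mul_assoc, mul_inv_cancel₀, one_mul]
  intro h0
  have h3 : #(words (Finsupp.toMultiset e)) = 0 := by exact_mod_cast h0
  rw [h3, zero_mul] at h
  exact Nat.factorial_ne_zero _ h.symm

/-- A sum over finite sequences of a function of the exponents. -/
lemma finsum_words (u : (ι →₀ ℕ) → ℂ) (S : Finset (ι →₀ ℕ)) (hS : ∀ e ∉ S, u e = 0) :
    ∑ᶠ k : List ι, (k.length.factorial : ℂ)⁻¹ * u (wordExpo k) =
      ∑ e ∈ S, (e.prod fun _ m => (m.factorial : ℂ))⁻¹ * u e := by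
  classical
  rw [finsum_eq_sum_of_support_subset (s := S.biUnion fun e => words (Finsupp.toMultiset e)),
    sum_biUnion]
  · refine sum_congr rfl fun e _ => ?_
    have : ∀ k ∈ words (Finsupp.toMultiset e), (k.length.factorial : ℂ)⁻¹ * u (wordExpo k) =
        ((Finsupp.toMultiset e).card.factorial : ℂ)⁻¹ * u e := by
      intro k hk
      rw [wordExpo_eq_iff.mpr hk, ← mem_words.mp hk, Multiset.coe_card]
    rw [sum_congr rfl this, sum_const, nsmul_eq_mul, ← mul_assoc, card_words_toMultiset_mul]
  · intro a _ b _ hab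
    rw [Function.onFun, disjoint_left]
    intro k hk hk'
    exact hab ((wordExpo_eq_iff.mpr hk).symm.trans (wordExpo_eq_iff.mpr hk'))
  · intro k hk
    rw [mem_coe, mem_biUnion]
    refine ⟨wordExpo k, ?_, wordExpo_eq_iff.mp rfl⟩
    by_contra h
    exact hk (by simp only [hS _ h, mul_zero])

lemma list_prod_map_eq {M : Type*} [CommMonoid M] (g : ι → M) (k : List ι) :
    (k.map g).prod = (wordExpo k).prod fun i m => g i ^ m := by
  induction k with
  | nil => simp [wordExpo_nil]
  | cons a k ih =>
    rw [List.map_cons, List.prod_cons, ih, wordExpo_cons,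
      prod_add_single (fun i m => g i ^ m) (fun _ => pow_zero _) _ _ (g a) (pow_succ _ _), mul_comm]

end

end

section

/-! ### Normally ordered products -/

lemma neg_pnat_injective : Function.Injective fun k : ℕ+ => -(k : ℤ) := fun a b h => by
  simpa using h

lemma pnat_injective : Function.Injective fun k : ℕ+ => (k : ℤ) := fun a b h => by
  simpa using h

/-- The exponents of the negative integers. -/
def negPart (e : ℤ →₀ ℕ) : Expo := e.comapDomain _ neg_pnat_injective.injOn

/-- The exponents of the positive integers. -/
def posPart (e : ℤ →₀ ℕ) : Expo := e.comapDomain _ pnat_injective.injOn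

@[simp] lemma negPart_apply (e : ℤ →₀ ℕ) (k : ℕ+) : negPart e k = e (-k) := rfl

@[simp] lemma posPart_apply (e : ℤ →₀ ℕ) (k : ℕ+) : posPart e k = e k := rfl

lemma exists_pnat_of_neg {i : ℤ} (h : i < 0) : ∃ k : ℕ+, i = -(k : ℤ) :=
  ⟨⟨i.natAbs, by omega⟩, by simp only [PNat.mk_coe]; omega⟩

lemma exists_pnat_of_pos {i : ℤ} (h : 0 < i) : ∃ k : ℕ+, i = (k : ℤ) :=
  ⟨⟨i.natAbs, by omega⟩, by simp only [PNat.mk_coe]; omega⟩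

lemma negPart_add_single_neg (e : ℤ →₀ ℕ) (k : ℕ+) :
    negPart (e + Finsupp.single (-(k : ℤ)) 1) = negPart e + Finsupp.single k 1 := by
  ext j
  simp [Finsupp.single_apply]

lemma negPart_add_single_of_nonneg (e : ℤ →₀ ℕ) {i : ℤ} (h : 0 ≤ i) :
    negPart (e + Finsupp.single i 1) = negPart e := by
  ext j
  have := j.pos
  rw [negPart_apply, negPart_apply, Finsupp.add_apply, Finsupp.single_apply, if_neg (by omega),
    add_zero]

lemma posPart_add_single_pos (e : ℤ →₀ ℕ) (k : ℕ+) :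
    posPart (e + Finsupp.single (k : ℤ) 1) = posPart e + Finsupp.single k 1 := by
  ext j
  simp [Finsupp.single_apply]

lemma posPart_add_single_of_nonpos (e : ℤ →₀ ℕ) {i : ℤ} (h : i ≤ 0) :
    posPart (e + Finsupp.single i 1) = posPart e := by
  ext j
  have := j.pos
  rw [posPart_apply, posPart_apply, Finsupp.add_apply, Finsupp.single_apply, if_neg (by omega),
    add_zero]

lemma negPart_zero : negPart 0 = 0 := by
  ext k
  simp

lemma posPart_zero : posPart 0 = 0 := by
  ext k
  simp

lemma a_neg (k : ℕ+) (F : Ser ℂ) :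
    a (fun k : ℕ+ => k) (-(k : ℤ)) F = MvPowerSeries.monomial (Finsupp.single k 1) 1 * F := by
  obtain ⟨j, rfl⟩ : ∃ j : ℕ, k = j.succPNat := ⟨k.natPred, by simp⟩
  rfl

lemma a_pos (k : ℕ+) (F : Ser ℂ) :
    a (fun k : ℕ+ => k) (k : ℤ) F = diffOp (Finsupp.single k 1) F := by
  obtain ⟨j, rfl⟩ : ∃ j : ℕ, k = j.succPNat := ⟨k.natPred, by simp⟩
  rw [diffOp_single]
  rfl

lemma prod_map_a_neg (k : List ℤ) (F : Ser ℂ) :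
    ((k.filter (· < 0)).map (a fun k : ℕ+ => k)).prod F =
      MvPowerSeries.monomial (negPart (wordExpo k)) 1 * F := by
  induction k with
  | nil =>
    rw [wordExpo_nil, negPart_zero]
    simp [MvPowerSeries.monomial_zero_one]
  | cons i k ih =>
    by_cases hi : i < 0
    · rw [List.filter_cons_of_pos (by simpa using hi), List.map_cons, List.prod_cons,
        Module.End.mul_apply, ih]
      obtain ⟨j, rfl⟩ := exists_pnat_of_neg hi
      rw [a_neg, wordExpo_cons, negPart_add_single_neg, ← mul_assoc,
        MvPowerSeries.monomial_mul_monomial, one_mul, add_comm]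
    · rw [List.filter_cons_of_neg (by simpa using hi), ih, wordExpo_cons,
        negPart_add_single_of_nonneg _ (not_lt.mp hi)]

lemma prod_map_a_pos {k : List ℤ} (h0 : 0 ∉ k) (F : Ser ℂ) :
    ((k.filter (0 ≤ ·)).map (a fun k : ℕ+ => k)).prod F = diffOp (posPart (wordExpo k)) F := by
  induction k with
  | nil =>
    rw [wordExpo_nil, posPart_zero, diffOp_zero]
    simp
  | cons i k ih =>
    have ih := ih fun h => h0 (List.mem_cons_of_mem _ h)
    by_cases hi : 0 ≤ i
    · have hi' : 0 < i := lt_of_le_of_ne hi fun h => h0 (by simp [h])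
      rw [List.filter_cons_of_pos (by simpa using hi), List.map_cons, List.prod_cons,
        Module.End.mul_apply, ih]
      obtain ⟨j, rfl⟩ := exists_pnat_of_pos hi'
      rw [a_pos, wordExpo_cons, posPart_add_single_pos, diffOp_diffOp, add_comm]
    · rw [List.filter_cons_of_neg (by simpa using hi), ih, wordExpo_cons,
        posPart_add_single_of_nonpos _ (not_le.mp hi).le]

lemma normalOrdered_apply {k : List ℤ} (h0 : 0 ∉ k) (F : Ser ℂ) :
    normalOrdered (fun k : ℕ+ => k) k F = MvPowerSeries.monomial (negPart (wordExpo k)) 1 *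
      diffOp (posPart (wordExpo k)) F := by
  rw [normalOrdered, Module.End.mul_apply, prod_map_a_pos h0, prod_map_a_neg]

lemma sum_eq_wt_sub_wt (k : List ℤ) :
    k.sum = (wt (posPart (wordExpo k)) : ℤ) - wt (negPart (wordExpo k)) := by
  induction k with
  | nil => simp [wordExpo_nil, negPart_zero, posPart_zero]
  | cons i k ih =>
    rw [List.sum_cons, ih, wordExpo_cons]
    rcases lt_trichotomy i 0 with hi | rfl | hi
    · rw [posPart_add_single_of_nonpos _ hi.le]
      obtain ⟨j, rfl⟩ := exists_pnat_of_neg hi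
      rw [negPart_add_single_neg, map_add, wt_single]
      push_cast
      ring
    · rw [posPart_add_single_of_nonpos _ le_rfl, negPart_add_single_of_nonneg _ le_rfl, zero_add]
    · rw [negPart_add_single_of_nonneg _ hi.le]
      obtain ⟨j, rfl⟩ := exists_pnat_of_pos hi
      rw [posPart_add_single_pos, map_add, wt_single]
      push_cast
      ring

lemma mem_iff_wordExpo_ne_zero {ι : Type*} {i : ι} {k : List ι} : i ∈ k ↔ wordExpo k i ≠ 0 := by
  classical
  rw [wordExpo, Multiset.toFinsupp_apply, Multiset.coe_count, Ne, List.count_eq_zero, not_not]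

lemma wordExpo_ne_zero {ι : Type*} {k : List ι} : wordExpo k ≠ 0 ↔ k ≠ [] := by
  classical
  rw [wordExpo, Ne, Ne, map_eq_zero_iff _ Multiset.toFinsupp.injective, Multiset.coe_eq_zero]

/-- The exponents with given negative and positive part. -/
def join (x : Expo × Expo) : ℤ →₀ ℕ :=
  x.1.mapDomain (fun k : ℕ+ => -(k : ℤ)) + x.2.mapDomain fun k : ℕ+ => (k : ℤ)

lemma negPart_join (x : Expo × Expo) : negPart (join x) = x.1 := by
  ext k
  rw [negPart_apply, join, Finsupp.add_apply, Finsupp.mapDomain_apply neg_pnat_injective,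
    Finsupp.mapDomain_of_notMem_range, add_zero]
  rintro ⟨j, hj⟩
  have h1 := j.pos
  have h2 := k.pos
  simp only at hj
  omega

lemma posPart_join (x : Expo × Expo) : posPart (join x) = x.2 := by
  ext k
  rw [posPart_apply, join, Finsupp.add_apply, Finsupp.mapDomain_apply pnat_injective,
    Finsupp.mapDomain_of_notMem_range, zero_add]
  rintro ⟨j, hj⟩
  have h1 := j.pos
  have h2 := k.pos
  simp only at hj
  omega

lemma join_apply_zero (x : Expo × Expo) : join x 0 = 0 := by
  rw [join, Finsupp.add_apply, Finsupp.mapDomain_of_notMem_range, zero_add,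
    Finsupp.mapDomain_of_notMem_range]
  · rintro ⟨j, hj⟩
    have h1 := j.pos
    simp only at hj
    omega
  · rintro ⟨j, hj⟩
    have h1 := j.pos
    simp only at hj
    omega

lemma join_injective : Function.Injective join := fun x y h => by
  refine Prod.ext ?_ ?_
  · rw [← negPart_join x, h, negPart_join]
  · rw [← posPart_join x, h, posPart_join]

lemma join_parts {e : ℤ →₀ ℕ} (h : e 0 = 0) : join (negPart e, posPart e) = e := by
  ext i
  rcases lt_trichotomy i 0 with hi | rfl | hi
  · obtain ⟨j, rfl⟩ := exists_pnat_of_neg hi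
    rw [← negPart_apply, negPart_join, negPart_apply]
  · rw [h, join_apply_zero]
  · obtain ⟨j, rfl⟩ := exists_pnat_of_pos hi
    rw [← posPart_apply, posPart_join, posPart_apply]

lemma prod_join {M : Type*} [CommMonoid M] (g : ℤ → ℕ → M) (hg : ∀ i m, g (-i) m = g i m)
    (x : Expo × Expo) :
    (join x).prod g = (x.1.prod fun k m => g (k : ℤ) m) * x.2.prod fun k m => g (k : ℤ) m := by
  classical
  rw [join, Finsupp.prod_add_index_of_disjoint, Finsupp.prod_mapDomain_index_inj neg_pnat_injective,
    Finsupp.prod_mapDomain_index_inj pnat_injective]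
  · simp only [hg]
  · rw [Finsupp.mapDomain_support_of_injective neg_pnat_injective,
      Finsupp.mapDomain_support_of_injective pnat_injective, disjoint_left]
    intro i h1 h2
    obtain ⟨j, -, rfl⟩ := Finset.mem_image.mp h1
    obtain ⟨k, -, hk⟩ := Finset.mem_image.mp h2
    have h1 := j.pos
    have h2 := k.pos
    omega

end

section

/-! ### The completed cut-and-join operators and the vertex operator -/

/-- The power series `e^{z/2}`. -/
def expHalf : PowerSeries ℂ := PowerSeries.rescale (1 / 2) (PowerSeries.exp ℂ)

/-- The power series `e^{-z/2}`. -/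
def expNegHalf : PowerSeries ℂ := PowerSeries.rescale (-(1 / 2)) (PowerSeries.exp ℂ)

lemma rescale_exp_pow (c : ℂ) (k : ℕ) : PowerSeries.rescale c (PowerSeries.exp ℂ) ^ k =
    PowerSeries.rescale (k * c) (PowerSeries.exp ℂ) := by
  induction k with
  | zero => simp
  | succ k ih =>
    rw [pow_succ, ih, PowerSeries.exp_mul_exp_eq_exp_add]
    congr 2
    push_cast
    ring

lemma expHalf_mul_expNegHalf : expHalf * expNegHalf = 1 := by
  rw [expHalf, expNegHalf, PowerSeries.exp_mul_exp_eq_exp_add]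
  simp

lemma powDiff_expHalf (k : ℕ) : powDiff expHalf expNegHalf k = zeta k := by
  rw [powDiff, expHalf, expNegHalf, rescale_exp_pow, rescale_exp_pow, zeta]
  congr 4
  · ring
  · ring

lemma expHalf_sub_expNegHalf : expHalf - expNegHalf = zeta 1 := by
  simpa [powDiff] using powDiff_expHalf 1

lemma zeta_neg (t : ℂ) : zeta (-t) = -zeta t := by
  rw [zeta, zeta, neg_sub, neg_div, neg_neg]

/-- The coefficient of `z^j` in `P / ζ(z)`. -/
def zetaQuot (j : ℕ) : PowerSeries ℂ →ₗ[ℂ] ℂ where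
  toFun P := ((P : LaurentSeries ℂ) / ((zeta 1 : PowerSeries ℂ) : LaurentSeries ℂ)).coeff (j : ℤ)
  map_add' P P' := by rw [PowerSeries.coe_add, add_div, HahnSeries.coeff_add]
  map_smul' r P := by
    rw [PowerSeries.coe_smul, ← HahnSeries.C_mul_eq_smul, mul_div_assoc, HahnSeries.C_mul_eq_smul,
      HahnSeries.coeff_smul, RingHom.id_apply]

lemma zeta_one_ne_zero : zeta 1 ≠ 0 := by
  intro h
  have := congrArg (PowerSeries.coeff 1) h
  simp [zeta, PowerSeries.coeff_rescale, PowerSeries.coeff_exp] at this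

lemma zetaQuot_mul (j : ℕ) (P : PowerSeries ℂ) : zetaQuot j (zeta 1 * P) = PowerSeries.coeff j P := by
  have h : ((zeta 1 : PowerSeries ℂ) : LaurentSeries ℂ) ≠ 0 := by
    intro h
    exact zeta_one_ne_zero (HahnSeries.ofPowerSeries_injective (Γ := ℤ) (h.trans (map_zero _).symm))
  change (((zeta 1 * P : PowerSeries ℂ) : LaurentSeries ℂ) / _).coeff (j : ℤ) = _
  rw [PowerSeries.coe_mul, mul_div_cancel_left₀ _ h, LaurentSeries.coeff_coe_powerSeries]

/-- The power series `ζ(i z) / i`. -/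
def normZeta (i : ℤ) : PowerSeries ℂ := (i : ℂ)⁻¹ • zeta i

/-- Oddness of ζ gives the multiplication half and the derivation half of the operator the same
coefficients. -/
lemma normZeta_neg (i : ℤ) : normZeta (-i) = normZeta i := by
  rw [normZeta, normZeta, Int.cast_neg, zeta_neg, inv_neg, neg_smul, smul_neg, neg_neg]

/-- The coefficient sees a tuple only through its length and its exponents, as needed to collect
tuples into monomials. -/
lemma cutJoinCoeff_eq (j : ℕ) (k : List ℤ) : cutJoinCoeff j k =
    (k.length.factorial : ℂ)⁻¹ *
      zetaQuot j ((wordExpo k).prod fun i m => normZeta i ^ m) := by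
  have h : (k.map normZeta).prod =
      ((k.map fun i : ℤ => (i : ℂ)).prod)⁻¹ • (k.map fun i : ℤ => zeta i).prod := by
    induction k with
    | nil => simp
    | cons i k ih =>
      rw [List.map_cons, List.prod_cons, ih, normZeta, smul_mul_smul_comm, List.map_cons,
        List.prod_cons, List.map_cons, List.prod_cons, mul_inv]
  rw [← list_prod_map_eq, h, map_smul, cutJoinCoeff, div_eq_mul_inv, mul_inv, smul_eq_mul,
    mul_comm, mul_assoc]
  rfl

lemma expCoeff_eq_prod (α : Expo) : expCoeff (powDiff expHalf expNegHalf) α =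
    α.prod fun k m => (m.factorial : ℂ)⁻¹ • normZeta k ^ m := by
  rw [expCoeff, zee]
  simp only [Finsupp.prod, Nat.cast_prod, Nat.cast_mul, Nat.cast_pow, ← prod_inv_distrib, map_prod,
    ← prod_mul_distrib, powDiff_expHalf]
  refine prod_congr rfl fun k _ => ?_
  rw [normZeta, smul_pow, smul_smul, Algebra.smul_def, mul_inv, inv_pow]
  simp [mul_comm]

lemma prod_factorial_mul_zetaQuot (j : ℕ) (x : Expo × Expo) :
    ((join x).prod fun _ m => (m.factorial : ℂ))⁻¹ *
      zetaQuot j ((join x).prod fun i m => normZeta i ^ m) =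
    zetaQuot j (expCoeff (powDiff expHalf expNegHalf) x.1 *
      expCoeff (powDiff expHalf expNegHalf) x.2) := by
  have h := prod_join (fun i m => (m.factorial : ℂ)⁻¹ • normZeta i ^ m)
    (fun i m => by rw [normZeta_neg]) x
  rw [expCoeff_eq_prod, expCoeff_eq_prod, ← h, ← smul_eq_mul, ← map_smul]
  congr 1
  simp only [Finsupp.prod, Finset.prod_smul, prod_inv_distrib]

/-- The pairs of exponent vectors of the same weight at most `n`. -/
def expoPairs (n : ℕ) : Finset (Expo × Expo) :=
  (range (n + 1)).biUnion fun m => expos m ×ˢ expos m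

lemma mem_expoPairs {n : ℕ} {x : Expo × Expo} :
    x ∈ expoPairs n ↔ wt x.1 ≤ n ∧ wt x.2 = wt x.1 := by
  simp only [expoPairs, mem_biUnion, mem_range, mem_product, mem_expos, Nat.lt_succ_iff]
  constructor
  · rintro ⟨m, h1, h2, h3⟩
    exact ⟨by omega, by omega⟩
  · rintro ⟨h1, h2⟩
    exact ⟨wt x.1, h1, rfl, h2⟩

lemma coeff_monomial_mul_of_not_le {R : Type*} [CommRing R] {α N : Expo} (h : ¬ α ≤ N) (F : Ser R) :
    MvPowerSeries.coeff N (MvPowerSeries.monomial α 1 * F) = 0 := by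
  classical
  rw [MvPowerSeries.coeff_monomial_mul, if_neg h]

lemma wt_mono {α N : Expo} (h : α ≤ N) : wt α ≤ wt N := by
  obtain ⟨δ, rfl⟩ := exists_add_of_le h
  rw [map_add]
  omega

/-- The coefficients of the completed cut-and-join operators, as a finite sum. -/
theorem coeff_Q (j : ℕ) (F : Ser ℂ) (N : Expo) :
    MvPowerSeries.coeff N (Q (fun k : ℕ+ => k) j F) =
      ∑ x ∈ expoPairs (wt N) with x ≠ 0,
        zetaQuot j (expCoeff (powDiff expHalf expNegHalf) x.1 *
          expCoeff (powDiff expHalf expNegHalf) x.2) *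
        MvPowerSeries.coeff N (MvPowerSeries.monomial x.1 1 * diffOp x.2 F) := by
  classical
  let u : (ℤ →₀ ℕ) → ℂ := fun e =>
    if e ≠ 0 ∧ e 0 = 0 ∧ wt (posPart e) = wt (negPart e) then
      zetaQuot j (e.prod fun i m => normZeta i ^ m) *
        MvPowerSeries.coeff N (MvPowerSeries.monomial (negPart e) 1 * diffOp (posPart e) F)
    else 0
  have h1 : MvPowerSeries.coeff N (Q (fun k : ℕ+ => k) j F) =
      ∑ᶠ k : List ℤ, (k.length.factorial : ℂ)⁻¹ * u (wordExpo k) := by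
    change ∑ᶠ k : {k : List ℤ // k ≠ [] ∧ k.sum = 0}, MvPowerSeries.coeff N
      (cutJoinCoeff j k.1 • normalOrdered (fun k : ℕ+ => k) k.1 F) = _
    rw [finsum_subtype_eq_finsum_cond (f := fun k => MvPowerSeries.coeff N
      (cutJoinCoeff j k • normalOrdered (fun k : ℕ+ => k) k F)) fun k => k ≠ [] ∧ k.sum = 0]
    refine finsum_congr fun k => ?_
    by_cases h0 : 0 ∈ k
    · have h2 : u (wordExpo k) = 0 := if_neg fun h => mem_iff_wordExpo_ne_zero.mp h0 h.2.1
      have h3 : cutJoinCoeff j k = 0 := by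
        have : (k.map fun i : ℤ => (i : ℂ)).prod = 0 :=
          List.prod_eq_zero (List.mem_map.mpr ⟨0, h0, by simp⟩)
        rw [cutJoinCoeff, this, mul_zero, div_zero]
      rw [h2, h3]
      simp
    · by_cases hk : k ≠ [] ∧ k.sum = 0
      · have h2 : u (wordExpo k) = _ := if_pos ⟨wordExpo_ne_zero.mpr hk.1,
          not_not.mp fun h => h0 (mem_iff_wordExpo_ne_zero.mpr h), by
            have := sum_eq_wt_sub_wt k
            rw [hk.2] at this
            omega⟩
        rw [finsum_eq_if, if_pos hk, h2, map_smul, normalOrdered_apply h0, cutJoinCoeff_eq,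
          smul_eq_mul, mul_assoc]
      · have h2 : u (wordExpo k) = 0 := if_neg fun h => hk ⟨wordExpo_ne_zero.mp h.1, by
          rw [sum_eq_wt_sub_wt, h.2.2, sub_self]⟩
        rw [finsum_eq_if, if_neg hk, h2, mul_zero]
  -- Only monomials p^α dividing p^N contribute, which bounds the weight and makes the sum finite.
  have h2 : ∀ e ∉ (expoPairs (wt N)).image join, u e = 0 := by
    intro e he
    by_contra hu
    have hc : e ≠ 0 ∧ e 0 = 0 ∧ wt (posPart e) = wt (negPart e) := by
      by_contra h
      exact hu (if_neg h)
    refine he (Finset.mem_image.mpr ⟨(negPart e, posPart e), mem_expoPairs.mpr ⟨?_, hc.2.2⟩,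
      join_parts hc.2.1⟩)
    by_contra hle
    refine hu ?_
    rw [show u e = _ from if_pos hc, coeff_monomial_mul_of_not_le, mul_zero]
    exact fun h => hle (wt_mono h)
  rw [h1, finsum_words u _ h2, sum_image join_injective.injOn, sum_filter]
  refine sum_congr rfl fun x hx => ?_
  split_ifs with hx0
  · have h3 : u (join x) = _ := if_pos ⟨fun h => hx0 (join_injective (h.trans (by simp [join]))),
      join_apply_zero x, by rw [posPart_join, negPart_join, (mem_expoPairs.mp hx).2]⟩
    rw [h3, negPart_join, posPart_join, ← mul_assoc, prod_factorial_mul_zetaQuot]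
  · have h3 : u (join x) = 0 := if_neg fun h => h.1 (by
      rw [not_not.mp hx0]
      simp [join])
    rw [h3, mul_zero]

end

/-! ### Eigenvalues of the completed cut-and-join operators -/

section

variable {R : Type*} [CommRing R] [Algebra ℂ R] {n : ℕ}

lemma diffOp_extend (β : Expo) (F : Ser ℂ) :
    diffOp β (extend R F) = extend R (diffOp β F) := by
  ext γ
  simp [coeff_diffOp]

lemma coeff_vertexOp (t u : R) (F : Ser R) (N : Expo) (n : ℕ) :
    MvPowerSeries.coeff N (vertexOp t u n F) = ∑ x ∈ expoPairs n,
      expCoeff (powDiff t u) x.1 * expCoeff (powDiff t u) x.2 *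
        MvPowerSeries.coeff N (MvPowerSeries.monomial x.1 1 * diffOp x.2 F) := by
  rw [vertexOp_apply, map_sum, expoPairs, sum_biUnion]
  · refine sum_congr rfl fun m _ => ?_
    rw [expPart, expDiff, LinearMap.sum_apply, sum_mul_sum, map_sum, sum_product]
    refine sum_congr rfl fun α _ => ?_
    rw [map_sum]
    refine sum_congr rfl fun β _ => ?_
    rw [LinearMap.smul_apply, smul_mul_smul_comm, map_smul, smul_eq_mul]
  · intro a _ b _ hab
    rw [Function.onFun, disjoint_left]
    intro x hx hx'
    rw [mem_product, mem_expos] at hx hx'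
    exact hab (hx.1.symm.trans hx'.1)

lemma zero_mem_expoPairs (n : ℕ) : 0 ∈ expoPairs n := by
  rw [mem_expoPairs]
  simp

/-- The two operators have the same expansion over pairs of exponent vectors, except that the empty
tuple, the identity operator, is absent from `Q` and has to be subtracted. -/
lemma coeff_Q_eq_zetaQuot (j : ℕ) (F : Ser ℂ) (N : Expo) :
    MvPowerSeries.coeff N (Q (fun k : ℕ+ => k) j F) =
      zetaQuot j (MvPowerSeries.coeff N
        (vertexOp expHalf expNegHalf (wt N) (extend (PowerSeries ℂ) F) -
          extend (PowerSeries ℂ) F)) := by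
  rw [coeff_Q, map_sub, coeff_vertexOp, ← add_sum_erase _ _ (zero_mem_expoPairs (wt N))]
  simp only [Prod.fst_zero, Prod.snd_zero, expCoeff_zero, one_mul, diffOp_zero,
    MvPowerSeries.monomial_zero_one]
  rw [add_sub_cancel_left, map_sum, filter_ne']
  refine sum_congr rfl fun x _ => ?_
  have h : MvPowerSeries.coeff N (MvPowerSeries.monomial x.1 1 *
      diffOp x.2 (extend (PowerSeries ℂ) F)) = algebraMap ℂ (PowerSeries ℂ)
        (MvPowerSeries.coeff N (MvPowerSeries.monomial x.1 1 * diffOp x.2 F)) := by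
    rw [diffOp_extend, ← MvPowerSeries.coeff_map, map_mul (MvPowerSeries.map _),
      MvPowerSeries.map_monomial, map_one (algebraMap ℂ _)]
  rw [h, mul_comm _ (algebraMap ℂ (PowerSeries ℂ) _), ← Algebra.smul_def, map_smul, smul_eq_mul,
    mul_comm]

/-- The completed cut-and-join operators as linear maps. -/
def cutJoin (j : ℕ) : Ser ℂ →ₗ[ℂ] Ser ℂ where
  toFun := Q (fun k : ℕ+ => k) j
  map_add' F G := by
    ext N
    simp only [coeff_Q, map_add, mul_add, sum_add_distrib]
  map_smul' r F := by
    ext N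
    simp only [coeff_Q, map_smul, mul_smul_comm, RingHom.id_apply, smul_sum]

lemma cutJoin_apply (j : ℕ) (F : Ser ℂ) : cutJoin j F = Q (fun k : ℕ+ => k) j F := rfl

lemma HasWt.monomial_mul_diffOp {F : Ser R} (hF : HasWt n F) {α β : Expo} (h : wt β = wt α) :
    HasWt n (MvPowerSeries.monomial α 1 * diffOp β F) := by
  classical
  intro γ hγ
  rw [MvPowerSeries.coeff_monomial_mul]
  split_ifs with h1
  · rw [coeff_diffOp, hF, mul_zero, mul_zero]
    obtain ⟨δ, rfl⟩ := exists_add_of_le h1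
    rw [add_tsub_cancel_left, map_add, h, add_comm, ← map_add]
    exact hγ
  · rfl

lemma HasWt.cutJoin {F : Ser ℂ} (hF : HasWt n F) (j : ℕ) : HasWt n (cutJoin j F) := by
  intro γ hγ
  rw [cutJoin_apply, coeff_Q]
  refine sum_eq_zero fun x hx => ?_
  rw [(hF.monomial_mul_diffOp (mem_expoPairs.mp (mem_filter.mp hx).1).2) γ hγ, mul_zero]

/-- The exponents combine to a - (2i + 1)/2 = a - (i + 1) + 1/2, the shift in the power sums for
rows counted from 0. -/
lemma coeff_expHalf (j a i : ℕ) :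
    PowerSeries.coeff j (expNegHalf ^ (2 * i + 1) * (expHalf ^ (2 * a) - 1)) =
      (((a : ℂ) - ((i : ℂ) + 1) + 1 / 2) ^ j - (-((i : ℂ) + 1) + 1 / 2) ^ j) / (j.factorial : ℂ) := by
  rw [mul_sub, mul_one, expHalf, expNegHalf, rescale_exp_pow, rescale_exp_pow,
    PowerSeries.exp_mul_exp_eq_exp_add, map_sub, PowerSeries.coeff_rescale,
    PowerSeries.coeff_rescale, PowerSeries.coeff_exp, ← sub_mul, map_div₀, map_one, map_natCast,
    mul_one_div]
  congr 2
  · congr 1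
    push_cast
    ring
  · congr 1
    push_cast
    ring

/-- The eigenvalue of `Q_j` on the Schur function of `λ`. -/
def eigenvalue (j : ℕ) (l : Nat.Partition n) : ℂ := shiftedPowerSum j ⟨n, l⟩ / (j.factorial : ℂ)

/-- Schur functions are eigenvectors of the completed cut-and-join operators. -/
theorem cutJoin_schur (j : ℕ) (l : Nat.Partition n) :
    cutJoin j (schur l) = eigenvalue j l • schur l := by
  ext N
  by_cases hN : wt N = n
  -- The eigenvalue minus 1 contains the factor t - u = ζ(z), so the division by ζ(z) is exact.
  · rw [cutJoin_apply, coeff_Q_eq_zetaQuot, hN, vertexOp_schur expHalf_mul_expNegHalf,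
      vertexEigen_eq expHalf_mul_expNegHalf, expHalf_sub_expNegHalf, add_smul, one_smul,
      add_sub_cancel_left, map_smul, MvPowerSeries.coeff_map, smul_eq_mul, mul_comm,
      ← Algebra.smul_def, map_smul, zetaQuot_mul, map_sum, map_smul, smul_eq_mul, smul_eq_mul,
      mul_comm, eigenvalue, shiftedPowerSum, sum_div]
    simp only [coeff_expHalf]
  · rw [(hasWt_schur l).cutJoin j N hN, map_smul, hasWt_schur l N hN, smul_zero]

end

section

variable {n : ℕ}

/-! ### Characters -/

section

variable (l : Nat.Partition n)

/-- Right multiplication by the Young symmetrizer, as a map onto the Specht module. -/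
def toSpecht : GroupAlg n →ₗ[ℂ] Specht l where
  toFun x := ⟨x * youngSymmetrizer l, Ideal.mul_mem_left _ _ (Ideal.subset_span rfl)⟩
  map_add' _ _ := Subtype.ext (add_mul _ _ _)
  map_smul' _ _ := Subtype.ext (smul_mul_assoc _ _ _)

/-- The inclusion of the Specht module in the group algebra. -/
def ofSpecht : Specht l →ₗ[ℂ] GroupAlg n where
  toFun x := x
  map_add' _ _ := rfl
  map_smul' _ _ := rfl

lemma toSpecht_comp_ofSpecht :
    toSpecht l ∘ₗ ofSpecht l = youngScalar l • LinearMap.id := by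
  refine LinearMap.ext fun x => Subtype.ext ?_
  obtain ⟨y, hy⟩ := Ideal.mem_span_singleton'.mp x.2
  change (x : GroupAlg n) * youngSymmetrizer l = youngScalar l • (x : GroupAlg n)
  rw [← hy, mul_assoc, youngSymmetrizer_mul_self, mul_smul_comm]

instance : FiniteDimensional ℂ (Specht l) :=
  FiniteDimensional.of_injective (ofSpecht l) Subtype.val_injective

/-- Right multiplication by c_λ, divided by its scalar, is a projection onto the Specht module. The
trace of g there is thus a trace of x ↦ g x c_λ on the whole group algebra. -/
lemma character_eq (g : Perm (Fin n)) :
    (spechtRep l).character g = (youngScalar l)⁻¹ * traceForm (grp g) (youngSymmetrizer l) := by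
  have h1 : youngScalar l * (spechtRep l).character g =
      traceForm (grp g) (youngSymmetrizer l) := by
    have h2 : (spechtRep l g ∘ₗ toSpecht l) ∘ₗ ofSpecht l = youngScalar l • spechtRep l g := by
      rw [LinearMap.comp_assoc, toSpecht_comp_ofSpecht, LinearMap.comp_smul, LinearMap.comp_id]
    rw [Representation.character, ← smul_eq_mul, ← map_smul, ← h2, LinearMap.trace_comp_comm',
      trace_eq_sum_coeff, traceForm_apply]
    refine sum_congr rfl fun h _ => ?_
    change (grp g * (grp h * youngSymmetrizer l)).coeff h = _
    rw [mul_assoc]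
  rw [← h1, inv_mul_cancel_left₀ (youngScalar_ne_zero l)]

lemma traceForm_one : traceForm 1 (youngSymmetrizer l) = (n.factorial : ℂ) := by
  rw [← trace_mulRight_youngSymmetrizer l, trace_eq_sum_coeff, traceForm_apply]
  simp only [one_mul, LinearMap.mulRight_apply]

lemma youngScalar_mul_dim : youngScalar l * (dim l : ℂ) = (n.factorial : ℂ) := by
  rw [dim, ← Representation.char_one (spechtRep l), character_eq,
    mul_inv_cancel_left₀ (youngScalar_ne_zero l),
    show grp (1 : Perm (Fin n)) = 1 from map_one _, traceForm_one]

lemma dim_ne_zero : (dim l : ℂ) ≠ 0 := by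
  intro h
  have := youngScalar_mul_dim l
  rw [h, mul_zero] at this
  exact Nat.factorial_ne_zero n (by exact_mod_cast this.symm)

lemma form_monomial {γ : Expo} (h : wt γ = n) (c : ℂ) (F : Ser ℂ) :
    form n (MvPowerSeries.monomial γ c) F = zee γ * (c * MvPowerSeries.coeff γ F) := by
  classical
  rw [form_apply, sum_eq_single γ]
  · rw [MvPowerSeries.coeff_monomial_same]
  · intro δ _ hδ
    rw [MvPowerSeries.coeff_monomial_ne hδ, zero_mul, mul_zero]
  · intro h'
    exact absurd (mem_expos.mpr h) h'

lemma character_eq_coeff (g : Perm (Fin n)) : (spechtRep l).character g =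
    (youngScalar l)⁻¹ * (zee (cyc g) * MvPowerSeries.coeff (cyc g) (schur l)) := by
  rw [character_eq, ← form_toSer, toSer_grp, form_monomial ((wt_cyc g).trans (Fintype.card_fin n)),
    one_mul, schur]

lemma mem_conjClass {m : Multiset ℕ} (hm : ∀ a ∈ m, 0 < a) {σ : Perm (Fin n)} :
    σ ∈ conjClass n m ↔ cyc σ = expo m := by
  rw [conjClass, mem_filter, cyc]
  refine ⟨fun h => by rw [h.2], fun h => ⟨mem_univ _, ?_⟩⟩
  exact expo_injective (fun _ h => σ.partition.parts_pos h) hm h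

lemma conjClass_eq {m : Multiset ℕ} (hm : ∀ a ∈ m, 0 < a) :
    conjClass n m = ({σ | cyc σ = expo m} : Finset (Perm (Fin n))) := by
  ext σ
  rw [mem_conjClass hm, mem_filter]
  simp

lemma chi_eq {m : Multiset ℕ} (hm : ∀ a ∈ m, 0 < a) (hn : m.sum = n) : chi l m =
    (youngScalar l)⁻¹ * (zee (expo m) * MvPowerSeries.coeff (expo m) (schur l)) := by
  obtain ⟨σ, hσ⟩ := exists_cyc_eq (α := Fin n) (expo m) (by rw [wt_expo hm, hn, Fintype.card_fin])
  rw [chi, sum_congr rfl fun τ hτ => by rw [character_eq_coeff, (mem_conjClass hm).mp hτ],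
    sum_const, nsmul_eq_mul, mul_div_cancel_left₀]
  rw [Nat.cast_ne_zero]
  exact card_ne_zero_of_mem ((mem_conjClass hm).mpr hσ)

/-! ### Central elements -/

lemma mem_center_iff_grp {z : GroupAlg n} :
    z ∈ Subalgebra.center ℂ (GroupAlg n) ↔ ∀ g, grp g * z = z * grp g := by
  rw [Subalgebra.mem_center_iff]
  refine ⟨fun h g => h _, fun h x => ?_⟩
  rw [eq_sum_coeff_smul x, sum_mul, mul_sum]
  exact sum_congr rfl fun g _ => by rw [smul_mul_assoc, mul_smul_comm, h]

/-- Up to the scalar of c_λ, z c_λ equals c_λ z c_λ, a multiple of c_λ. The factor is found by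
comparing the traces of h ↦ z h c_λ and h ↦ h c_λ, the latter being n!. -/
lemma center_mul_youngSymmetrizer {z : GroupAlg n} (hz : z ∈ Subalgebra.center ℂ (GroupAlg n)) :
    z * youngSymmetrizer l =
      ((n.factorial : ℂ)⁻¹ * form n (toSer z) (schur l)) • youngSymmetrizer l := by
  rw [Subalgebra.mem_center_iff] at hz
  obtain ⟨ω, hω⟩ : ∃ ω : ℂ, z * youngSymmetrizer l = ω • youngSymmetrizer l := by
    refine ⟨(youngScalar l)⁻¹ * (youngSymmetrizer l * z * youngSymmetrizer l).coeff 1, ?_⟩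
    rw [mul_smul, ← youngSymmetrizer_mul_mul, hz, mul_assoc, youngSymmetrizer_mul_self,
      mul_smul_comm, inv_smul_smul₀ (youngScalar_ne_zero l)]
  have h1 : form n (toSer z) (schur l) = ω * n.factorial := by
    rw [schur, form_toSer, ← traceForm_one l, traceForm_apply, traceForm_apply, mul_sum]
    refine sum_congr rfl fun h _ => ?_
    rw [← hz, mul_assoc, hω, mul_smul_comm, MonoidAlgebra.coeff_smul, Finsupp.smul_apply,
      smul_eq_mul, one_mul]
  rw [h1, hω, mul_comm, mul_assoc, mul_inv_cancel₀ (Nat.cast_ne_zero.mpr (Nat.factorial_ne_zero n)),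
    mul_one]

/-- In the trace form the central factor can be moved next to the Young symmetrizer, where it acts
by its scalar. -/
lemma form_toSer_center_mul {z : GroupAlg n} (hz : z ∈ Subalgebra.center ℂ (GroupAlg n))
    (x : GroupAlg n) : form n (toSer (z * x)) (schur l) =
      (n.factorial : ℂ)⁻¹ * form n (toSer z) (schur l) * form n (toSer x) (schur l) := by
  have h1 := center_mul_youngSymmetrizer l hz
  rw [Subalgebra.mem_center_iff] at hz
  rw [← smul_eq_mul _ (form n (toSer x) (schur l)), ← map_smul]
  conv_rhs => rw [schur, ← map_smul toSer, ← schur, ← h1, form_toSer]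
  rw [schur, form_toSer, traceForm_apply, traceForm_apply]
  refine sum_congr rfl fun h _ => ?_
  rw [← hz, ← mul_assoc, mul_assoc x z, ← hz, ← mul_assoc]

end

/-! ### The action of class sums -/

lemma cyc_ofSubtype {S : Finset (Fin n)} (τ : Perm S) :
    cyc (Perm.ofSubtype τ) = cyc τ + Finsupp.single 1 (n - #S) := by
  rw [cyc, cyc, parts_partition', parts_partition', Perm.cycleType_ofSubtype, Fintype.card_fin,
    Fintype.card_coe]
  have h1 : τ.cycleType.sum ≤ #S := by
    rw [Perm.sum_cycleType, ← Fintype.card_coe S]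
    exact card_le_univ _
  have h2 : #S ≤ n := by simpa using card_le_univ S
  have h3 : n - τ.cycleType.sum = (#S - τ.cycleType.sum) + (n - #S) := by omega
  rw [h3, add_smul, ← add_assoc, expo_add]
  congr 1
  generalize n - #S = k
  induction k with
  | zero => simp
  | succ k ih =>
    rw [succ_nsmul, expo_add, ih, ← Multiset.cons_zero, expo_cons, expo_zero, zero_add,
      Finsupp.single_add]
    rfl

lemma card_perm_eq_card_conjClass (μ : Part) {S : Finset (Fin n)} (hS : #S = μ.1) :
    #{τ : Perm S | τ.partition.parts = μ.2.parts} = #(conjClass μ.1 μ.2.parts) := by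
  have hpos : ∀ a ∈ μ.2.parts, 0 < a := fun _ h => μ.2.parts_pos h
  have h1 : ({τ : Perm S | τ.partition.parts = μ.2.parts} : Finset (Perm S)) =
      ({τ | cyc τ = expo μ.2.parts} : Finset (Perm S)) := by
    refine filter_congr fun τ _ => ⟨fun h => by rw [cyc, h], fun h => ?_⟩
    exact expo_injective (fun _ h => τ.partition.parts_pos h) hpos h
  rw [h1, conjClass_eq hpos]
  refine Nat.eq_of_mul_eq_mul_right (zee_pos (expo μ.2.parts)) ?_
  rw [card_cyc_mul_zee, card_cyc_mul_zee, Fintype.card_coe, Fintype.card_fin, hS]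
  · rw [wt_expo_parts, Fintype.card_fin]
  · rw [wt_expo_parts, Fintype.card_coe, hS]

/-- The exponents of the class `μ`, completed by parts `1` to size `n`. -/
def stab (n : ℕ) (μ : Part) : Expo := expo μ.2.parts + Finsupp.single 1 (n - μ.1)

lemma wt_stab {μ : Part} (h : μ.1 ≤ n) : wt (stab n μ) = n := by
  rw [stab, map_add, wt_expo_parts, wt_single]
  simp
  omega

lemma toSer_classElt (μ : Part) : toSer (classElt n μ) =
    ((n.choose μ.1 : ℂ) * (#(conjClass μ.1 μ.2.parts) : ℂ)) •
      MvPowerSeries.monomial (stab n μ) 1 := by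
  rw [classElt, map_sum]
  have h : ∀ S ∈ (univ : Finset (Fin n)).powersetCard μ.1,
      toSer (∑ τ : Perm S with τ.partition.parts = μ.2.parts,
        MonoidAlgebra.of ℂ (Perm (Fin n)) (Perm.ofSubtype τ)) =
      (#(conjClass μ.1 μ.2.parts) : ℂ) • MvPowerSeries.monomial (stab n μ) 1 := by
    intro S hS
    have hS' := (mem_powersetCard.mp hS).2
    rw [map_sum, sum_congr rfl fun τ hτ => ?_, sum_const, card_perm_eq_card_conjClass μ hS',
      Nat.cast_smul_eq_nsmul]
    rw [toSer_grp, cyc_ofSubtype, cyc, (mem_filter.mp hτ).2, hS', stab]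
  rw [sum_congr rfl h, sum_const, card_powersetCard, card_univ, Fintype.card_fin, mul_smul,
    Nat.cast_smul_eq_nsmul ℂ (n.choose μ.1)]

/-- Because n! is dim λ times the scalar of c_λ, the normalised character value is the scalar by
which the class element acts on c_λ. -/
lemma f_eq (μ : Part) (l : Nat.Partition n) :
    f μ ⟨n, l⟩ = (n.factorial : ℂ)⁻¹ * form n (toSer (classElt n μ)) (schur l) := by
  rw [toSer_classElt, map_smul, LinearMap.smul_apply, smul_eq_mul, f]
  by_cases h : μ.1 ≤ n
  · have hpos : ∀ a ∈ μ.2.parts + Multiset.replicate (n - μ.1) 1, 0 < a := by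
      intro a ha
      rcases Multiset.mem_add.mp ha with ha | ha
      · exact μ.2.parts_pos ha
      · rw [Multiset.eq_of_mem_replicate ha]; exact one_pos
    have hsum : (μ.2.parts + Multiset.replicate (n - μ.1) 1).sum = n := by
      rw [Multiset.sum_add, μ.2.parts_sum, Multiset.sum_replicate, smul_eq_mul]
      omega
    have hst : expo (μ.2.parts + Multiset.replicate (n - μ.1) 1) = stab n μ := by
      rw [expo_add, stab]
      congr 1
      generalize n - μ.1 = k
      induction k with
      | zero => simp
      | succ k ih =>
        rw [Multiset.replicate_succ, expo_cons, ih, Finsupp.single_add]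
        rfl
    rw [chi_eq l hpos hsum, hst, form_monomial (wt_stab h), one_mul, ← youngScalar_mul_dim l]
    have h1 := youngScalar_ne_zero l
    have h2 := dim_ne_zero l
    field_simp
  · rw [Nat.choose_eq_zero_of_lt (not_le.mp h)]
    simp

/-- The sum is rewritten through supports and cycle types in S_n, which behave well under
conjugation; the added parts 1 are the fixed points inside S. -/
lemma sum_perm_subtype_eq (μ : Part) {S : Finset (Fin n)} (hS : #S = μ.1) :
    ∑ τ : Perm S with τ.partition.parts = μ.2.parts, grp (Perm.ofSubtype τ) =
      ∑ σ : Perm (Fin n) with σ.support ⊆ S ∧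
        σ.cycleType + (μ.1 - σ.cycleType.sum) • ({1} : Multiset ℕ) = μ.2.parts, grp σ := by
  refine sum_bij (fun τ _ => Perm.ofSubtype τ) ?_ ?_ ?_ ?_
  · intro τ hτ
    rw [mem_filter, parts_partition', Fintype.card_coe, hS] at hτ
    rw [mem_filter, Perm.cycleType_ofSubtype]
    refine ⟨mem_univ _, fun i hi => ?_, hτ.2⟩
    by_contra h
    exact Perm.mem_support.mp hi (Perm.ofSubtype_apply_of_not_mem τ h)
  · intro τ _ τ' _ h
    exact Perm.ofSubtype_injective h
  · intro σ hσ
    obtain ⟨-, h1, h2⟩ := mem_filter.mp hσ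
    have h3 : ∀ i, i ∈ S ↔ σ i ∈ S := by
      intro i
      by_cases hi : i ∈ σ.support
      · exact ⟨fun _ => h1 (Perm.apply_mem_support.mpr hi), fun _ => h1 hi⟩
      · rw [Perm.notMem_support.mp hi]
    have h4 : Perm.ofSubtype (σ.subtypePerm (p := (· ∈ S)) fun i => (h3 i).symm) = σ := by
      refine Perm.ofSubtype_subtypePerm _ fun i hi => h1 (Perm.mem_support.mpr hi)
    refine ⟨σ.subtypePerm (p := (· ∈ S)) fun i => (h3 i).symm, ?_, h4⟩
    rw [mem_filter, parts_partition', Fintype.card_coe, hS, ← Perm.cycleType_ofSubtype, h4]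
    exact ⟨mem_univ _, h2⟩
  · intro τ _
    rfl

lemma classElt_mem_center (μ : Part) :
    classElt n μ ∈ Subalgebra.center ℂ (GroupAlg n) := by
  rw [mem_center_iff_grp]
  intro g
  have h : classElt n μ = ∑ S ∈ (univ : Finset (Fin n)).powersetCard μ.1,
      ∑ σ : Perm (Fin n) with σ.support ⊆ S ∧
        σ.cycleType + (μ.1 - σ.cycleType.sum) • ({1} : Multiset ℕ) = μ.2.parts, grp σ :=
    sum_congr rfl fun S hS => sum_perm_subtype_eq μ (mem_powersetCard.mp hS).2
  rw [h, mul_sum, sum_mul]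
  -- Conjugation by g carries the permutations supported in S to those supported in g(S) with the
  -- same cycle type.
  refine sum_bij' (fun S _ => S.map g.toEmbedding) (fun S _ => S.map g.symm.toEmbedding) ?_ ?_ ?_ ?_ ?_
  · intro S hS
    rw [mem_powersetCard] at *
    exact ⟨subset_univ _, by rw [card_map, hS.2]⟩
  · intro S hS
    rw [mem_powersetCard] at *
    exact ⟨subset_univ _, by rw [card_map, hS.2]⟩
  · intro S _
    ext i
    simp
  · intro S _
    ext i
    simp
  · intro S _
    rw [mul_sum, sum_mul]
    refine sum_equiv (MulAut.conj g).toEquiv ?_ ?_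
    · intro σ
      simp only [mem_filter, mem_univ, true_and, MulEquiv.toEquiv_eq_coe, MulEquiv.coe_toEquiv,
        MulAut.conj_apply, Perm.cycleType_conj, Perm.support_conj]
      rw [map_subset_map]
    · intro σ _
      simp [grp, MonoidAlgebra.single_mul_single]

lemma toGroupAlg_mem_center (c : ClassSpace) :
    toGroupAlg n c ∈ Subalgebra.center ℂ (GroupAlg n) := by
  rw [toGroupAlg, Finsupp.linearCombination_apply]
  exact Subalgebra.sum_mem _ fun μ _ => Subalgebra.smul_mem _ (classElt_mem_center μ) _

lemma phi_eq (c : ClassSpace) (l : Nat.Partition n) :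
    phi c ⟨n, l⟩ = (n.factorial : ℂ)⁻¹ * form n (toSer (toGroupAlg n c)) (schur l) := by
  rw [phi, toGroupAlg, Finsupp.linearCombination_apply, Finsupp.linearCombination_apply,
    Finsupp.sum, Finsupp.sum, Finset.sum_apply, map_sum, map_sum, LinearMap.sum_apply, mul_sum]
  refine sum_congr rfl fun μ _ => ?_
  rw [Pi.smul_apply, f_eq, map_smul, map_smul, LinearMap.smul_apply, smul_eq_mul, smul_eq_mul]
  ring

end

section

variable {n : ℕ}

/-! ### Class functions and quasi-homogeneous polynomials -/

lemma coeff_eq_of_cyc_eq {z : GroupAlg n} (hz : z ∈ Subalgebra.center ℂ (GroupAlg n))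
    {σ τ : Perm (Fin n)} (h : cyc σ = cyc τ) : z.coeff σ = z.coeff τ := by
  obtain ⟨g, rfl⟩ := isConj_iff.mp (cyc_eq_iff.mp h)
  have h1 := congrArg (fun x : GroupAlg n => x.coeff (g * σ)) (mem_center_iff_grp.mp hz g)
  simp only [grp, MonoidAlgebra.of_apply, MonoidAlgebra.coeff_single_mul_apply,
    MonoidAlgebra.coeff_mul_single_apply, one_mul, mul_one, inv_mul_cancel_left] at h1
  exact h1

lemma coeff_pMap_cyc {z : GroupAlg n} (hz : z ∈ Subalgebra.center ℂ (GroupAlg n))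
    (σ : Perm (Fin n)) : MvPolynomial.coeff (cyc σ) (pMap n z) =
      (#{τ : Perm (Fin n) | cyc τ = cyc σ} : ℂ) * z.coeff σ := by
  rw [coeff_pMap, sum_congr rfl fun τ hτ => coeff_eq_of_cyc_eq hz (mem_filter.mp hτ).2, sum_const,
    nsmul_eq_mul]

lemma card_cyc_ne_zero (σ : Perm (Fin n)) : (#{τ : Perm (Fin n) | cyc τ = cyc σ} : ℂ) ≠ 0 := by
  rw [Nat.cast_ne_zero]
  exact card_ne_zero_of_mem (mem_filter.mpr ⟨mem_univ σ, rfl⟩)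

/-- The map `p` identifies the class algebra with the quasi-homogeneous polynomials. -/
theorem bijOn_pMap : Set.BijOn (pMap n) (Subalgebra.center ℂ (GroupAlg n) : Set (GroupAlg n))
    (MvPolynomial.weightedHomogeneousSubmodule ℂ (fun k : ℕ+ => (k : ℕ)) n :
      Set (MvPolynomial ℕ+ ℂ)) := by
  refine ⟨fun z _ => ?_, fun z hz w hw h => ?_, fun P hP => ?_⟩
  · intro γ hγ
    rw [coeff_pMap] at hγ
    obtain ⟨σ, hσ, -⟩ := exists_ne_zero_of_sum_ne_zero hγ
    rw [← (mem_filter.mp hσ).2]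
    exact (wt_cyc σ).trans (Fintype.card_fin n)
  · ext σ
    have h1 := congrArg (MvPolynomial.coeff (cyc σ)) h
    rw [coeff_pMap_cyc hz, coeff_pMap_cyc hw] at h1
    exact mul_left_cancel₀ (card_cyc_ne_zero σ) h1
  -- The preimage spreads each coefficient of P evenly over the corresponding conjugacy class.
  · let u : Perm (Fin n) → ℂ := fun σ =>
      (#{τ : Perm (Fin n) | cyc τ = cyc σ} : ℂ)⁻¹ * MvPolynomial.coeff (cyc σ) P
    have hu : ∀ g σ, u (g * σ * g⁻¹) = u σ := fun g σ => by simp only [u, cyc_conj]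
    have hz : ∑ σ, u σ • grp σ ∈ Subalgebra.center ℂ (GroupAlg n) := by
      rw [mem_center_iff_grp]
      intro g
      rw [mul_sum, sum_mul]
      refine sum_equiv (MulAut.conj g).toEquiv (fun σ => by simp) fun σ _ => ?_
      change grp g * u σ • grp σ = u (g * σ * g⁻¹) • grp (g * σ * g⁻¹) * grp g
      rw [hu, smul_mul_assoc, mul_smul_comm, ← map_mul, ← map_mul, inv_mul_cancel_right]
    have hcoeff : ∀ σ, (∑ σ, u σ • grp σ).coeff σ = u σ := by
      intro σ
      rw [MonoidAlgebra.coeff_sum, Finsupp.finsetSum_apply]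
      simp only [MonoidAlgebra.coeff_smul, Finsupp.smul_apply, coeff_grp, smul_eq_mul, mul_ite,
        mul_one, mul_zero]
      simp
    refine ⟨_, hz, ?_⟩
    ext γ
    by_cases hγ : wt γ = n
    · obtain ⟨σ, rfl⟩ := exists_cyc_eq (α := Fin n) γ (hγ.trans (Fintype.card_fin n).symm)
      rw [coeff_pMap_cyc hz, hcoeff, mul_inv_cancel_left₀ (card_cyc_ne_zero σ)]
    · rw [← MvPolynomial.coeff_coe, coe_pMap, coeff_toSer_of_wt_ne _ hγ]
      by_contra h
      exact hγ (hP (Ne.symm h))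

/-! ### The completed cycles -/

lemma extend_self (F : Ser ℂ) : extend ℂ F = F := by
  ext γ
  rw [MvPowerSeries.coeff_map]
  rfl

lemma HasWt.ext_form {F G : Ser ℂ} (hF : HasWt n F) (hG : HasWt n G)
    (h : ∀ l : Nat.Partition n, form n F (schur l) = form n G (schur l)) : F = G := by
  rw [← sub_eq_zero]
  refine HasWt.eq_zero (n := n) (fun γ hγ => ?_) fun l => ?_
  · rw [map_sub, hF γ hγ, hG γ hγ, sub_zero]
  · rw [extend_self, map_sub, LinearMap.sub_apply, h, sub_self]

lemma HasWt.eq_sum_schur_complex {F : Ser ℂ} (hF : HasWt n F) : F = ∑ l : Nat.Partition n,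
    ((youngScalar l ^ 2)⁻¹ * form n F (schur l)) • schur l := by
  have h := hF.eq_sum_schur
  simp only [extend_self] at h
  exact h

lemma form_cutJoin_schur (j : ℕ) {F : Ser ℂ} (hF : HasWt n F) (l : Nat.Partition n) :
    form n (cutJoin j F) (schur l) = eigenvalue j l * form n F (schur l) := by
  conv_lhs => rw [hF.eq_sum_schur_complex]
  rw [map_sum, map_sum, LinearMap.sum_apply, sum_eq_single l]
  · rw [map_smul, cutJoin_schur, map_smul, map_smul, LinearMap.smul_apply, LinearMap.smul_apply,
      form_schur_self, smul_eq_mul, smul_eq_mul]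
    have := youngScalar_ne_zero l
    field_simp
  · intro m _ hm
    rw [map_smul, cutJoin_schur, map_smul, map_smul, LinearMap.smul_apply, LinearMap.smul_apply,
      form_schur_eq_zero hm, smul_zero, smul_zero]
  · intro h
    exact absurd (mem_univ l) h

lemma IsCompletedCycle.phi_eq {j : ℕ} {c : ClassSpace} (hc : IsCompletedCycle j c)
    (l : Nat.Partition n) : phi c ⟨n, l⟩ = eigenvalue j l := by
  rw [hc, Pi.smul_apply, smul_eq_mul, eigenvalue, div_eq_inv_mul]

/-- The map `p` transforms multiplication by a completed cycle into the completed cut-and-join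
operator. -/
theorem toSer_completedCycle_mul {j : ℕ} {c : ClassSpace} (hc : IsCompletedCycle j c)
    (x : GroupAlg n) : toSer (toGroupAlg n c * x) = cutJoin j (toSer x) := by
  refine (hasWt_toSer _).ext_form ((hasWt_toSer x).cutJoin j) fun l => ?_
  rw [form_toSer_center_mul l (toGroupAlg_mem_center c), form_cutJoin_schur j (hasWt_toSer x),
    ← CompletedCycles.phi_eq, hc.phi_eq]

/-- The forward direction multiplies the identity. Conversely, pairing with Schur functions recovers
φ(c), since the identity pairs to n! with each of them. -/
lemma isCompletedCycle_iff {j : ℕ} {c : ClassSpace} : IsCompletedCycle j c ↔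
    ∀ n, toSer (toGroupAlg n c) = cutJoin j (toSer (1 : GroupAlg n)) := by
  constructor
  · intro hc n
    rw [← toSer_completedCycle_mul hc, mul_one]
  · intro h
    funext ⟨n, l⟩
    rw [phi_eq, h, form_cutJoin_schur j (hasWt_toSer _), schur, form_toSer, traceForm_one,
      Pi.smul_apply, smul_eq_mul, eigenvalue]
    have := Nat.cast_ne_zero (R := ℂ).mpr (Nat.factorial_ne_zero n)
    field_simp

lemma toSer_toGroupAlg (c : ClassSpace) : toSer (toGroupAlg n c) =
    ∑ μ ∈ c.support, c μ • toSer (classElt n μ) := by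
  rw [toGroupAlg, Finsupp.linearCombination_apply, Finsupp.sum, map_sum]
  simp only [map_smul]

lemma card_conjClass_ne_zero (μ : Part) : (#(conjClass μ.1 μ.2.parts) : ℂ) ≠ 0 := by
  have hpos : ∀ a ∈ μ.2.parts, 0 < a := fun _ h => μ.2.parts_pos h
  rw [conjClass_eq hpos]
  obtain ⟨σ, hσ⟩ := exists_cyc_eq (α := Fin μ.1) (expo μ.2.parts)
    (by rw [wt_expo_parts, Fintype.card_fin])
  rw [← hσ]
  exact card_cyc_ne_zero σ

/-- In ℂS_d the classes of size above d act by 0, those of smaller size have coefficient 0 by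
induction, and those of size d give distinct monomials. -/
lemma eq_zero_of_toSer_toGroupAlg {c : ClassSpace} (h : ∀ n, toSer (toGroupAlg n c) = 0) :
    c = 0 := by
  ext ⟨d, μ⟩
  rw [Finsupp.zero_apply]
  induction d using Nat.strong_induction_on with
  | _ d ih =>
  have h1 := congrArg (MvPowerSeries.coeff (expo μ.parts)) (h d)
  rw [toSer_toGroupAlg, map_sum, map_zero, sum_eq_single ⟨d, μ⟩] at h1
  · rw [toSer_classElt, map_smul, map_smul, stab, Nat.sub_self, Finsupp.single_zero, add_zero,
      MvPowerSeries.coeff_monomial_same, Nat.choose_self, Nat.cast_one, one_mul] at h1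
    have h2 := card_conjClass_ne_zero ⟨d, μ⟩
    simpa [h2] using h1
  · rintro ⟨e, ν⟩ _ hne
    rcases lt_trichotomy e d with he | rfl | he
    · rw [ih e he ν, zero_smul, map_zero]
    · classical
      rw [toSer_classElt, map_smul, map_smul, stab, Nat.sub_self, Finsupp.single_zero, add_zero,
        MvPowerSeries.coeff_monomial_ne, smul_zero, smul_zero]
      intro h'
      exact hne (by rw [expo_parts_injective h'])
    · rw [toSer_classElt, Nat.choose_eq_zero_of_lt he, Nat.cast_zero, zero_mul, zero_smul, smul_zero,
        map_zero]
  · intro h'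
    rw [Finsupp.notMem_support_iff.mp h', zero_smul, map_zero]

lemma IsCompletedCycle.unique {j : ℕ} {c c' : ClassSpace} (hc : IsCompletedCycle j c)
    (hc' : IsCompletedCycle j c') : c = c' := by
  rw [← sub_eq_zero]
  refine eq_zero_of_toSer_toGroupAlg fun n => ?_
  rw [map_sub, map_sub, isCompletedCycle_iff.mp hc, isCompletedCycle_iff.mp hc', sub_self]

end

section

variable {n : ℕ}

/-! ### Existence of the completed cycles -/

lemma zee_single_one (b : ℕ) : zee (Finsupp.single 1 b) = b.factorial := by
  rw [zee, Finsupp.prod_single_index] <;> simp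

lemma toSer_one : toSer (1 : GroupAlg n) = MvPowerSeries.monomial (Finsupp.single 1 n) 1 := by
  have h : cyc (1 : Perm (Fin n)) = Finsupp.single 1 n := by
    have h1 := cyc_ofSubtype (n := n) (S := ∅) 1
    rw [map_one, card_empty, Nat.sub_zero] at h1
    rw [h1, eq_zero_of_wt (α := cyc (1 : Perm (∅ : Finset (Fin n)))) (by rw [wt_cyc]; simp),
      zero_add]
  rw [← h, ← toSer_grp, show grp (1 : Perm (Fin n)) = 1 from map_one _]

lemma diffOp_monomial_of_not_le {β : Expo} (h : ¬ β ≤ Finsupp.single 1 n) :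
    diffOp β (MvPowerSeries.monomial (Finsupp.single 1 n) 1 : Ser ℂ) = 0 := by
  classical
  ext γ
  rw [coeff_diffOp, MvPowerSeries.coeff_monomial_ne, mul_zero, map_zero]
  intro h'
  exact h (by rw [← h']; exact le_add_self)

lemma diffOp_monomial_single_one {b : ℕ} (hb : b ≤ n) :
    diffOp (Finsupp.single 1 b) (MvPowerSeries.monomial (Finsupp.single 1 n) 1 : Ser ℂ) =
      (n.descFactorial b : ℂ) • MvPowerSeries.monomial (Finsupp.single 1 (n - b)) 1 := by
  classical
  ext γ
  rw [coeff_diffOp, map_smul, MvPowerSeries.coeff_monomial, MvPowerSeries.coeff_monomial]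
  have h1 : (Finsupp.single 1 n : Expo) = Finsupp.single 1 (n - b) + Finsupp.single 1 b := by
    rw [← Finsupp.single_add, Nat.sub_add_cancel hb]
  by_cases h : γ = Finsupp.single 1 (n - b)
  · have h2 := Nat.factorial_mul_descFactorial hb
    rw [if_pos h, h, if_pos h1.symm, ← h1, zee_single_one, zee_single_one, ← h2]
    have := Nat.cast_ne_zero (R := ℂ).mpr (Nat.factorial_ne_zero (n - b))
    push_cast
    rw [mul_div_cancel_left₀ _ this]
    rfl
  · rw [if_neg h, if_neg, mul_zero, smul_zero]
    rw [h1]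
    exact fun h' => h (add_right_cancel h')

lemma eq_single_one_of_le {β : Expo} (h : β ≤ Finsupp.single 1 n) :
    β = Finsupp.single 1 (wt β) := by
  have h1 : β = Finsupp.single 1 (β 1) := by
    ext k
    by_cases hk : k = 1
    · rw [hk, Finsupp.single_eq_same]
    · rw [Finsupp.single_eq_of_ne hk]
      have := h k
      rw [Finsupp.single_eq_of_ne hk] at this
      exact Nat.le_zero.mp this
  have h2 : wt β = β 1 := by
    conv_lhs => rw [h1, wt_single]
    simp
  rw [h2]
  exact h1

/-- The coefficients of the completed cycles. -/
def cycleWeight (j : ℕ) (α : Expo) : ℂ :=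
  zetaQuot j (expCoeff (powDiff expHalf expNegHalf) α *
    expCoeff (powDiff expHalf expNegHalf) (Finsupp.single 1 (wt α)))

/-- With w the weight of α, the factor from p_1^w is a multiple of ζ(z)^w. Dividing by ζ(z) leaves
ζ(z)^{w-1}, which is divisible by z^{w-1}. -/
lemma cycleWeight_eq_zero {j : ℕ} {α : Expo} (h : j + 1 < wt α) : cycleWeight j α = 0 := by
  obtain ⟨b, hb⟩ : ∃ b, wt α = b + 1 := ⟨wt α - 1, by omega⟩
  have h1 : expCoeff (powDiff expHalf expNegHalf) (Finsupp.single 1 (b + 1)) =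
      zeta 1 * (algebraMap ℂ (PowerSeries ℂ) ((b + 1).factorial : ℂ)⁻¹ * zeta 1 ^ b) := by
    rw [expCoeff, zee_single_one, Finsupp.prod_single_index (by simp), powDiff_expHalf, PNat.one_coe,
      Nat.cast_one]
    ring
  have h2 : PowerSeries.X ^ b ∣ zeta 1 ^ b := by
    refine pow_dvd_pow_of_dvd (PowerSeries.X_dvd_iff.mpr ?_) b
    rw [← PowerSeries.coeff_zero_eq_constantCoeff_apply, zeta, map_sub, PowerSeries.coeff_rescale,
      PowerSeries.coeff_rescale, pow_zero, pow_zero, sub_self]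
  rw [cycleWeight, hb, h1, mul_left_comm, zetaQuot_mul]
  refine (PowerSeries.X_pow_dvd_iff (n := b)).mp ?_ j (by omega)
  exact (h2.mul_left _).mul_left _

/-- The part of the completed cut-and-join operator on `p₁ⁿ` that moves `b` points. -/
def movedPart (j n b : ℕ) : Ser ℂ := ∑ α ∈ expos b, (cycleWeight j α * n.descFactorial b) •
  MvPowerSeries.monomial (α + Finsupp.single 1 (n - b)) 1

lemma movedPart_eq_zero_of_lt {j n b : ℕ} (h : n < b) : movedPart j n b = 0 := by
  rw [movedPart, Nat.descFactorial_eq_zero_iff_lt.mpr h]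
  simp

lemma movedPart_eq_zero {j n b : ℕ} (h : j + 1 < b) : movedPart j n b = 0 := by
  refine sum_eq_zero fun α hα => ?_
  rw [cycleWeight_eq_zero (by rw [mem_expos.mp hα]; exact h), zero_mul, zero_smul]

/-- Terms with b > n and terms with b > j + 1 all vanish, so the range of summation can be made
independent of n. -/
lemma sum_movedPart {j n : ℕ} :
    ∑ b ∈ Icc 1 n, movedPart j n b = ∑ b ∈ Icc 1 (j + 1), movedPart j n b := by
  have h1 : ∑ b ∈ Icc 1 n, movedPart j n b = ∑ b ∈ Icc 1 (max n (j + 1)), movedPart j n b := by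
    refine sum_subset (Icc_subset_Icc_right (le_max_left _ _)) fun b hb hb' => ?_
    rw [mem_Icc] at hb hb'
    exact movedPart_eq_zero_of_lt (by omega)
  have h2 : ∑ b ∈ Icc 1 (j + 1), movedPart j n b =
      ∑ b ∈ Icc 1 (max n (j + 1)), movedPart j n b := by
    refine sum_subset (Icc_subset_Icc_right (le_max_right _ _)) fun b hb hb' => ?_
    rw [mem_Icc] at hb hb'
    exact movedPart_eq_zero (by omega)
  rw [h1, h2]

lemma hasWt_movedPart {j n b : ℕ} : HasWt n (movedPart j n b) := by
  classical
  rcases lt_or_ge n b with h | h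
  · rw [movedPart_eq_zero_of_lt h]
    intro γ _
    simp
  · intro γ hγ
    rw [movedPart, map_sum]
    refine sum_eq_zero fun α hα => ?_
    rw [map_smul, MvPowerSeries.coeff_monomial_ne, smul_zero]
    rintro rfl
    refine hγ ?_
    rw [map_add, mem_expos.mp hα, wt_single, PNat.one_coe]
    omega

/-- The identity corresponds to p_1^n, on which only powers of ∂/∂p_1 act nontrivially; the
exponents (0, 0) are absent from Q. -/
lemma cutJoin_toSer_one (j n : ℕ) :
    cutJoin j (toSer (1 : GroupAlg n)) = ∑ b ∈ Icc 1 n, movedPart j n b := by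
  ext N
  by_cases hN : wt N = n
  · rw [cutJoin_apply, coeff_Q, hN, expoPairs, sum_filter, sum_biUnion]
    · rw [map_sum, range_eq_Ico, sum_eq_sum_Ico_succ_bot (Nat.succ_pos n)]
      have h0 : ∑ x ∈ expos 0 ×ˢ expos 0, (if x ≠ 0 then
          zetaQuot j (expCoeff (powDiff expHalf expNegHalf) x.1 *
            expCoeff (powDiff expHalf expNegHalf) x.2) *
          MvPowerSeries.coeff N (MvPowerSeries.monomial x.1 1 *
            diffOp x.2 (toSer (1 : GroupAlg n))) else 0) = 0 := by
        refine sum_eq_zero fun x hx => if_neg (not_not.mpr ?_)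
        rw [expos_zero, mem_product, mem_singleton, mem_singleton] at hx
        exact Prod.ext hx.1 hx.2
      rw [h0, zero_add]
      refine sum_congr rfl fun b hb => ?_
      have hb' : 1 ≤ b ∧ b ≤ n := by
        have := mem_Ico.mp hb
        omega
      rw [sum_product, movedPart, map_sum]
      refine sum_congr rfl fun α hα => ?_
      rw [mem_expos] at hα
      rw [sum_eq_single (Finsupp.single 1 b)]
      · rw [if_pos, toSer_one, diffOp_monomial_single_one hb'.2, mul_smul_comm, map_smul, map_smul,
          MvPowerSeries.monomial_mul_monomial, one_mul, cycleWeight, hα, smul_eq_mul, smul_eq_mul,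
          mul_assoc]
        intro h
        have := congrArg (fun x : Expo × Expo => wt x.1) h
        simp only [Prod.fst_zero, map_zero] at this
        omega
      · intro β hβ hne
        rw [toSer_one, diffOp_monomial_of_not_le, mul_zero, map_zero, mul_zero, ite_self]
        intro hle
        refine hne ?_
        rw [eq_single_one_of_le (β := β) hle, mem_expos.mp hβ]
      · intro h
        exact absurd (by rw [mem_expos, wt_single]; simp) h
    · intro a _ b _ hab
      rw [Function.onFun, disjoint_left]
      intro x hx hx'
      rw [mem_product, mem_expos] at hx hx'
      exact hab (hx.1.symm.trans hx'.1)
  · rw [(hasWt_toSer _).cutJoin j N hN, map_sum]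
    symm
    exact sum_eq_zero fun b _ => hasWt_movedPart N hN

/-- The completed cycle. -/
def completedCycle (j : ℕ) : ClassSpace := ∑ b ∈ Icc 1 (j + 1), ∑ μ : Nat.Partition b,
  Finsupp.single ⟨b, μ⟩ (zee (expo μ.parts) * cycleWeight j (expo μ.parts))

lemma isCompletedCycle_completedCycle (j : ℕ) : IsCompletedCycle j (completedCycle j) := by
  rw [isCompletedCycle_iff]
  intro n
  rw [cutJoin_toSer_one, sum_movedPart, completedCycle, map_sum, map_sum]
  refine sum_congr rfl fun b _ => ?_
  rw [map_sum, map_sum, movedPart, sum_expos_eq_sum_partition]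
  refine sum_congr rfl fun μ _ => ?_
  rw [toGroupAlg, Finsupp.linearCombination_single, map_smul, toSer_classElt, smul_smul, stab]
  congr 1
  -- The class size times `zee` is b!, which turns the binomial coefficient of the class action into
  -- the falling factorial of the derivative.
  have h := card_cyc_mul_zee (α := Fin b) (expo μ.parts) (by rw [wt_expo_parts, Fintype.card_fin])
  rw [← conjClass_eq fun _ h => μ.parts_pos h, Fintype.card_fin] at h
  rw [Nat.descFactorial_eq_factorial_mul_choose, ← h]
  push_cast
  ring

/-- The completed cycles are well defined. -/
theorem existsUnique_isCompletedCycle (j : ℕ) : ∃! c, IsCompletedCycle j c :=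
  ⟨completedCycle j, isCompletedCycle_completedCycle j,
    fun _ hc => hc.unique (isCompletedCycle_completedCycle j)⟩

end

section

/-! ### Slices of power series -/

section

variable {σ : Type} (v : ℕ+ → σ) (M : σ →₀ ℕ)

/-- The power series in the variables `v k` that is the coefficient of a monomial `M` in the other
variables. -/
def slice : MvPowerSeries σ ℂ →ₗ[ℂ] Ser ℂ where
  toFun F := fun γ => MvPowerSeries.coeff (γ.mapDomain v + M) F
  map_add' _ _ := by
    ext γ
    exact map_add (MvPowerSeries.coeff (γ.mapDomain v + M)) _ _
  map_smul' r F := by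
    ext γ
    exact map_smul (MvPowerSeries.coeff (γ.mapDomain v + M)) r F

lemma coeff_slice (F : MvPowerSeries σ ℂ) (γ : Expo) :
    MvPowerSeries.coeff γ (slice v M F) = MvPowerSeries.coeff (γ.mapDomain v + M) F := rfl

variable {v M}

lemma slice_X_mul (hv : Function.Injective v) (hM : ∀ k, M (v k) = 0) (k : ℕ+)
    (F : MvPowerSeries σ ℂ) :
    slice v M (MvPowerSeries.X (v k) * F) = MvPowerSeries.X k * slice v M F := by
  classical
  ext γ
  rw [coeff_slice, MvPowerSeries.X, MvPowerSeries.X, MvPowerSeries.coeff_monomial_mul,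
    MvPowerSeries.coeff_monomial_mul]
  by_cases h : Finsupp.single k 1 ≤ γ
  · obtain ⟨δ, rfl⟩ := exists_add_of_le h
    rw [if_pos h, if_pos, Finsupp.mapDomain_add, Finsupp.mapDomain_single, add_tsub_cancel_left,
      add_assoc, add_tsub_cancel_left, coeff_slice]
    rw [Finsupp.mapDomain_add, Finsupp.mapDomain_single, add_assoc]
    exact le_self_add
  · rw [if_neg h, if_neg]
    intro h'
    refine h ?_
    rw [Finsupp.single_le_iff] at h' ⊢
    rwa [Finsupp.add_apply, Finsupp.mapDomain_apply hv, hM, add_zero] at h'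

lemma slice_pderiv (hv : Function.Injective v) (hM : ∀ k, M (v k) = 0) (k : ℕ+)
    (F : MvPowerSeries σ ℂ) :
    slice v M (MvPowerSeries.pderiv ℂ (v k) F) = MvPowerSeries.pderiv ℂ k (slice v M F) := by
  ext γ
  rw [coeff_slice, MvPowerSeries.coeff_pderiv, MvPowerSeries.coeff_pderiv, coeff_slice,
    Finsupp.mapDomain_add, Finsupp.mapDomain_single, Finsupp.add_apply,
    Finsupp.mapDomain_apply hv, hM, add_zero, add_right_comm]

lemma slice_a (hv : Function.Injective v) (hM : ∀ k, M (v k) = 0) (i : ℤ)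
    (F : MvPowerSeries σ ℂ) : slice v M (a v i F) = a (fun k : ℕ+ => k) i (slice v M F) := by
  match i with
  | Int.ofNat 0 => exact map_zero _
  | Int.ofNat (k + 1) =>
    change slice v M (((k + 1 : ℕ) : ℂ) • MvPowerSeries.pderiv ℂ (v k.succPNat) F) =
      ((k + 1 : ℕ) : ℂ) • MvPowerSeries.pderiv ℂ k.succPNat (slice v M F)
    rw [map_smul, slice_pderiv hv hM]
  | Int.negSucc k => exact slice_X_mul hv hM k.succPNat F

lemma slice_prod_map_a (hv : Function.Injective v) (hM : ∀ k, M (v k) = 0) (k : List ℤ)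
    (F : MvPowerSeries σ ℂ) :
    slice v M ((k.map (a v)).prod F) = (k.map (a fun k : ℕ+ => k)).prod (slice v M F) := by
  induction k with
  | nil => rfl
  | cons i k ih =>
    rw [List.map_cons, List.prod_cons, Module.End.mul_apply, slice_a hv hM, ih, List.map_cons,
      List.prod_cons, Module.End.mul_apply]

/-- The operator involves only the variables v k, which do not occur in M, so it commutes with each
term of the coefficientwise sum. -/
lemma slice_Q (hv : Function.Injective v) (hM : ∀ k, M (v k) = 0) (j : ℕ)
    (F : MvPowerSeries σ ℂ) : slice v M (Q v j F) = cutJoin j (slice v M F) := by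
  ext γ
  refine finsum_congr fun k => ?_
  have h : slice v M (normalOrdered v k.1 F) =
      normalOrdered (fun k : ℕ+ => k) k.1 (slice v M F) := by
    unfold normalOrdered
    rw [Module.End.mul_apply, Module.End.mul_apply, slice_prod_map_a hv hM, slice_prod_map_a hv hM]
  rw [← coeff_slice, map_smul, h]

end

/-! ### The generating series of double Hurwitz numbers -/

lemma p_injective : Function.Injective HVar.p := fun _ _ h => HVar.p.inj h

lemma q_injective : Function.Injective HVar.q := fun _ _ h => HVar.q.inj h

/-- The exponents of the monomial `β^s q^ν`. -/
def outerExpo (s : ℕ) (ν : Expo) : HVar →₀ ℕ :=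
  Finsupp.single HVar.β s + ν.mapDomain HVar.q

lemma outerExpo_p (s : ℕ) (ν : Expo) (k : ℕ+) : outerExpo s ν (HVar.p k) = 0 := by
  classical
  rw [outerExpo, Finsupp.add_apply, Finsupp.mapDomain_of_notMem_range, Finsupp.single_apply,
    if_neg (by simp), add_zero]
  rintro ⟨j, hj⟩
  cases hj

lemma outerExpo_q (s : ℕ) (ν : Expo) (k : ℕ+) : outerExpo s ν (HVar.q k) = ν k := by
  classical
  rw [outerExpo, Finsupp.add_apply, Finsupp.mapDomain_apply q_injective, Finsupp.single_apply,
    if_neg (by simp), zero_add]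

lemma outerExpo_β (s : ℕ) (ν : Expo) : outerExpo s ν HVar.β = s := by
  classical
  rw [outerExpo, Finsupp.add_apply, Finsupp.mapDomain_of_notMem_range, Finsupp.single_eq_same,
    add_zero]
  rintro ⟨j, hj⟩
  cases hj

lemma mapDomain_p_apply_p (γ : Expo) (k : ℕ+) : γ.mapDomain HVar.p (HVar.p k) = γ k :=
  Finsupp.mapDomain_apply p_injective γ k

lemma mapDomain_p_apply_q (γ : Expo) (k : ℕ+) : γ.mapDomain HVar.p (HVar.q k) = 0 := by
  refine Finsupp.mapDomain_of_notMem_range _ _ ?_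
  rintro ⟨j, hj⟩
  cases hj

lemma mapDomain_p_apply_β (γ : Expo) : γ.mapDomain HVar.p HVar.β = 0 := by
  refine Finsupp.mapDomain_of_notMem_range _ _ ?_
  rintro ⟨j, hj⟩
  cases hj

lemma expo_hvar_injective {s s' : ℕ} {γ γ' ν ν' : Expo}
    (h : γ.mapDomain HVar.p + outerExpo s ν = γ'.mapDomain HVar.p + outerExpo s' ν') :
    s = s' ∧ γ = γ' ∧ ν = ν' := by
  refine ⟨?_, ?_, ?_⟩
  · have := DFunLike.congr_fun h HVar.β
    simpa [outerExpo_β, mapDomain_p_apply_β] using this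
  · ext k
    have := DFunLike.congr_fun h (HVar.p k)
    simpa [outerExpo_p, mapDomain_p_apply_p] using this
  · ext k
    have := DFunLike.congr_fun h (HVar.q k)
    simpa [outerExpo_q, mapDomain_p_apply_q] using this

lemma exists_expo_hvar (N : HVar →₀ ℕ) :
    ∃ (s : ℕ) (γ ν : Expo), N = γ.mapDomain HVar.p + outerExpo s ν := by
  refine ⟨N HVar.β, N.comapDomain _ p_injective.injOn, N.comapDomain _ q_injective.injOn, ?_⟩
  ext x
  rw [Finsupp.add_apply]
  cases x with
  | β => rw [outerExpo_β, mapDomain_p_apply_β, zero_add]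
  | p k => rw [outerExpo_p, mapDomain_p_apply_p, add_zero]; rfl
  | q k => rw [outerExpo_q, mapDomain_p_apply_q, zero_add]; rfl

lemma prod_map_X_eq {ι τ : Type} (w : ι → τ) (k : List ι) :
    (k.map fun i => (MvPowerSeries.X (w i) : MvPowerSeries τ ℂ)).prod =
      MvPowerSeries.monomial ((wordExpo k).mapDomain w) 1 := by
  induction k with
  | nil =>
    rw [wordExpo_nil, Finsupp.mapDomain_zero, MvPowerSeries.monomial_zero_one]
    rfl
  | cons i k ih =>
    rw [List.map_cons, List.prod_cons, ih, wordExpo_cons, Finsupp.mapDomain_add,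
      Finsupp.mapDomain_single, MvPowerSeries.X, MvPowerSeries.monomial_mul_monomial, one_mul,
      add_comm]

lemma profile_cons (k : ℕ+) (μ : List ℕ+) : profile (k :: μ) = (k : ℕ) ::ₘ profile μ := rfl

lemma expo_profile (μ : List ℕ+) : expo (profile μ) = wordExpo μ := by
  induction μ with
  | nil =>
    rw [wordExpo_nil]
    exact expo_zero
  | cons k μ ih =>
    rw [profile_cons, expo_cons, ih, wordExpo_cons, PNat.coe_toPNat']

lemma profile_pos (μ : List ℕ+) : ∀ a ∈ profile μ, 0 < a := by
  induction μ with
  | nil => exact fun a ha => absurd ha (Multiset.notMem_zero a)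
  | cons k μ ih =>
    intro a ha
    rw [profile_cons] at ha
    rcases Multiset.mem_cons.mp ha with rfl | ha
    · exact k.pos
    · exact ih a ha

lemma sum_profile (μ : List ℕ+) : (profile μ).sum = wt (wordExpo μ) := by
  rw [← expo_profile, wt_expo (profile_pos μ)]

lemma zee_wordExpo (μ : List ℕ+) : (zee (wordExpo μ) : ℂ) =
    (profile μ).prod * (wordExpo μ).prod fun _ m => (m.factorial : ℂ) := by
  have h : (profile μ).prod = (wordExpo μ).prod fun k m => (k : ℕ) ^ m := by
    rw [← list_prod_map_eq]
    induction μ with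
    | nil => rfl
    | cons k μ ih => rw [profile_cons, Multiset.prod_cons, ih, List.map_cons, List.prod_cons]
  rw [h, zee]
  simp only [Finsupp.prod, prod_mul_distrib]
  push_cast
  rfl

/-- The centralizer orders in the character values contain the products of parts, which cancel
against the denominator and leave factorials of multiplicities. -/
lemma hurwitz_eq {n : ℕ} (r s : ℕ) {μ ν : List ℕ+} (hμ : wt (wordExpo μ) = n)
    (hν : wt (wordExpo ν) = n) :
    hurwitz r s μ ν = ((wordExpo μ).prod fun _ m => (m.factorial : ℂ)) *
      ((wordExpo ν).prod fun _ m => (m.factorial : ℂ)) *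
      ∑ l : Nat.Partition n, (youngScalar l ^ 2)⁻¹ * eigenvalue (r + 1) l ^ s *
        (MvPowerSeries.coeff (wordExpo μ) (schur l) *
          MvPowerSeries.coeff (wordExpo ν) (schur l)) := by
  rw [← sum_profile] at hμ hν
  subst hμ
  have h1 : ((profile μ).prod : ℂ) ≠ 0 := by
    intro h
    have h2 := zee_wordExpo μ
    rw [h, zero_mul] at h2
    exact zee_ne_zero _ h2
  have h2 : ((profile ν).prod : ℂ) ≠ 0 := by
    intro h
    have h2 := zee_wordExpo ν
    rw [h, zero_mul] at h2
    exact zee_ne_zero _ h2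
  rw [hurwitz, if_pos hν.symm, mul_sum, sum_div]
  refine sum_congr rfl fun l _ => ?_
  rw [chi_eq l (profile_pos μ) rfl, chi_eq l (profile_pos ν) hν, expo_profile, expo_profile,
    zee_wordExpo, zee_wordExpo, eigenvalue]
  field_simp

/-- The coefficients of the generating series. -/
lemma coeff_H (r s : ℕ) (γ ν : Expo) :
    MvPowerSeries.coeff (γ.mapDomain HVar.p + outerExpo s ν) (H r) =
      (s.factorial : ℂ)⁻¹ * ∑ l : Nat.Partition (wt ν), (youngScalar l ^ 2)⁻¹ *
        eigenvalue (r + 1) l ^ s *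
        (MvPowerSeries.coeff γ (schur l) * MvPowerSeries.coeff ν (schur l)) := by
  classical
  have hterm : ∀ x : ℕ × List ℕ+ × List ℕ+,
      (MvPowerSeries.X HVar.β ^ x.1 * (x.2.1.map fun k => MvPowerSeries.X (HVar.p k)).prod *
        (x.2.2.map fun k => MvPowerSeries.X (HVar.q k)).prod : MvPowerSeries HVar ℂ) =
      MvPowerSeries.monomial ((wordExpo x.2.1).mapDomain HVar.p +
        outerExpo x.1 (wordExpo x.2.2)) 1 := by
    intro x
    rw [MvPowerSeries.X_pow_eq, prod_map_X_eq, prod_map_X_eq, MvPowerSeries.monomial_mul_monomial,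
      MvPowerSeries.monomial_mul_monomial, one_mul, one_mul, outerExpo]
    congr 1
    abel_nf
  change ∑ᶠ x : ℕ × List ℕ+ × List ℕ+, MvPowerSeries.coeff _ (_ • _) = _
  simp only [hterm, map_smul, smul_eq_mul]
  -- Only sequences with exponents γ and ν contribute. Counting them against the factorials of their
  -- lengths cancels the factorials of the multiplicities.
  rw [finsum_eq_sum_of_support_subset
    (s := {s} ×ˢ words (Finsupp.toMultiset γ) ×ˢ words (Finsupp.toMultiset ν))]
  · have hconst : ∀ x ∈ {s} ×ˢ words (Finsupp.toMultiset γ) ×ˢ words (Finsupp.toMultiset ν),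
        hurwitz r x.1 x.2.1 x.2.2 / ((x.1.factorial : ℂ) * (x.2.1.length.factorial : ℂ) *
          (x.2.2.length.factorial : ℂ)) * MvPowerSeries.coeff
          (γ.mapDomain HVar.p + outerExpo s ν) (MvPowerSeries.monomial
            ((wordExpo x.2.1).mapDomain HVar.p + outerExpo x.1 (wordExpo x.2.2)) (1 : ℂ)) =
        ((Finsupp.toMultiset γ).card.factorial : ℂ)⁻¹ *
          ((Finsupp.toMultiset ν).card.factorial : ℂ)⁻¹ *
        ((γ.prod fun _ m => (m.factorial : ℂ)) * (ν.prod fun _ m => (m.factorial : ℂ)) *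
        ((s.factorial : ℂ)⁻¹ * ∑ l : Nat.Partition (wt ν), (youngScalar l ^ 2)⁻¹ *
        eigenvalue (r + 1) l ^ s *
        (MvPowerSeries.coeff γ (schur l) * MvPowerSeries.coeff ν (schur l)))) := by
      rintro ⟨s', μ, ν'⟩ hx
      obtain ⟨h1, h2'⟩ := mem_product.mp hx
      obtain ⟨h2, h3⟩ := mem_product.mp h2'
      rw [mem_singleton] at h1
      have h4 := wordExpo_eq_iff.mpr h2
      have h5 := wordExpo_eq_iff.mpr h3
      simp only at h1 h4 h5 ⊢
      subst h1 h4 h5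
      rw [MvPowerSeries.coeff_monomial_same, mul_one, ← mem_words.mp h2, ← mem_words.mp h3,
        Multiset.coe_card, Multiset.coe_card]
      by_cases hw : wt (wordExpo μ) = wt (wordExpo ν')
      · rw [hurwitz_eq r s' hw rfl]
        field_simp
      -- For unequal weights the Hurwitz number is 0 by convention, in agreement with the vanishing
      -- of the Schur coefficients.
      · rw [hurwitz, if_neg (by rwa [sum_profile, sum_profile]), zero_div]
        symm
        rw [sum_eq_zero, mul_zero, mul_zero, mul_zero]
        intro l _
        rw [hasWt_schur l _ hw, zero_mul, mul_zero]
    rw [sum_congr rfl hconst, sum_const, card_product, card_product, card_singleton, one_mul,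
      nsmul_eq_mul, Nat.cast_mul]
    have h1 := card_words_toMultiset_mul γ
    have h2 := card_words_toMultiset_mul ν
    have h3 : (γ.prod fun _ m => (m.factorial : ℂ)) ≠ 0 :=
      prod_ne_zero_iff.mpr fun i _ => Nat.cast_ne_zero.mpr (Nat.factorial_ne_zero _)
    have h4 : (ν.prod fun _ m => (m.factorial : ℂ)) ≠ 0 :=
      prod_ne_zero_iff.mpr fun i _ => Nat.cast_ne_zero.mpr (Nat.factorial_ne_zero _)
    generalize (∑ l : Nat.Partition (wt ν), (youngScalar l ^ 2)⁻¹ * eigenvalue (r + 1) l ^ s *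
        (MvPowerSeries.coeff γ (schur l) * MvPowerSeries.coeff ν (schur l))) = y
    have h5 := inv_mul_cancel₀ h3
    have h6 := inv_mul_cancel₀ h4
    rw [← h1] at h5
    rw [← h2] at h6
    linear_combination ((s.factorial : ℂ)⁻¹ * y * ((#(words (Finsupp.toMultiset ν)) : ℂ) *
      (((Finsupp.toMultiset ν).card.factorial : ℂ))⁻¹ *
      (ν.prod fun _ m => (m.factorial : ℂ)))) * h5 + ((s.factorial : ℂ)⁻¹ * y) * h6
  · intro x hx
    rw [mem_coe, mem_product, mem_product, mem_singleton, ← wordExpo_eq_iff, ← wordExpo_eq_iff]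
    by_contra h
    refine hx ?_
    simp only
    rw [MvPowerSeries.coeff_monomial_ne, mul_zero]
    intro h'
    obtain ⟨h1, h2, h3⟩ := expo_hvar_injective h'
    exact h ⟨h1.symm, h2.symm, h3.symm⟩

lemma slice_H (r s : ℕ) (ν : Expo) : slice HVar.p (outerExpo s ν) (H r) =
    ∑ l : Nat.Partition (wt ν), ((s.factorial : ℂ)⁻¹ * ((youngScalar l ^ 2)⁻¹ *
      eigenvalue (r + 1) l ^ s * MvPowerSeries.coeff ν (schur l))) • schur l := by
  ext γ
  rw [coeff_slice, coeff_H, mul_sum, map_sum]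
  refine sum_congr rfl fun l _ => ?_
  rw [map_smul, smul_eq_mul]
  ring

/-- The evolution equation of the generating series. -/
theorem pderiv_H (r : ℕ) : MvPowerSeries.pderiv ℂ HVar.β (H r) = Q HVar.p (r + 1) (H r) := by
  ext N
  obtain ⟨s, γ, ν, rfl⟩ := exists_expo_hvar N
  rw [← coeff_slice HVar.p _ (Q HVar.p (r + 1) (H r)),
    slice_Q p_injective (outerExpo_p s ν), slice_H, MvPowerSeries.coeff_pderiv, Finsupp.add_apply,
    mapDomain_p_apply_β, outerExpo_β, zero_add]
  have h1 : γ.mapDomain HVar.p + outerExpo s ν + Finsupp.single HVar.β 1 =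
      γ.mapDomain HVar.p + outerExpo (s + 1) ν := by
    rw [outerExpo, outerExpo, Finsupp.single_add]
    abel
  rw [h1, ← coeff_slice, slice_H, map_sum, map_sum, map_sum, sum_mul]
  -- For each shape the claim is (s + 1) e^{s+1}/(s + 1)! = e · e^s/s!, where e is the eigenvalue.
  refine sum_congr rfl fun l _ => ?_
  rw [map_smul, map_smul, map_smul, cutJoin_schur, map_smul, Nat.factorial_succ]
  simp only [smul_eq_mul]
  have := Nat.cast_ne_zero (R := ℂ).mpr (Nat.factorial_ne_zero s)
  have h2 : (s : ℂ) + 1 ≠ 0 := by exact_mod_cast Nat.succ_ne_zero s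
  push_cast
  field_simp
  ring

end

end CompletedCycles

end

/-! ### Assembly of the theorem -/

open CompletedCycles in
theorem theorem5p2 (r : ℕ) :
    (∃! c : ClassSpace, IsCompletedCycle (r + 1) c) ∧
    (∀ n : ℕ, Set.BijOn (pMap n) (Subalgebra.center ℂ (GroupAlg n) : Set (GroupAlg n))
      (MvPolynomial.weightedHomogeneousSubmodule ℂ (fun k : ℕ+ => (k : ℕ)) n :
        Set (MvPolynomial ℕ+ ℂ))) ∧
    (∀ c : ClassSpace, IsCompletedCycle (r + 1) c →
      ∀ (n : ℕ), ∀ x ∈ Subalgebra.center ℂ (GroupAlg n),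
        toGroupAlg n c * x ∈ Subalgebra.center ℂ (GroupAlg n) ∧
        (pMap n (toGroupAlg n c * x) : MvPowerSeries ℕ+ ℂ) =
          Q (fun k => k) (r + 1) (pMap n x : MvPowerSeries ℕ+ ℂ)) ∧
    MvPowerSeries.pderiv ℂ HVar.β (H r) = Q HVar.p (r + 1) (H r) := by
  exact ⟨existsUnique_isCompletedCycle (r + 1), fun n => bijOn_pMap, fun c hc n x hx =>
    ⟨Subalgebra.mul_mem _ (toGroupAlg_mem_center c) hx, by
      rw [coe_pMap, coe_pMap, toSer_completedCycle_mul hc]; rfl⟩, pderiv_H r⟩
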